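/- **Setting.** Let $F$ be a totally real number field, $r$ an odd prime, $L=F(\zeta_r)$ with $[L:F]=2$, and fix an embedding $L\hookrightarrow\mathbb C$. Let $S'$ be a finite set of finite places of $L$, stable under $\mathrm{Gal}(L/F)$, containing all places dividing $r$, and such that the ring of $S'$-integers $\mathcal O_L^{S'}$ is a principal ideal domain. Let $\psi$, $\rho$ be unitary Hecke characters of $L$, $F$, unramified outside $S'$, regarded as completely multiplicative functions on ideals prime to $S'$ (so $\psi(\mathfrak h)=\psi(\mathfrak h\mathcal O_L)$ for an ideal $\mathfrak h$ of $F$). Let $\mathcal I_L(S)$, $\mathcal I_F(S)$ be the nonzero integral ideals, and $I_L(S)$, $I_F(S)$ the fractional ideals, prime to $S'$. For a place $v$, $q_v$ is its norm, $\psi(\pi_v)$ the value of $\psi$ at the corresponding prime ideal (likewise for other characters). Empty products are $1$. **Residue symbol.** Let $\mathfrak c=\prod_{v\in S'}\mathfrak P_v^{r_v}$, with $r_v=1$ if $v\nmid r$ and with $r_v$ so large that every $a\in L_v$ with $\mathrm{ord}_v(a-1)\ge r_v$ is in $(L_v^\times)^r$. Let $P_L(\mathfrak c)$ be the group of principal ideals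 $(\alpha)$ with $\alpha\equiv1\bmod\mathfrak c$, and $R_{\mathfrak c}=(I_L(S)/P_L(\mathfrak c))\otimes\mathbb Z/r$. Choose integral ideals $\mathfrak e_{0,1},\dots,\mathfrak e_{0,d}$ in $\mathcal I_L(S)$ whose classes form a basis of the $\mathbb F_r$-vector space $R_{\mathfrak c}$, and $m_{0,j}\in L^\times$ with $\mathfrak e_{0,j}\mathcal O_L^{S'}=m_{0,j}\mathcal O_L^{S'}$. For $\mathfrak e=\prod_j\mathfrak e_{0,j}^{\lambda_j}$ with $0\le\lambda_j<r$ put $m_{\mathfrak e}=\prod_j m_{0,j}^{\lambda_j}$. The choices are assumed to be such that ideals of $F$ have real decompositions: every prime $\mathfrak n\in\mathcal I_F(S)$ (hence, up to $r$-th powers in the generator, every $\mathfrak n\in\mathcal I_F(S)$) can be written $\mathfrak n=(m)\,\mathfrak e\,\mathfrak g^r$ with $m\in F^\times$, $m\equiv1\bmod\mathfrak c$, $\mathfrak e$ as above, $\mathfrak e,\mathfrak g\in I_F(S)$ and $m_{\mathfrak e}\in F^\times$. For $\mathfrak n\in\mathcal I_F(S)$ and $\mathfrak m\in\mathcal I_L(S)$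 coprime, $\chi_{\mathfrak n}(\mathfrak m)=\big(\tfrac{m\,m_{\mathfrak e}}{\mathfrak m}\big)_r$ is the $r$-th power residue symbol for such a decomposition of $\mathfrak n$, where decompositions are chosen for the primes and multiplied; if $\mathfrak n,\mathfrak m$ are not coprime, $\chi_{\mathfrak n}(\mathfrak m)=0$. Put $\chi^*_{\mathfrak m}(\mathfrak n)=\chi_{\mathfrak n}(\mathfrak m)$. For an integral ideal $\mathfrak n$ let $\mathfrak n_1$ be its $r$-th power free part, $\mathfrak n_0$ the product of the distinct primes dividing $\mathfrak n_1$, and $\mathfrak n_2=\prod_{r\mid\mathrm{ord}_v(\mathfrak n)}\mathfrak p_v^{\mathrm{ord}_v(\mathfrak n)}$. An ideal $\mathfrak m\in\mathcal I_L(S)$ is *imaginary* if its only divisor in $\mathcal I_F(S)$ is $\mathcal O_F$. $L_S(z,\cdot)$ denotes the Dirichlet series over integral ideals prime to $S'$. **The series.** Let $\tilde\rho=\rho\circ N_{L/F}$ and $\mathcal N=L_S(rs+rw+1-r,\psi^r\tilde\rho^r)$ (over $L$). For $v$ a place of $F$ and $k\ge0$ let $\Sigma_v(k)=\sum_{i=0}^{k-1}\psi(\pi_v)^i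 q_v^{i(1-2s)}$, and for $\mathfrak n\in\mathcal I_F(S)$, with $k_v=\mathrm{ord}_v(\mathfrak n)$, let $$P_{\mathfrak n}(s,\psi)=\prod_{\mathrm{ord}_v(\mathfrak n_1)>0}\Sigma_v(k_v)\cdot\prod_{\substack{r\mid k_v>0\\ v\text{ inert}}}\Big[(1-\psi(\pi_v)q_v^{-2s})\Sigma_v(k_v)+\psi(\pi_v)^{k_v}q_v^{k_v(1-2s)}(1+q_v^{-1})\Big]$$ $$\cdot\prod_{\substack{r\mid k_v>0\\ v=v'\bar v'\text{ split}}}\Big[(1-(\chi_{\mathfrak n_1}\psi)(\pi_{v'})q_v^{-s})(1-(\chi_{\mathfrak n_1}\psi)(\pi_{\bar v'})q_v^{-s})\Sigma_v(k_v)+\psi(\pi_v)^{k_v}q_v^{k_v(1-2s)}(1-q_v^{-1})\Big],$$ $$Z(s,w;\psi;\rho)=\mathcal N\sum_{\mathfrak n\in\mathcal I_F(S)}\frac{L_S(s,\chi_{\mathfrak n_1}\psi)\,P_{\mathfrak n}(s,\psi)\,\rho(\mathfrak n)}{N_{F/\mathbb Q}(\mathfrak n)^w},$$ $$\widetilde Z(s,w;\psi;\rho)=\mathcal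 N\sum_{\substack{\mathfrak m\in\mathcal I_L(S)\\ \text{imaginary}}}\frac{\psi(\mathfrak m)L_S(w,\chi^*_{\mathfrak m}\rho)}{N_{L/\mathbb Q}(\mathfrak m)^s}\sum_{\mathfrak h\in\mathcal I_F(S)}\frac{(\psi\rho)(\mathfrak h)\chi^*_{\mathfrak m}(\mathfrak h_1)}{N_{F/\mathbb Q}(\mathfrak h)^{2s-1}N_{F/\mathbb Q}(\mathfrak h)^w}\,A\,B\,C\,D,$$ where $L_S(s,\chi_{\mathfrak n_1}\psi)$ is over $L$, $L_S(w,\chi^*_{\mathfrak m}\rho)$ is over $F$, and, with products over places $v$ of $F$, $$A=\prod_{\mathrm{ord}_v(\mathfrak h_0)>0}\big[(\chi^*_{\mathfrak m}\rho)(\pi_v)q_v^{-w}-q_v^{-1}\big],\qquad B=\prod_{\substack{\mathrm{ord}_v(N_{L/F}\mathfrak m)>0\\ \mathrm{ord}_v(\mathfrak h_2)>0}}(1-q_v^{-1}),$$ $$C=\prod_{\substack{v\text{ split},\ \mathrm{ord}_v(N_{L/F}\mathfrak m)=0\\ \mathrm{ord}_v(\mathfrak h_2)>0}}\big[(\chi^*_{\mathfrak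 m}\rho)(\pi_v)q_v^{-w-1}+1-2q_v^{-1}\big],\qquad D=\prod_{\substack{v\text{ inert}\\ \mathrm{ord}_v(\mathfrak h_2)>0}}\big[1-(\chi^*_{\mathfrak m}\rho)(\pi_v)q_v^{-w-1}\big].$$ **Proposition 3.4.** For $\Re(s),\Re(w)>1$ all these series converge absolutely and $$Z(s,w;\psi;\rho)=L_S(2s,\psi)\,\widetilde Z(s,w;\psi;\rho),$$ where $L_S(2s,\psi)=\sum_{\mathfrak n\in\mathcal I_F(S)}\psi(\mathfrak n)N_{F/\mathbb Q}(\mathfrak n)^{-2s}$ is the $L$-function over $F$. -/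

import Mathlib

open NumberField IsDedekindDomain
open scoped nonZeroDivisors

noncomputable section

namespace DoubleDirichlet

/-! ### Ideals -/

section Ideals

variable {K : Type*} [Field K] [NumberField K]

open Classical in
/-- The exponent of the prime `v` in the (nonzero) integral ideal `n`. -/
def ord (v : HeightOneSpectrum (𝓞 K)) (n : Ideal (𝓞 K)) : ℕ :=
  (UniqueFactorizationMonoid.normalizedFactors n).count v.asIdeal

/-- The absolute norm `q_v` of the prime `v`. -/
def q (v : HeightOneSpectrum (𝓞 K)) : ℂ := (Ideal.absNorm v.asIdeal : ℂ)

/-- The set of nonzero integral ideals that are prime to all the places in `T`. -/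
def idealsPrimeTo (T : Set (HeightOneSpectrum (𝓞 K))) : Set (Ideal (𝓞 K)) :=
  {n | n ≠ ⊥ ∧ ∀ v ∈ T, ¬ v.asIdeal ∣ n}

/-- The group of nonzero fractional ideals that are prime to all the places in `T`. -/
def fracIdealsPrimeTo (T : Set (HeightOneSpectrum (𝓞 K))) : Set (FractionalIdeal (𝓞 K)⁰ K) :=
  {g | g ≠ 0 ∧ ∀ v ∈ T, FractionalIdeal.count K v g = 0}

/-- The `r`-th power free part `n₁` of `n`, so that `n = n₁ n'^r` with `n₁` free of `r`-th
powers. -/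
def powFreePart (r : ℕ) (n : Ideal (𝓞 K)) : Ideal (𝓞 K) :=
  ∏ᶠ v : HeightOneSpectrum (𝓞 K), v.asIdeal ^ (ord v n % r)

/-- The product `n₀` of the distinct primes that divide `n₁`. -/
def radPart (r : ℕ) (n : Ideal (𝓞 K)) : Ideal (𝓞 K) :=
  ∏ᶠ v ∈ {v : HeightOneSpectrum (𝓞 K) | 0 < ord v (powFreePart r n)}, v.asIdeal

/-- The product `n₂` of the prime powers `v ^ ord_v(n)` over the `v` with `r ∣ ord_v(n)`. -/
def fullPowPart (r : ℕ) (n : Ideal (𝓞 K)) : Ideal (𝓞 K) :=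
  ∏ᶠ v ∈ {v : HeightOneSpectrum (𝓞 K) | r ∣ ord v n}, v.asIdeal ^ ord v n

/-- The term of index `n` of the Dirichlet series `∑ f(n) N(n)^(-z)`. -/
def dirichletTerm (f : Ideal (𝓞 K) → ℂ) (z : ℂ) (n : Ideal (𝓞 K)) : ℂ :=
  f n * (Ideal.absNorm n : ℂ) ^ (-z)

/-- The Dirichlet series of `f`, summed over the nonzero integral ideals prime to `T`. For a
completely multiplicative `f` of absolute value at most one and `Re z > 1` this is the `L`-series
of `f` with the Euler factors at `T` removed. -/
def LSer (T : Set (HeightOneSpectrum (𝓞 K))) (f : Ideal (𝓞 K) → ℂ) (z : ℂ) : ℂ :=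
  ∑' n : idealsPrimeTo T, dirichletTerm f z n

end Ideals

/-! ### Unitary Hecke characters -/

section Hecke

variable (K : Type*) [Field K] [NumberField K]

/-- A unitary Hecke character: a continuous character of the idele group with values in the unit
circle that is trivial on the principal ideles. -/
structure HeckeChar where
  /-- the character of the idele group -/
  toHom : (AdeleRing (𝓞 K) K)ˣ →ₜ* Circle
  /-- it is trivial on the principal ideles -/
  map_principal : ∀ x : Kˣ, toHom (Units.map (algebraMap K (AdeleRing (𝓞 K) K)) x) = 1

variable {K}

open Classical in
/-- The idele with component `x` at the finite place `v` and component `1` at all other places. -/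
def localIdele (v : HeightOneSpectrum (𝓞 K)) :
    (v.adicCompletion K)ˣ →* (AdeleRing (𝓞 K) K)ˣ :=
  Units.map
    { toFun := fun x =>
        ((1, (RestrictedProduct.mulSingle
          (fun w : HeightOneSpectrum (𝓞 K) => w.adicCompletionIntegers K) v x :
            FiniteAdeleRing (𝓞 K) K)) : InfiniteAdeleRing K × FiniteAdeleRing (𝓞 K) K)
      map_one' := Prod.ext rfl (RestrictedProduct.mulSingle_one
        (fun w : HeightOneSpectrum (𝓞 K) => w.adicCompletionIntegers K) v)
      map_mul' := fun x y =>
        Prod.ext (one_mul (1 : InfiniteAdeleRing K)).symm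
          (RestrictedProduct.mulSingle_mul
            (fun w : HeightOneSpectrum (𝓞 K) => w.adicCompletionIntegers K) v x y) }

/-- An element of `K` of valuation exactly one at `v`. -/
def uniformizer (v : HeightOneSpectrum (𝓞 K)) : K := (v.valuation_exists_uniformizer K).choose

/-- The image of `uniformizer v` in the multiplicative group of the completion `K_v`. -/
def localUniformizer (v : HeightOneSpectrum (𝓞 K)) : (v.adicCompletion K)ˣ :=
  Units.map (algebraMap K (v.adicCompletion K)).toMonoidHom
    (Units.mk0 (uniformizer v) (by
      intro h
      have := (v.valuation_exists_uniformizer K).choose_spec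
      change v.valuation K (uniformizer v) = _ at this
      rw [h, map_zero] at this
      exact WithZero.coe_ne_zero this.symm))

namespace HeckeChar

/-- `χ` is unramified at `v`: it is trivial on the units of the ring of integers of `K_v`. -/
def IsUnramifiedAt (χ : HeckeChar K) (v : HeightOneSpectrum (𝓞 K)) : Prop :=
  ∀ u : (v.adicCompletion K)ˣ, Valued.v (u : v.adicCompletion K) = 1 →
    χ.toHom (localIdele v u) = 1

/-- The value `χ(π_v)`. -/
def atPrime (χ : HeckeChar K) (v : HeightOneSpectrum (𝓞 K)) : ℂ :=
  (χ.toHom (localIdele v (localUniformizer v)) : ℂ)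

/-- The value of `χ` at a nonzero integral ideal (used where `χ` is unramified). -/
def onIdeal (χ : HeckeChar K) (n : Ideal (𝓞 K)) : ℂ :=
  ∏ᶠ v : HeightOneSpectrum (𝓞 K), χ.atPrime v ^ ord v n

end HeckeChar

end Hecke

/-! ### The extension `L / F` -/

section Extension

variable (F : Type*) {L : Type*} [Field F] [NumberField F] [Field L] [NumberField L] [Algebra F L]

/-- The finite places of `F` below the places of `S'`. -/
def below (S' : Set (HeightOneSpectrum (𝓞 L))) : Set (HeightOneSpectrum (𝓞 F)) :=
  {v | ∃ P ∈ S', P.asIdeal.comap (algebraMap (𝓞 F) (𝓞 L)) = v.asIdeal}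

variable {F}

variable (L) in
/-- The ideal of `𝓞 L` generated by an ideal of `𝓞 F`. -/
def extIdeal (n : Ideal (𝓞 F)) : Ideal (𝓞 L) := n.map (algebraMap (𝓞 F) (𝓞 L))

variable (L) in
/-- `v` is inert in `L`. -/
def IsInert (v : HeightOneSpectrum (𝓞 F)) : Prop := (extIdeal L v.asIdeal).IsPrime

variable (L) in
/-- `v` is split in the quadratic extension `L`. -/
def IsSplit (v : HeightOneSpectrum (𝓞 F)) : Prop :=
  ∃ P Q : HeightOneSpectrum (𝓞 L), P ≠ Q ∧ extIdeal L v.asIdeal = P.asIdeal * Q.asIdeal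

/-- `S'` is stable under the automorphisms of `L` over `F`. -/
def IsConjStable (F : Type*) {L : Type*} [Field F] [NumberField F] [Field L] [NumberField L]
    [Algebra F L] (S' : Set (HeightOneSpectrum (𝓞 L))) : Prop :=
  ∀ σ : L ≃ₐ[F] L, ∀ P ∈ S', ∀ Q : HeightOneSpectrum (𝓞 L),
    P.asIdeal.map (RingOfIntegers.mapRingEquiv σ.toRingEquiv) = Q.asIdeal → Q ∈ S'

variable (F) in
/-- The imaginary ideals prime to `S'`: the only ideal of `𝓞 F` prime to `S'` that divides them
is `𝓞 F`. -/
def imaginaryIdeals (S' : Set (HeightOneSpectrum (𝓞 L))) : Set (Ideal (𝓞 L)) :=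
  {m | m ∈ idealsPrimeTo S' ∧ ∀ h ∈ idealsPrimeTo (below F S'), extIdeal L h ∣ m → h = ⊤}

end Extension

/-! ### The `r`-th power residue symbol and its extension to ideals -/

section Symbol

section Residue

variable {L : Type*} [Field L] [NumberField L]

open Classical in
/-- The `r`-th power residue symbol `(a / P)_r`, as a complex number by means of the embedding
`emb`, for `P` prime to `r` and `a` of order divisible by `r` at `P`. If `a` is a unit at `P`,
it is the `r`-th root of unity congruent to `a ^ ((N P - 1) / r)` modulo `P`; in general, `a` is
first made a unit at `P` by an `r`-th power, so that the symbol gives the action of the Frobenius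
of `P` on the `r`-th roots of `a`. It is `0` if the order of `a` at `P` is not divisible by `r`. -/
def primeSymbol (r : ℕ) (emb : L →+* ℂ) (P : HeightOneSpectrum (𝓞 L)) (a : L) : ℂ :=
  if h : ∃ ζ : L, ζ ^ r = 1 ∧ ∃ b : L, b ≠ 0 ∧
      P.valuation L ((a * b ^ r) ^ ((Ideal.absNorm P.asIdeal - 1) / r) - ζ) < 1
  then emb h.choose else 0

/-- The symbol `(a / m)_r` for an integral ideal `m`. -/
def idealSymbol (r : ℕ) (emb : L →+* ℂ) (a : L) (m : Ideal (𝓞 L)) : ℂ :=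
  ∏ᶠ P : HeightOneSpectrum (𝓞 L), primeSymbol r emb P a ^ ord P m

end Residue

variable (F L : Type*) [Field F] [NumberField F] [Field L] [NumberField L] [Algebra F L]

/-- The choices on which the extension of the `r`-th power residue symbol to ideals depends
(`r` is a prime number).

* The modulus `c = ∏ P ^ cExp P`, over `P ∈ S'`.
* The ideals `e₀ j`, whose classes are generators of the cyclic factors (all of order `r`) of
  `R_c = H_c ⊗ ℤ/r`, where `H_c` is the ray class group modulo `c`, and generators `m₀ j` of
  the `e₀ j` over the `S'`-integers. The representatives of `R_c` are the products
  `e = ∏ j, e₀ j ^ lam j` with `0 ≤ lam j < r`, and `m_e = ∏ j, m₀ j ^ lam j`.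
* For each prime `v` of `F` outside `S'`, a decomposition `v = (m) e g ^ r` that is real, in the
  sense that `m` and `m_e` are elements of `F`, and that `e` and `g` are ideals of `F`. -/
structure SymbolChoices (r : ℕ) (S' : Set (HeightOneSpectrum (𝓞 L))) where
  /-- the exponents of the modulus -/
  cExp : HeightOneSpectrum (𝓞 L) → ℕ
  cExp_tame : ∀ P ∈ S', (r : 𝓞 L) ∉ P.asIdeal → cExp P = 1
  cExp_power : ∀ P ∈ S', ∀ a : P.adicCompletion L,
    Valued.v (a - 1) ≤ WithZero.exp (-(cExp P : ℤ)) →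
      ∃ b : (P.adicCompletion L)ˣ, (b : P.adicCompletion L) ^ r = a
  /-- the number of the ideals `e₀ j` -/
  d : ℕ
  /-- ideals that represent generators of the cyclic factors of `R_c` -/
  e₀ : Fin d → Ideal (𝓞 L)
  e₀_mem : ∀ j, e₀ j ∈ idealsPrimeTo S'
  /-- every class in `R_c` contains exactly one of the products of the `e₀ j` with exponents
  less than `r` -/
  e₀_basis : ∀ a ∈ fracIdealsPrimeTo S', ∃! lam : Fin d → Fin r,
    ∃ m : L, m ≠ 0 ∧ (∀ P ∈ S', P.valuation L (m - 1) ≤ WithZero.exp (-(cExp P : ℤ))) ∧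
      ∃ g ∈ fracIdealsPrimeTo S',
        a = FractionalIdeal.spanSingleton (𝓞 L)⁰ m *
          ((∏ j, e₀ j ^ (lam j : ℕ) : Ideal (𝓞 L)) : FractionalIdeal (𝓞 L)⁰ L) * g ^ r
  /-- generators of the `e₀ j` over the ring of `S'`-integers -/
  m₀ : Fin d → L
  m₀_span : ∀ j, Submodule.span (S'.integer L) (algebraMap (𝓞 L) L '' (e₀ j : Set (𝓞 L))) =
    Submodule.span (S'.integer L) {m₀ j}
  /-- the element `m` in the decomposition of `v` -/
  mF : HeightOneSpectrum (𝓞 F) → F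
  /-- the exponents of `e` in the decomposition of `v` -/
  lam : HeightOneSpectrum (𝓞 F) → Fin d → Fin r
  /-- the ideal `e` in the decomposition of `v` -/
  eF : HeightOneSpectrum (𝓞 F) → Ideal (𝓞 F)
  /-- the generator `m_e` in the decomposition of `v` -/
  meF : HeightOneSpectrum (𝓞 F) → F
  /-- the ideal `g` in the decomposition of `v` -/
  gF : HeightOneSpectrum (𝓞 F) → FractionalIdeal (𝓞 F)⁰ F
  mF_ne_zero : ∀ v ∉ below F S', mF v ≠ 0
  mF_congr : ∀ v ∉ below F S', ∀ P ∈ S',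
    P.valuation L (algebraMap F L (mF v) - 1) ≤ WithZero.exp (-(cExp P : ℤ))
  eF_eq : ∀ v ∉ below F S', extIdeal L (eF v) = ∏ j, e₀ j ^ (lam v j : ℕ)
  meF_eq : ∀ v ∉ below F S', algebraMap F L (meF v) = ∏ j, m₀ j ^ (lam v j : ℕ)
  gF_mem : ∀ v ∉ below F S', gF v ∈ fracIdealsPrimeTo (below F S')
  decomp : ∀ v ∉ below F S', (v.asIdeal : FractionalIdeal (𝓞 F)⁰ F) =
    FractionalIdeal.spanSingleton (𝓞 F)⁰ (mF v) * (eF v : FractionalIdeal (𝓞 F)⁰ F) * gF v ^ r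

variable {F L}

namespace SymbolChoices

variable {r : ℕ} {S' : Set (HeightOneSpectrum (𝓞 L))}

/-- The element `m m_e` attached to the integral ideal `n` of `F` prime to `S'`. The product of
the chosen decompositions of the prime factors of `n` is a decomposition of `n` once the exponents
of the `e₀ j` are reduced modulo `r`; this reduction changes `m m_e` by an `r`-th power only, to
which the residue symbol is insensitive. -/
def gen (C : SymbolChoices F L r S') (n : Ideal (𝓞 F)) : F :=
  ∏ᶠ v : HeightOneSpectrum (𝓞 F), (C.mF v * C.meF v) ^ ord v n

open Classical in
/-- The extended symbol `χ_n(m) = (n / m)_r = (m m_e / m)_r`, for integral ideals `n` of `F` and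
`m` of `L` prime to `S'`; it is zero if `n` and `m` are not coprime. As a function of `m`, for
`n` free of `r`-th powers, this is the Hecke character `χ_n`, which is ramified at the primes
dividing `n`; as a function of `n` it is the character `χ*_m`, not necessarily primitive. -/
def chi (C : SymbolChoices F L r S') (emb : L →+* ℂ) (n : Ideal (𝓞 F)) (m : Ideal (𝓞 L)) : ℂ :=
  if IsCoprime (extIdeal L n) m then idealSymbol r emb (algebraMap F L (C.gen n)) m else 0

end SymbolChoices

end Symbol

/-! ### The double Dirichlet series -/

section Series

variable {F L : Type*} [Field F] [NumberField F] [Field L] [NumberField L] [Algebra F L]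
  {r : ℕ} {S' : Set (HeightOneSpectrum (𝓞 L))}
  (C : SymbolChoices F L r S') (emb : L →+* ℂ) (ψ : HeckeChar L) (ρ : HeckeChar F)

/-- The polynomial `1 + ψ(π_v) q_v^(1-2s) + ... + ψ(π_v)^(k-1) q_v^((k-1)(1-2s))`. -/
def geomPoly (ψ : HeckeChar L) (v : HeightOneSpectrum (𝓞 F)) (k : ℕ) (s : ℂ) : ℂ :=
  ∑ i ∈ Finset.range k, (ψ.onIdeal (extIdeal L v.asIdeal)) ^ i * q v ^ ((i : ℂ) * (1 - 2 * s))

/-- The Dirichlet polynomial `P_n(s, ψ)`. -/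
def polyP (n : Ideal (𝓞 F)) (s : ℂ) : ℂ :=
  (∏ᶠ v ∈ {v : HeightOneSpectrum (𝓞 F) | 0 < ord v (powFreePart r n)},
    geomPoly ψ v (ord v n) s) *
  (∏ᶠ v ∈ {v : HeightOneSpectrum (𝓞 F) | 0 < ord v n ∧ r ∣ ord v n ∧ IsInert L v},
    ((1 - ψ.onIdeal (extIdeal L v.asIdeal) * q v ^ (-2 * s)) * geomPoly ψ v (ord v n) s +
      ψ.onIdeal (extIdeal L v.asIdeal) ^ ord v n * q v ^ ((ord v n : ℂ) * (1 - 2 * s)) *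
        (1 + (q v)⁻¹))) *
  (∏ᶠ v ∈ {v : HeightOneSpectrum (𝓞 F) | 0 < ord v n ∧ r ∣ ord v n ∧ IsSplit L v},
    ((∏ᶠ P ∈ {P : HeightOneSpectrum (𝓞 L) | P.asIdeal ∣ extIdeal L v.asIdeal},
        (1 - C.chi emb (powFreePart r n) P.asIdeal * ψ.onIdeal P.asIdeal * q v ^ (-s))) *
        geomPoly ψ v (ord v n) s +
      ψ.onIdeal (extIdeal L v.asIdeal) ^ ord v n * q v ^ ((ord v n : ℂ) * (1 - 2 * s)) *
        (1 - (q v)⁻¹)))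

/-- `L_S(s, χ_n ψ) = L_S(s, χ_{n₁} ψ) P_n(s, ψ)`. -/
def LChiPsi (n : Ideal (𝓞 F)) (s : ℂ) : ℂ :=
  LSer S' (fun m => C.chi emb (powFreePart r n) m * ψ.onIdeal m) s * polyP C emb ψ n s

/-- The values of `ψ^r ρ̃^r` at ideals of `L`, where `ρ̃` is the composite of `ρ` with the norm
from `L` to `F`. -/
def normalizingChar (r : ℕ) (m : Ideal (𝓞 L)) : ℂ :=
  ψ.onIdeal m ^ r * ρ.onIdeal (Ideal.relNorm (𝓞 F) m) ^ r

/-- The normalizing factor `L_S(rs + rw + 1 - r, ψ^r ρ̃^r)`, an `L`-series over `L`. -/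
def normalizingFactor (r : ℕ) (S' : Set (HeightOneSpectrum (𝓞 L))) (s w : ℂ) : ℂ :=
  LSer S' (normalizingChar ψ ρ r) (r * s + r * w + 1 - r)

/-- The term of index `n` of the series that defines `Z(s, w; ψ; ρ)`. -/
def termZ (s w : ℂ) (n : Ideal (𝓞 F)) : ℂ :=
  LChiPsi C emb ψ n s * ρ.onIdeal n * (Ideal.absNorm n : ℂ) ^ (-w)

/-- The double Dirichlet series `Z(s, w; ψ; ρ)`. -/
def Z (s w : ℂ) : ℂ :=
  normalizingFactor ψ ρ r S' s w *
    ∑' n : idealsPrimeTo (below F S'), termZ C emb ψ ρ s w n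

/-- The value of `χ*_m ρ` at an ideal of `F`. -/
def chiStarRho (m : Ideal (𝓞 L)) (n : Ideal (𝓞 F)) : ℂ :=
  C.chi emb n m * ρ.onIdeal n

/-- The term of index `h` of the inner sum in the definition of `Z̃(s, w; ψ; ρ)`. -/
def innerTerm (s w : ℂ) (m : Ideal (𝓞 L)) (h : Ideal (𝓞 F)) : ℂ :=
  ψ.onIdeal (extIdeal L h) * ρ.onIdeal h * C.chi emb (powFreePart r h) m *
    (Ideal.absNorm h : ℂ) ^ (-(2 * s - 1)) * (Ideal.absNorm h : ℂ) ^ (-w) *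
  (∏ᶠ v ∈ {v : HeightOneSpectrum (𝓞 F) | 0 < ord v (radPart r h)},
    (chiStarRho C emb ρ m v.asIdeal * q v ^ (-w) - (q v)⁻¹)) *
  (∏ᶠ v ∈ {v : HeightOneSpectrum (𝓞 F) |
      0 < ord v (Ideal.relNorm (𝓞 F) m) ∧ 0 < ord v (fullPowPart r h)},
    (1 - (q v)⁻¹)) *
  (∏ᶠ v ∈ {v : HeightOneSpectrum (𝓞 F) | IsSplit L v ∧
      ord v (Ideal.relNorm (𝓞 F) m) = 0 ∧ 0 < ord v (fullPowPart r h)},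
    (chiStarRho C emb ρ m v.asIdeal * q v ^ (-w - 1) + 1 - 2 * (q v)⁻¹)) *
  (∏ᶠ v ∈ {v : HeightOneSpectrum (𝓞 F) | IsInert L v ∧ 0 < ord v (fullPowPart r h)},
    (1 - chiStarRho C emb ρ m v.asIdeal * q v ^ (-w - 1)))

/-- The term of index `m` of the outer sum in the definition of `Z̃(s, w; ψ; ρ)`. -/
def termZtilde (s w : ℂ) (m : Ideal (𝓞 L)) : ℂ :=
  ψ.onIdeal m * LSer (below F S') (chiStarRho C emb ρ m) w * (Ideal.absNorm m : ℂ) ^ (-s) *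
    ∑' h : idealsPrimeTo (below F S'), innerTerm C emb ψ ρ s w m h

/-- The double Dirichlet series `Z̃(s, w; ψ; ρ)`. -/
def Ztilde (s w : ℂ) : ℂ :=
  normalizingFactor ψ ρ r S' s w *
    ∑' m : imaginaryIdeals F S', termZtilde C emb ψ ρ s w m

end Series

end DoubleDirichlet

end

open DoubleDirichlet

noncomputable section

set_option linter.unusedSectionVars false

namespace DoubleDirichlet

/-! ### Factorization of ideals -/

section IdealFactorization

variable {K : Type*} [Field K] [NumberField K]

/-! Fix `n`, with exponents `k_v`. Every ideal of `L` prime to `S'` is uniquely `h m` with `h` an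
ideal of `F` and `m` imaginary (`imaginaryDecomposition`), and `χ_{n₁}` is trivial on ideals of `F`
coprime to `n₁` (`SymbolChoices.chi_extIdeal`). Indeed the element of `F` that represents `n₁` is
fixed by conjugation, so conjugation permutes its symbols at the primes over `v`. Their product is
an `r`-th root of unity fixed by conjugation, hence an element of the totally real field `F`, hence
`1` because `r` is odd. As `N(h 𝓞_L) = N(h)²`, the sum over `h` is `L_S(2s, ψ)` without the Euler
factors at the primes of `n₁`.

The polynomial `P_n` restores these factors. Its factor at `v` is affine, `E_v α + β`, in the
product `E_v` of the inverse Euler factors of `χ_{n₁} ψ` over `v`; where `r ∤ k_v`, one has `E_v =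
1` and `β = 0`. Multiplication by `E_v` deletes the primes over `v`. On imaginary ideals this
inserts a coprimality indicator, and on ideals of `F` it produces the factor `1 - ψ(π_v) q_v^(-2s)`.
Hence `L_S(s, χ_{n₁} ψ) P_n` is `L_S(2s, ψ)` times a series over imaginary `m` whose coefficients
are products of local factors depending on the `k_v` (`LChiPsi_idealOfExp`).

A bound uniform in `m` makes the double series over `(n, m)` absolutely convergent
(`summable_double`), so the sums may be exchanged. For fixed `m` the sum over `n` is an Euler
product. With `c = χ_v(m)`, `R = ρ(π_v) q_v^(-w)`, `Y = ψ(π_v) q_v^(1-2s)`, `x = 1/q_v`, `κ = 1 ± x`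
(plus for inert `v`, minus for split `v`) and `e = c^r`, which is `0` or `1`, its local term of
index `k > 0` is `c^(k mod r) R^k (e (1 - Yx)(1 + ... + Y^(k-1)) + [r ∣ k] Y^k κ)`.

Subtracting `T = cR` times the preceding term telescopes the geometric sum and leaves monomials in
`Y R` (`local_recursion`). So the local series is `(1 - T)⁻¹`, the Euler factor of `L_S(w, χ*_m ρ)`,
times a series whose coefficients are linear in `T` (`tsum_leftFactor`). These linear forms are
exactly the factors `A`, `B`, `C`, `D` of the inner sum (`innerTerm_idealOfExp`). The normalizing
factor is common to both sides. -/

lemma ord_mul (v : HeightOneSpectrum (𝓞 K)) {m n : Ideal (𝓞 K)} (hm : m ≠ ⊥) (hn : n ≠ ⊥) :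
    ord v (m * n) = ord v m + ord v n := by
  classical
  unfold ord
  rw [UniqueFactorizationMonoid.normalizedFactors_mul hm hn, Multiset.count_add]

@[simp] lemma ord_one (v : HeightOneSpectrum (𝓞 K)) : ord v (1 : Ideal (𝓞 K)) = 0 := by
  classical
  unfold ord
  rw [UniqueFactorizationMonoid.normalizedFactors_one, Multiset.count_zero]

@[simp] lemma ord_top (v : HeightOneSpectrum (𝓞 K)) : ord v (⊤ : Ideal (𝓞 K)) = 0 := by
  rw [← Ideal.one_eq_top, ord_one]

lemma ord_pow (v : HeightOneSpectrum (𝓞 K)) {m : Ideal (𝓞 K)} (hm : m ≠ ⊥) (k : ℕ) :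
    ord v (m ^ k) = k * ord v m := by
  induction k with
  | zero => simp
  | succ k ih => rw [pow_succ, ord_mul v (pow_ne_zero k hm) hm, ih]; ring

lemma ord_prime (v w : HeightOneSpectrum (𝓞 K)) [Decidable (v = w)] :
    ord v w.asIdeal = if v = w then 1 else 0 := by
  classical
  unfold ord
  rw [UniqueFactorizationMonoid.normalizedFactors_irreducible w.irreducible, normalize_eq,
    Multiset.count_singleton]
  simp [HeightOneSpectrum.ext_iff]

lemma ord_self (v : HeightOneSpectrum (𝓞 K)) : ord v v.asIdeal = 1 := by
  classical
  rw [ord_prime, if_pos rfl]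

lemma ord_pos_iff (v : HeightOneSpectrum (𝓞 K)) {n : Ideal (𝓞 K)} (hn : n ≠ ⊥) :
    0 < ord v n ↔ v.asIdeal ∣ n := by
  classical
  unfold ord
  rw [Multiset.count_pos, UniqueFactorizationMonoid.mem_normalizedFactors_iff' hn]
  exact ⟨fun h => h.2.2, fun h => ⟨v.irreducible, normalize_eq _, h⟩⟩

lemma ord_prod {ι : Type*} (v : HeightOneSpectrum (𝓞 K)) (s : Finset ι) (f : ι → Ideal (𝓞 K))
    (hf : ∀ i ∈ s, f i ≠ ⊥) : ord v (∏ i ∈ s, f i) = ∑ i ∈ s, ord v (f i) := by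
  classical
  induction s using Finset.induction_on with
  | empty => simp
  | insert a s ha ih =>
    rw [Finset.prod_insert ha, Finset.sum_insert ha,
      ord_mul v (hf a (Finset.mem_insert_self a s))
        (Finset.prod_ne_zero_iff.2 fun i hi => hf i (Finset.mem_insert_of_mem hi)),
      ih fun i hi => hf i (Finset.mem_insert_of_mem hi)]

lemma finite_ord_ne_zero {n : Ideal (𝓞 K)} (hn : n ≠ ⊥) :
    {v : HeightOneSpectrum (𝓞 K) | ord v n ≠ 0}.Finite := by
  refine (Ideal.finite_factors hn).subset fun v hv => ?_
  exact (ord_pos_iff v hn).1 (Nat.pos_of_ne_zero hv)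

/-- A multiplicative combination of values at primes with exponents `ord v n` has finite
support. -/
lemma hasFiniteMulSupport_pow_ord {M : Type*} [CommMonoid M] (f : HeightOneSpectrum (𝓞 K) → M)
    {n : Ideal (𝓞 K)} (hn : n ≠ ⊥) :
    (Function.mulSupport fun v : HeightOneSpectrum (𝓞 K) => f v ^ ord v n).Finite := by
  refine (finite_ord_ne_zero hn).subset fun v hv h => hv ?_
  simp only [h, pow_zero]

lemma finprod_pow_ord_mul {M : Type*} [CommMonoid M] (f : HeightOneSpectrum (𝓞 K) → M)
    {m n : Ideal (𝓞 K)} (hm : m ≠ ⊥) (hn : n ≠ ⊥) :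
    ∏ᶠ v, f v ^ ord v (m * n) = (∏ᶠ v, f v ^ ord v m) * ∏ᶠ v, f v ^ ord v n := by
  rw [← finprod_mul_distrib (hasFiniteMulSupport_pow_ord f hm) (hasFiniteMulSupport_pow_ord f hn)]
  exact finprod_congr fun v => by rw [ord_mul v hm hn, pow_add]

lemma finprod_pow_ord_one {M : Type*} [CommMonoid M] (f : HeightOneSpectrum (𝓞 K) → M) :
    ∏ᶠ v, f v ^ ord v (1 : Ideal (𝓞 K)) = 1 := by
  simp

lemma finprod_pow_ord_prime {M : Type*} [CommMonoid M] (f : HeightOneSpectrum (𝓞 K) → M)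
    (w : HeightOneSpectrum (𝓞 K)) : ∏ᶠ v, f v ^ ord v w.asIdeal = f w := by
  classical
  rw [finprod_eq_single _ w fun v hv => by rw [ord_prime, if_neg hv, pow_zero], ord_self, pow_one]

variable {T : Set (HeightOneSpectrum (𝓞 K))}

lemma one_mem_idealsPrimeTo : (1 : Ideal (𝓞 K)) ∈ idealsPrimeTo T :=
  ⟨one_ne_zero, fun v _ h => v.irreducible.not_isUnit (isUnit_of_dvd_one h)⟩

lemma mul_mem_idealsPrimeTo_iff {m n : Ideal (𝓞 K)} :
    m * n ∈ idealsPrimeTo T ↔ m ∈ idealsPrimeTo T ∧ n ∈ idealsPrimeTo T := by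
  constructor
  · rintro ⟨h0, h⟩
    exact ⟨⟨left_ne_zero_of_mul h0, fun v hv h' => h v hv (h'.mul_right n)⟩,
      ⟨right_ne_zero_of_mul h0, fun v hv h' => h v hv (h'.mul_left m)⟩⟩
  · rintro ⟨hm, hn⟩
    refine ⟨mul_ne_zero hm.1 hn.1, fun v hv h => ?_⟩
    exact (v.prime.dvd_or_dvd h).elim (hm.2 v hv) (hn.2 v hv)

lemma mul_mem_idealsPrimeTo {m n : Ideal (𝓞 K)} (hm : m ∈ idealsPrimeTo T)
    (hn : n ∈ idealsPrimeTo T) : m * n ∈ idealsPrimeTo T :=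
  mul_mem_idealsPrimeTo_iff.2 ⟨hm, hn⟩

lemma prime_mem_idealsPrimeTo {v : HeightOneSpectrum (𝓞 K)} (hv : v ∉ T) :
    v.asIdeal ∈ idealsPrimeTo T := by
  refine ⟨v.ne_bot, fun w hw h => hv ?_⟩
  have : w = v := HeightOneSpectrum.ext
    ((associated_iff_eq.1 ((w.prime.dvd_prime_iff_associated v.prime).1 h)))
  exact this ▸ hw

lemma idealsPrimeTo_mono {T' : Set (HeightOneSpectrum (𝓞 K))} (h : T ⊆ T') :
    idealsPrimeTo T' ⊆ idealsPrimeTo T := fun _ hn => ⟨hn.1, fun v hv => hn.2 v (h hv)⟩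

lemma notMem_of_dvd {n : Ideal (𝓞 K)} (hn : n ∈ idealsPrimeTo T) {v : HeightOneSpectrum (𝓞 K)}
    (h : v.asIdeal ∣ n) : v ∉ T := fun hv => hn.2 v hv h

variable (T) in
/-- The ideal with the given exponents at the primes outside `T`. -/
def idealOfExp (k : {v : HeightOneSpectrum (𝓞 K) // v ∉ T} →₀ ℕ) : Ideal (𝓞 K) :=
  k.prod fun v i => v.1.asIdeal ^ i

lemma idealOfExp_mem (k : {v : HeightOneSpectrum (𝓞 K) // v ∉ T} →₀ ℕ) :
    idealOfExp T k ∈ idealsPrimeTo T := by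
  unfold idealOfExp Finsupp.prod
  refine Finset.prod_induction _ (· ∈ idealsPrimeTo T) (fun _ _ => mul_mem_idealsPrimeTo)
    one_mem_idealsPrimeTo fun v _ => ?_
  dsimp only
  induction k v with
  | zero => rw [pow_zero]; exact one_mem_idealsPrimeTo
  | succ i ih => rw [pow_succ]; exact mul_mem_idealsPrimeTo ih (prime_mem_idealsPrimeTo v.2)

lemma ord_idealOfExp (k : {v : HeightOneSpectrum (𝓞 K) // v ∉ T} →₀ ℕ)
    (v : {v : HeightOneSpectrum (𝓞 K) // v ∉ T}) : ord v.1 (idealOfExp T k) = k v := by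
  classical
  unfold idealOfExp Finsupp.prod
  rw [ord_prod _ _ _ fun w _ => pow_ne_zero _ w.1.ne_bot,
    Finset.sum_congr rfl fun w _ => by rw [ord_pow _ w.1.ne_bot, ord_prime]]
  by_cases hv : k v = 0
  · rw [hv]
    refine Finset.sum_eq_zero fun w hw => ?_
    rw [if_neg, mul_zero]
    intro h
    rw [← Subtype.ext h] at hw
    exact (Finsupp.mem_support_iff.1 hw) hv
  · rw [Finset.sum_eq_single v]
    · simp
    · intro w _ hw
      rw [if_neg fun h => hw (Subtype.ext h.symm), mul_zero]
    · intro h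
      exact absurd (Finsupp.notMem_support_iff.1 h) hv

lemma ord_eq_zero_of_mem {n : Ideal (𝓞 K)} (hn : n ∈ idealsPrimeTo T)
    {v : HeightOneSpectrum (𝓞 K)} (hv : v ∈ T) : ord v n = 0 := by
  by_contra h
  exact hn.2 v hv ((ord_pos_iff v hn.1).1 (Nat.pos_of_ne_zero h))

lemma eq_of_ord_eq {m n : Ideal (𝓞 K)} (hm : m ≠ ⊥) (hn : n ≠ ⊥)
    (h : ∀ v : HeightOneSpectrum (𝓞 K), ord v m = ord v n) : m = n := by
  classical
  rw [← associated_iff_eq,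
    UniqueFactorizationMonoid.associated_iff_normalizedFactors_eq_normalizedFactors hm hn]
  ext p
  by_cases hp : p = ⊥ ∨ ¬ p.IsPrime
  · have aux : ∀ a : Ideal (𝓞 K), p ∉ UniqueFactorizationMonoid.normalizedFactors a := by
      intro a ha
      have := UniqueFactorizationMonoid.prime_of_normalized_factor p ha
      rcases hp with hp | hp
      · exact this.ne_zero hp
      · exact hp (Ideal.isPrime_of_prime this)
    rw [Multiset.count_eq_zero_of_notMem (aux m), Multiset.count_eq_zero_of_notMem (aux n)]
  · push Not at hp
    convert! h ⟨p, hp.2, hp.1⟩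

variable (T) in
/-- Ideals prime to `T` correspond to their exponents at the primes outside `T`. -/
def expEquiv : ({v : HeightOneSpectrum (𝓞 K) // v ∉ T} →₀ ℕ) ≃ idealsPrimeTo T where
  toFun k := ⟨idealOfExp T k, idealOfExp_mem k⟩
  invFun n := Finsupp.ofSupportFinite (fun v => ord v.1 n.1)
    ((finite_ord_ne_zero n.2.1).preimage Subtype.val_injective.injOn)
  left_inv k := by
    ext v
    exact ord_idealOfExp k v
  right_inv n := by
    refine Subtype.ext (eq_of_ord_eq (idealOfExp_mem _).1 n.2.1 fun v => ?_)
    by_cases hv : v ∈ T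
    · rw [ord_eq_zero_of_mem (idealOfExp_mem _) hv, ord_eq_zero_of_mem n.2 hv]
    · exact ord_idealOfExp _ ⟨v, hv⟩

/-- A finite product over primes, as a product over the support of a finitely supported
function. -/
lemma finprod_eq_prod_support (k : {v : HeightOneSpectrum (𝓞 K) // v ∉ T} →₀ ℕ)
    {M : Type*} [CommMonoid M] (f : HeightOneSpectrum (𝓞 K) → M)
    (hf : ∀ v, ord v (idealOfExp T k) = 0 → f v = 1) :
    ∏ᶠ v, f v = ∏ v ∈ k.support, f v.1 := by
  classical
  rw [finprod_eq_prod_of_mulSupport_subset (s := k.support.map (Function.Embedding.subtype _)),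
    Finset.prod_map]
  · rfl
  · intro v hv
    have h0 : ord v (idealOfExp T k) ≠ 0 := fun h => hv (hf v h)
    have hvT : v ∉ T := fun h => h0 (ord_eq_zero_of_mem (idealOfExp_mem k) h)
    simp only [Finset.coe_map, Set.mem_image, Finset.mem_coe, Finsupp.mem_support_iff]
    exact ⟨⟨v, hvT⟩, by rw [← ord_idealOfExp]; exact h0, rfl⟩

open Classical in
lemma finprod_mem_eq_prod_support (k : {v : HeightOneSpectrum (𝓞 K) // v ∉ T} →₀ ℕ)
    {M : Type*} [CommMonoid M] (A : Set (HeightOneSpectrum (𝓞 K)))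
    (f : HeightOneSpectrum (𝓞 K) → M) (hA : ∀ v ∈ A, ord v (idealOfExp T k) ≠ 0) :
    ∏ᶠ v ∈ A, f v = ∏ v ∈ k.support, if v.1 ∈ A then f v.1 else 1 := by
  rw [finprod_mem_def, finprod_eq_prod_support k]
  · rfl
  · intro v hv
    rw [Set.mulIndicator_of_notMem]
    exact fun h => hA v h hv

lemma ord_finprod_pow (v : HeightOneSpectrum (𝓞 K)) (e : HeightOneSpectrum (𝓞 K) → ℕ)
    (he : {v | e v ≠ 0}.Finite) :
    ord v (∏ᶠ w : HeightOneSpectrum (𝓞 K), w.asIdeal ^ e w) = e v := by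
  classical
  rw [finprod_eq_prod_of_mulSupport_subset (s := he.toFinset)]
  · rw [ord_prod _ _ _ fun w _ => pow_ne_zero _ w.ne_bot,
      Finset.sum_congr rfl fun w _ => by rw [ord_pow _ w.ne_bot, ord_prime]]
    by_cases hv : e v = 0
    · rw [hv]
      refine Finset.sum_eq_zero fun w hw => ?_
      rw [if_neg, mul_zero]
      rintro rfl
      exact (he.mem_toFinset.1 hw) hv
    · rw [Finset.sum_eq_single v]
      · simp
      · intro w _ hw
        rw [if_neg hw.symm, mul_zero]
      · intro h
        exact absurd hv (fun h' => h (he.mem_toFinset.2 h'))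
  · intro w hw
    simp only [Set.Finite.coe_toFinset, Set.mem_ofPred_eq]
    intro h
    exact hw (by simp [h])

lemma finprod_pow_ne_bot (e : HeightOneSpectrum (𝓞 K) → ℕ) :
    ∏ᶠ w : HeightOneSpectrum (𝓞 K), w.asIdeal ^ e w ≠ ⊥ :=
  finprod_induction (p := fun I : Ideal (𝓞 K) => I ≠ ⊥) one_ne_zero (fun _ _ => mul_ne_zero)
    fun w => pow_ne_zero _ w.ne_bot

lemma ord_powFreePart (r : ℕ) {n : Ideal (𝓞 K)} (hn : n ≠ ⊥) (v : HeightOneSpectrum (𝓞 K)) :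
    ord v (powFreePart r n) = ord v n % r :=
  ord_finprod_pow v _ ((finite_ord_ne_zero hn).subset fun w hw h => hw (by simp [h]))

lemma powFreePart_ne_bot (r : ℕ) (n : Ideal (𝓞 K)) : powFreePart r n ≠ ⊥ :=
  finprod_pow_ne_bot _

lemma powFreePart_mem {r : ℕ} {n : Ideal (𝓞 K)} (hn : n ∈ idealsPrimeTo T) :
    powFreePart r n ∈ idealsPrimeTo T := by
  refine ⟨powFreePart_ne_bot r n, fun v hv h => ?_⟩
  have := (ord_pos_iff v (powFreePart_ne_bot r n)).2 h
  rw [ord_powFreePart r hn.1, ord_eq_zero_of_mem hn hv, Nat.zero_mod] at this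
  exact lt_irrefl _ this

lemma finprod_mem_pow_eq (A : Set (HeightOneSpectrum (𝓞 K))) [DecidablePred (· ∈ A)]
    (e : HeightOneSpectrum (𝓞 K) → ℕ) :
    ∏ᶠ w ∈ A, w.asIdeal ^ e w =
      ∏ᶠ w : HeightOneSpectrum (𝓞 K), w.asIdeal ^ (if w ∈ A then e w else 0) :=
  finprod_congr fun w => by
    by_cases hw : w ∈ A
    · simp [hw]
    · simp [hw]

lemma ord_radPart_pos_iff (r : ℕ) {n : Ideal (𝓞 K)} (hn : n ≠ ⊥)
    (v : HeightOneSpectrum (𝓞 K)) : 0 < ord v (radPart r n) ↔ ¬ r ∣ ord v n := by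
  classical
  have h1 : radPart r n = ∏ᶠ w : HeightOneSpectrum (𝓞 K), w.asIdeal ^
      (if w ∈ {v | 0 < ord v (powFreePart r n)} then 1 else 0) := by
    rw [← finprod_mem_pow_eq]
    unfold radPart
    simp only [pow_one]
  rw [h1, ord_finprod_pow]
  · simp only [Set.mem_ofPred_eq, ord_powFreePart r hn, Nat.dvd_iff_mod_eq_zero]
    split_ifs with h <;> omega
  · refine (finite_ord_ne_zero (powFreePart_ne_bot r n)).subset fun w hw => ?_
    simp only [Set.mem_ofPred_eq, ne_eq, ite_eq_right_iff, one_ne_zero, imp_false, not_not] at hw ⊢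
    omega

lemma ord_fullPowPart_pos_iff (r : ℕ) {n : Ideal (𝓞 K)} (hn : n ≠ ⊥)
    (v : HeightOneSpectrum (𝓞 K)) :
    0 < ord v (fullPowPart r n) ↔ 0 < ord v n ∧ r ∣ ord v n := by
  classical
  unfold fullPowPart
  rw [finprod_mem_pow_eq, ord_finprod_pow]
  · simp only [Set.mem_ofPred_eq]
    split_ifs with h <;> simp [h]
  · refine (finite_ord_ne_zero hn).subset fun w hw h => hw (by simp [h])

end IdealFactorization

/-! ### Dirichlet series over ideals -/

section DirichletSeries

variable {K : Type*} [Field K] [NumberField K] {T : Set (HeightOneSpectrum (𝓞 K))}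

lemma absNorm_pos {n : Ideal (𝓞 K)} (hn : n ≠ ⊥) : 0 < Ideal.absNorm n :=
  Nat.pos_of_ne_zero fun h => hn (Ideal.absNorm_eq_zero_iff.1 h)

-- The number of ideals of norm at most `n` is `O(n)`, so the Dirichlet series that counts ideals by
-- norm converges for `σ > 1`. Grouping the ideals by their norm reduces the sum to this series.
open Filter Asymptotics in
lemma summable_absNorm_rpow (K : Type*) [Field K] [NumberField K] {σ : ℝ} (hσ : 1 < σ) :
    Summable fun n : {n : Ideal (𝓞 K) // n ≠ ⊥} => (Ideal.absNorm n.1 : ℝ) ^ (-σ) := by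
  set c : ℕ → ℝ := fun n => Nat.card {I : Ideal (𝓞 K) // Ideal.absNorm I = n} with hc
  have hL : LSeriesSummable (fun n => (c n : ℂ)) (σ : ℂ) := by
    refine LSeriesSummable_of_sum_norm_bigO_and_nonneg (r := 1) ?_ (fun n => Nat.cast_nonneg _)
      zero_le_one (by simpa using hσ)
    have h1 := ((Ideal.tendsto_norm_le_div_atTop₀ K).comp tendsto_natCast_atTop_atTop).isBigO_one ℝ
    have h2 := h1.mul (isBigO_refl (fun n : ℕ => (n : ℝ)) atTop)
    refine (h2.congr' ?_ ?_)
    · filter_upwards [eventually_gt_atTop 0] with n hn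
      simp only [Function.comp_apply, Nat.cast_le]
      rw [div_mul_cancel₀ _ (Nat.cast_ne_zero.2 hn.ne')]
      simp only [hc, ← Nat.cast_sum]
      congr 1
      -- The count of ideals of norm at most `n` includes the zero ideal, of norm `0`, whereas the
      -- partial sum starts at `1`.
      rw [← add_left_inj 1, ← Ideal.card_norm_le_eq_card_norm_le_add_one,
        show Finset.Icc 1 n = Finset.Ioc 0 n from Finset.Icc_succ_left_eq_Ioc _ _,
        show 1 = Nat.card {I : Ideal (𝓞 K) // Ideal.absNorm I = 0} by
          simp [Ideal.absNorm_eq_zero_iff],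
        Finset.sum_Ioc_add_eq_sum_Icc (n.zero_le),
        ← Finset.card_preimage_eq_sum_card_image_eq
          (fun k _ ↦ Ideal.finite_setOfPred_absNorm_eq k)]
      simp [Set.coe_eq_subtype]
    · filter_upwards with n
      simp
  rw [← (Equiv.sigmaFiberEquiv fun n : {n : Ideal (𝓞 K) // n ≠ ⊥} =>
    Ideal.absNorm n.1).summable_iff, summable_sigma_of_nonneg fun _ => by
      simp only [Function.comp_apply]; positivity]
  have hfin : ∀ a : ℕ, Finite {x : {n : Ideal (𝓞 K) // n ≠ ⊥} // Ideal.absNorm x.1 = a} := by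
    intro a
    have := (Ideal.finite_setOfPred_absNorm_eq (S := 𝓞 K) a).to_subtype
    exact Finite.of_injective (β := {I : Ideal (𝓞 K) | Ideal.absNorm I = a})
      (fun x => ⟨x.1.1, x.2⟩) fun x y h => Subtype.ext (Subtype.ext (congrArg (fun z => z.1) h))
  refine ⟨fun a => ?_, ?_⟩
  · have := hfin a
    exact Summable.of_finite
  · refine Summable.of_nonneg_of_le (fun a => tsum_nonneg fun _ => ?_) (fun a => ?_) hL.norm
    · simp only [Function.comp_apply]; positivity
    · have := hfin a
      have := Fintype.ofFinite {x : {n : Ideal (𝓞 K) // n ≠ ⊥} // Ideal.absNorm x.1 = a}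
      have h1 : ∀ x : {x : {n : Ideal (𝓞 K) // n ≠ ⊥} // Ideal.absNorm x.1 = a},
          ((fun n : {n : Ideal (𝓞 K) // n ≠ ⊥} => (Ideal.absNorm n.1 : ℝ) ^ (-σ)) ∘
          (Equiv.sigmaFiberEquiv fun n : {n : Ideal (𝓞 K) // n ≠ ⊥} => Ideal.absNorm n.1)) ⟨a, x⟩
            = (a : ℝ) ^ (-σ) := by
        rintro ⟨x, rfl⟩
        rfl
      simp only [h1, tsum_fintype, Finset.sum_const, Finset.card_univ, nsmul_eq_mul]
      rcases Nat.eq_zero_or_pos a with rfl | ha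
      · have : IsEmpty {x : {n : Ideal (𝓞 K) // n ≠ ⊥} // Ideal.absNorm x.1 = 0} :=
          ⟨fun x => x.1.2 (Ideal.absNorm_eq_zero_iff.1 x.2)⟩
        simp
      · rw [LSeries.term_of_ne_zero ha.ne', norm_div, Complex.norm_natCast_cpow_of_pos ha,
          Complex.norm_real, Complex.ofReal_re, Real.norm_of_nonneg (Nat.cast_nonneg _),
          Real.rpow_neg (Nat.cast_nonneg _), div_eq_mul_inv]
        refine mul_le_mul_of_nonneg_right ?_ (by positivity)
        rw [← Nat.card_eq_fintype_card, Nat.cast_le]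
        have : Finite {I : Ideal (𝓞 K) // Ideal.absNorm I = a} :=
          (Ideal.finite_setOfPred_absNorm_eq (S := 𝓞 K) a).to_subtype
        exact Nat.card_le_card_of_injective
          (β := {I : Ideal (𝓞 K) // Ideal.absNorm I = a}) (fun x => ⟨x.1.1, x.2⟩)
          fun x y h => Subtype.ext (Subtype.ext (congrArg (fun z => z.1) h))

lemma summable_absNorm_rpow_of_subset {A : Set (Ideal (𝓞 K))} (hA : ∀ n ∈ A, n ≠ ⊥) {σ : ℝ}
    (hσ : 1 < σ) : Summable fun n : A => (Ideal.absNorm n.1 : ℝ) ^ (-σ) :=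
  (summable_absNorm_rpow K hσ).comp_injective
    (i := fun n : A => (⟨n.1, hA n n.2⟩ : {n : Ideal (𝓞 K) // n ≠ ⊥}))
    fun _ _ h => Subtype.ext (congrArg (fun z => z.1) h)

lemma summable_prime_rpow {σ : ℝ} (hσ : 1 < σ) :
    Summable fun v : {v : HeightOneSpectrum (𝓞 K) // v ∉ T} =>
      (Ideal.absNorm v.1.asIdeal : ℝ) ^ (-σ) :=
  (summable_absNorm_rpow K hσ).comp_injective
    (i := fun v : {v : HeightOneSpectrum (𝓞 K) // v ∉ T} =>
      (⟨v.1.asIdeal, v.1.ne_bot⟩ : {n : Ideal (𝓞 K) // n ≠ ⊥}))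
    fun _ _ h => Subtype.ext (HeightOneSpectrum.ext (congrArg (fun z => z.1) h))

lemma norm_absNorm_cpow {n : Ideal (𝓞 K)} (hn : n ≠ ⊥) (z : ℂ) :
    ‖(Ideal.absNorm n : ℂ) ^ z‖ = (Ideal.absNorm n : ℝ) ^ z.re :=
  Complex.norm_natCast_cpow_of_pos (absNorm_pos hn) z

lemma absNorm_mul_cpow (m n : Ideal (𝓞 K)) (z : ℂ) :
    (Ideal.absNorm (m * n) : ℂ) ^ z = (Ideal.absNorm m : ℂ) ^ z * (Ideal.absNorm n : ℂ) ^ z := by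
  rw [map_mul, Nat.cast_mul, Complex.natCast_mul_natCast_cpow]

lemma norm_dirichletTerm_le {f : Ideal (𝓞 K) → ℂ} {n : Ideal (𝓞 K)} (hn : n ≠ ⊥)
    (hf : ‖f n‖ ≤ 1) (z : ℂ) : ‖dirichletTerm f z n‖ ≤ (Ideal.absNorm n : ℝ) ^ (-z.re) := by
  unfold dirichletTerm
  rw [norm_mul, norm_absNorm_cpow hn, Complex.neg_re]
  exact mul_le_of_le_one_left (by positivity) hf

lemma summable_dirichletTerm {f : Ideal (𝓞 K) → ℂ} {A : Set (Ideal (𝓞 K))}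
    (hA : ∀ n ∈ A, n ≠ ⊥) (hf : ∀ n ∈ A, ‖f n‖ ≤ 1) {z : ℂ} (hz : 1 < z.re) :
    Summable fun n : A => dirichletTerm f z (n : Ideal (𝓞 K)) :=
  Summable.of_norm_bounded (summable_absNorm_rpow_of_subset hA hz)
    fun n => norm_dirichletTerm_le (hA n n.2) (hf n n.2) z

lemma pow_mem_idealsPrimeTo {m : Ideal (𝓞 K)} (hm : m ∈ idealsPrimeTo T) (k : ℕ) :
    m ^ k ∈ idealsPrimeTo T := by
  induction k with
  | zero => rw [pow_zero]; exact one_mem_idealsPrimeTo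
  | succ k ih => rw [pow_succ]; exact mul_mem_idealsPrimeTo ih hm

/-- `g` is completely multiplicative on the ideals prime to `T`. -/
structure IsCompletelyMultiplicative (T : Set (HeightOneSpectrum (𝓞 K)))
    (g : Ideal (𝓞 K) → ℂ) : Prop where
  map_one : g 1 = 1
  map_mul : ∀ m ∈ idealsPrimeTo T, ∀ n ∈ idealsPrimeTo T, g (m * n) = g m * g n

namespace IsCompletelyMultiplicative

variable {g : Ideal (𝓞 K) → ℂ}

lemma mul {g' : Ideal (𝓞 K) → ℂ} (hg : IsCompletelyMultiplicative T g)
    (hg' : IsCompletelyMultiplicative T g') :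
    IsCompletelyMultiplicative T fun n => g n * g' n where
  map_one := by simp only [hg.map_one, hg'.map_one, mul_one]
  map_mul m hm n hn := by simp only [hg.map_mul m hm n hn, hg'.map_mul m hm n hn]; ring

lemma mono {T' : Set (HeightOneSpectrum (𝓞 K))} (hg : IsCompletelyMultiplicative T g)
    (h : T ⊆ T') : IsCompletelyMultiplicative T' g where
  map_one := hg.map_one
  map_mul m hm n hn := hg.map_mul m (idealsPrimeTo_mono h hm) n (idealsPrimeTo_mono h hn)

lemma map_pow (hg : IsCompletelyMultiplicative T g) {m : Ideal (𝓞 K)}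
    (hm : m ∈ idealsPrimeTo T) (k : ℕ) : g (m ^ k) = g m ^ k := by
  induction k with
  | zero => rw [pow_zero, pow_zero]; exact hg.map_one
  | succ k ih =>
    rw [pow_succ, pow_succ, hg.map_mul _ (pow_mem_idealsPrimeTo hm k) _ hm, ih]

lemma map_idealOfExp (hg : IsCompletelyMultiplicative T g)
    (k : {v : HeightOneSpectrum (𝓞 K) // v ∉ T} →₀ ℕ) :
    g (idealOfExp T k) = ∏ v ∈ k.support, g v.1.asIdeal ^ k v := by
  classical
  have h : ∀ s : Finset {v : HeightOneSpectrum (𝓞 K) // v ∉ T},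
      ∏ v ∈ s, v.1.asIdeal ^ k v ∈ idealsPrimeTo T ∧
      g (∏ v ∈ s, v.1.asIdeal ^ k v) = ∏ v ∈ s, g v.1.asIdeal ^ k v := by
    intro s
    induction s using Finset.induction_on with
    | empty => rw [Finset.prod_empty, Finset.prod_empty]; exact ⟨one_mem_idealsPrimeTo, hg.map_one⟩
    | insert a s ha ih =>
      have hp := prime_mem_idealsPrimeTo a.2
      rw [Finset.prod_insert ha, Finset.prod_insert ha,
        hg.map_mul _ (pow_mem_idealsPrimeTo hp _) _ ih.1, hg.map_pow hp, ih.2]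
      exact ⟨mul_mem_idealsPrimeTo (pow_mem_idealsPrimeTo hp _) ih.1, rfl⟩
  exact (h k.support).2

end IsCompletelyMultiplicative

lemma isCompletelyMultiplicative_absNorm_cpow (z : ℂ) :
    IsCompletelyMultiplicative T fun n : Ideal (𝓞 K) => (Ideal.absNorm n : ℂ) ^ z where
  map_one := by simp
  map_mul m _ n _ := absNorm_mul_cpow m n z

lemma IsCompletelyMultiplicative.dirichletTerm {f : Ideal (𝓞 K) → ℂ}
    (hf : IsCompletelyMultiplicative T f) (z : ℂ) :
    IsCompletelyMultiplicative T (dirichletTerm f z) :=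
  hf.mul (isCompletelyMultiplicative_absNorm_cpow (-z))

/-- Removing the Euler factor at `v` from a completely multiplicative series. -/
lemma tsum_insert_prime {g : Ideal (𝓞 K) → ℂ} (hg : IsCompletelyMultiplicative T g)
    (hs : Summable fun n : idealsPrimeTo T => g n) {v : HeightOneSpectrum (𝓞 K)} (hv : v ∉ T) :
    ∑' n : idealsPrimeTo (insert v T), g n =
      (1 - g v.asIdeal) * ∑' n : idealsPrimeTo T, g n := by
  have hsplit := hs.tsum_subtype_add_tsum_subtype_compl
    {n : idealsPrimeTo T | n.1 ∈ idealsPrimeTo (insert v T)}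
  let e1 : idealsPrimeTo (insert v T) ≃
      {n : idealsPrimeTo T | n.1 ∈ idealsPrimeTo (insert v T)} :=
    { toFun := fun n => ⟨⟨n.1, idealsPrimeTo_mono (Set.subset_insert v T) n.2⟩, n.2⟩
      invFun := fun n => ⟨n.1.1, n.2⟩
      left_inv := fun _ => rfl
      right_inv := fun _ => rfl }
  have hdvd : ∀ n : idealsPrimeTo T, n ∈ {n : idealsPrimeTo T |
      n.1 ∈ idealsPrimeTo (insert v T)}ᶜ → v.asIdeal ∣ n.1 := by
    intro n hn
    by_contra h
    refine hn ⟨n.2.1, fun w hw => ?_⟩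
    rcases hw with rfl | hw
    · exact h
    · exact n.2.2 w hw
  -- Multiplication by `v` identifies all ideals prime to `T` with those divisible by `v`.
  let e2 : idealsPrimeTo T ≃ ({n : idealsPrimeTo T | n.1 ∈ idealsPrimeTo (insert v T)}ᶜ : Set _) :=
    Equiv.ofBijective (fun n => ⟨⟨v.asIdeal * n.1,
      mul_mem_idealsPrimeTo (prime_mem_idealsPrimeTo hv) n.2⟩,
        fun h => h.2 v (Set.mem_insert v T) (Dvd.intro _ rfl)⟩) (by
      constructor
      · intro a b h
        have h' : v.asIdeal * a.1 = v.asIdeal * b.1 := congrArg (fun z => z.1.1) h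
        exact Subtype.ext (mul_left_cancel₀ v.ne_bot h')
      · intro n
        obtain ⟨c, hc⟩ := hdvd n.1 n.2
        refine ⟨⟨c, (mul_mem_idealsPrimeTo_iff.1 (hc ▸ n.1.2)).2⟩, ?_⟩
        exact Subtype.ext (Subtype.ext hc.symm))
  rw [← e1.tsum_eq, ← e2.tsum_eq] at hsplit
  have h3 : ∀ n : idealsPrimeTo T, g ((e2 n).1.1) = g v.asIdeal * g n.1 := fun n =>
    hg.map_mul _ (prime_mem_idealsPrimeTo hv) _ n.2
  simp only [h3, tsum_mul_left] at hsplit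
  rw [sub_mul, one_mul]
  exact eq_sub_of_add_eq hsplit

/-- Removing finitely many Euler factors from a completely multiplicative series. -/
lemma tsum_union_primes {g : Ideal (𝓞 K) → ℂ} (hg : IsCompletelyMultiplicative T g)
    (hs : Summable fun n : idealsPrimeTo T => g n) (W : Finset (HeightOneSpectrum (𝓞 K)))
    (hW : ∀ v ∈ W, v ∉ T) :
    ∑' n : idealsPrimeTo (T ∪ W), g n =
      (∏ v ∈ W, (1 - g v.asIdeal)) * ∑' n : idealsPrimeTo T, g n := by
  classical
  induction W using Finset.induction_on with
  | empty => rw [Finset.coe_empty, Set.union_empty, Finset.prod_empty, one_mul]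
  | insert a W ha ih =>
    rw [Finset.prod_insert ha, mul_assoc,
      ← ih fun v hv => hW v (Finset.mem_insert_of_mem hv), Finset.coe_insert, Set.union_insert]
    refine tsum_insert_prime (hg.mono Set.subset_union_left) ?_ ?_
    · exact hs.comp_injective (i := fun n : idealsPrimeTo (T ∪ W) =>
        (⟨n.1, idealsPrimeTo_mono Set.subset_union_left n.2⟩ : idealsPrimeTo T))
        fun x y h => Subtype.ext (congrArg (fun z => z.1) h)
    · rintro (h | h)
      · exact hW a (Finset.mem_insert_self a W) h
      · exact ha h

end DirichletSeries

/-! ### Primes in the quadratic extension -/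

section QuadraticExtension

variable {F L : Type*} [Field F] [NumberField F] [Field L] [NumberField L] [Algebra F L]

lemma extIdeal_mul (m n : Ideal (𝓞 F)) : extIdeal L (m * n) = extIdeal L m * extIdeal L n :=
  Ideal.map_mul _ m n

lemma extIdeal_one : extIdeal L (1 : Ideal (𝓞 F)) = 1 := by
  unfold extIdeal
  rw [Ideal.one_eq_top, Ideal.map_top, Ideal.one_eq_top]

lemma extIdeal_ne_bot {n : Ideal (𝓞 F)} (hn : n ≠ ⊥) : extIdeal L n ≠ ⊥ := fun h =>
  hn ((Ideal.map_eq_bot_iff_of_injective (RingOfIntegers.algebraMap.injective F L)).1 h)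

lemma relNorm_extIdeal (hdeg : Module.finrank F L = 2) (n : Ideal (𝓞 F)) :
    Ideal.relNorm (𝓞 F) (extIdeal L n) = n ^ 2 := by
  unfold extIdeal
  rw [Ideal.relNorm_algebraMap, ← IsFractionRing.finrank_eq (𝓞 F) F (𝓞 L) L, hdeg]

lemma absNorm_extIdeal (hdeg : Module.finrank F L = 2) (n : Ideal (𝓞 F)) :
    Ideal.absNorm (extIdeal L n) = Ideal.absNorm n ^ 2 := by
  rw [← Ideal.absNorm_relNorm (𝓞 F), relNorm_extIdeal hdeg, map_pow]

lemma comap_eq_of_dvd {v : HeightOneSpectrum (𝓞 F)} {P : HeightOneSpectrum (𝓞 L)}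
    (h : P.asIdeal ∣ extIdeal L v.asIdeal) :
    P.asIdeal.comap (algebraMap (𝓞 F) (𝓞 L)) = v.asIdeal := by
  have h1 : v.asIdeal ≤ P.asIdeal.comap (algebraMap (𝓞 F) (𝓞 L)) :=
    Ideal.map_le_iff_le_comap.1 (Ideal.le_of_dvd h)
  have := v.isMaximal
  have := P.isPrime
  exact (v.isMaximal.eq_of_le (Ideal.IsPrime.ne_top inferInstance) h1).symm

lemma dvd_extIdeal_comap (P : HeightOneSpectrum (𝓞 L)) :
    P.asIdeal ∣ extIdeal L (P.asIdeal.comap (algebraMap (𝓞 F) (𝓞 L))) :=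
  Ideal.dvd_iff_le.2 Ideal.map_comap_le

lemma exists_below (F : Type*) [Field F] [NumberField F] [Algebra F L]
    (P : HeightOneSpectrum (𝓞 L)) :
    ∃ v : HeightOneSpectrum (𝓞 F), P.asIdeal.comap (algebraMap (𝓞 F) (𝓞 L)) = v.asIdeal :=
  ⟨P.under (𝓞 F), rfl⟩

lemma notMem_of_dvd_extIdeal {S' : Set (HeightOneSpectrum (𝓞 L))}
    {v : HeightOneSpectrum (𝓞 F)} (hv : v ∉ below F S') {P : HeightOneSpectrum (𝓞 L)}
    (h : P.asIdeal ∣ extIdeal L v.asIdeal) : P ∉ S' :=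
  fun hP => hv ⟨P, hP, comap_eq_of_dvd h⟩

lemma relNorm_prime {v : HeightOneSpectrum (𝓞 F)} {P : HeightOneSpectrum (𝓞 L)}
    (h : P.asIdeal ∣ extIdeal L v.asIdeal) :
    ∃ a : ℕ, 0 < a ∧ Ideal.relNorm (𝓞 F) P.asIdeal = v.asIdeal ^ a := by
  have := v.isMaximal
  have := P.isMaximal
  have : P.asIdeal.LiesOver v.asIdeal := ⟨(comap_eq_of_dvd h).symm⟩
  exact ⟨_, Ideal.inertiaDeg_pos P.asIdeal (𝓞 F),
    Ideal.relNorm_eq_pow_of_isMaximal P.asIdeal v.asIdeal⟩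

lemma one_lt_absNorm {K : Type*} [Field K] [NumberField K] (v : HeightOneSpectrum (𝓞 K)) :
    1 < Ideal.absNorm v.asIdeal := by
  have h0 := absNorm_pos v.ne_bot
  have h1 : Ideal.absNorm v.asIdeal ≠ 1 := fun h =>
    v.isPrime.ne_top (Ideal.absNorm_eq_one_iff.1 h)
  omega

lemma exists_prime_dvd {K : Type*} [Field K] [NumberField K] {n : Ideal (𝓞 K)} (h0 : n ≠ ⊥)
    (h1 : n ≠ ⊤) : ∃ P : HeightOneSpectrum (𝓞 K), P.asIdeal ∣ n := by
  obtain ⟨P, hP, hle⟩ := Ideal.exists_le_maximal n h1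
  exact ⟨⟨P, hP.isPrime, fun h => h0 (le_bot_iff.1 (h ▸ hle))⟩, Ideal.dvd_iff_le.2 hle⟩

/-- A prime of `F` generates a prime ideal of `L` or a product of two primes with the same
residue field. -/
lemma isPrime_or_eq_mul (hdeg : Module.finrank F L = 2) (v : HeightOneSpectrum (𝓞 F)) :
    IsInert L v ∨ ∃ P Q : HeightOneSpectrum (𝓞 L),
      extIdeal L v.asIdeal = P.asIdeal * Q.asIdeal ∧
      Ideal.absNorm P.asIdeal = Ideal.absNorm v.asIdeal ∧
      Ideal.absNorm Q.asIdeal = Ideal.absNorm v.asIdeal := by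
  have hN := absNorm_extIdeal hdeg v.asIdeal
  have hq := one_lt_absNorm v
  have hI0 : extIdeal L v.asIdeal ≠ ⊥ := extIdeal_ne_bot v.ne_bot
  have hI1 : extIdeal L v.asIdeal ≠ ⊤ := by
    intro h
    rw [h, Ideal.absNorm_top] at hN
    have := Nat.one_lt_pow two_ne_zero hq
    omega
  have key : ∀ P : HeightOneSpectrum (𝓞 L), P.asIdeal ∣ extIdeal L v.asIdeal →
      ∃ a, 0 < a ∧ Ideal.absNorm P.asIdeal = Ideal.absNorm v.asIdeal ^ a := by
    intro P hP
    obtain ⟨a, ha, h⟩ := relNorm_prime hP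
    exact ⟨a, ha, by rw [← Ideal.absNorm_relNorm (𝓞 F), h, map_pow]⟩
  obtain ⟨P, hP⟩ := exists_prime_dvd hI0 hI1
  obtain ⟨a, ha, haN⟩ := key P hP
  obtain ⟨J, hJ⟩ := hP
  by_cases hJ1 : J = ⊤
  · left
    unfold IsInert
    rw [hJ, hJ1, ← Ideal.one_eq_top, mul_one]
    exact P.isPrime
  right
  have hJ0 : J ≠ ⊥ := right_ne_zero_of_mul (hJ ▸ hI0)
  obtain ⟨Q, hQ⟩ := exists_prime_dvd hJ0 hJ1
  obtain ⟨b, hb, hbN⟩ := key Q (hJ ▸ hQ.mul_left _)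
  obtain ⟨J', hJ'⟩ := hQ
  have hJ'0 : J' ≠ ⊥ := right_ne_zero_of_mul (hJ' ▸ hJ0)
  rw [hJ, hJ', map_mul, map_mul, haN, hbN, ← mul_assoc, ← pow_add] at hN
  have hJ'N := absNorm_pos hJ'0
  -- Norms give `q_v^(a+b) N(J') = q_v²`, which leaves room for two primes of residue degree one and
  -- nothing else.
  have hab : a + b ≤ 2 := by
    rw [← Nat.pow_le_pow_iff_right hq, ← hN]
    exact Nat.le_mul_of_pos_right _ hJ'N
  obtain rfl : a = 1 := by omega
  obtain rfl : b = 1 := by omega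
  have hJ'1 : J' = ⊤ := by
    rw [← Ideal.absNorm_eq_one_iff]
    have h2 : 0 < Ideal.absNorm v.asIdeal ^ (1 + 1) := by positivity
    exact Nat.eq_of_mul_eq_mul_left h2 (by rw [hN, mul_one])
  rw [pow_one] at haN hbN
  refine ⟨P, Q, ?_, haN, hbN⟩
  rw [hJ, hJ', hJ'1, ← Ideal.one_eq_top, mul_one]

lemma IsInert.eq_of_dvd {v : HeightOneSpectrum (𝓞 F)} (hv : IsInert L v)
    {P : HeightOneSpectrum (𝓞 L)} (hP : P.asIdeal ∣ extIdeal L v.asIdeal) :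
    P.asIdeal = extIdeal L v.asIdeal := by
  have hp : Prime (extIdeal L v.asIdeal) := Ideal.prime_of_isPrime (extIdeal_ne_bot v.ne_bot) hv
  exact associated_iff_eq.1 ((P.prime.dvd_prime_iff_associated hp).1 hP)

lemma IsInert.not_isSplit {v : HeightOneSpectrum (𝓞 F)} (hv : IsInert L v) : ¬ IsSplit L v := by
  rintro ⟨P, Q, hPQ, h⟩
  exact hPQ (HeightOneSpectrum.ext ((hv.eq_of_dvd (h ▸ Dvd.intro _ rfl)).trans
    (hv.eq_of_dvd (h ▸ Dvd.intro_left _ rfl)).symm))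

lemma absNorm_of_dvd_of_isSplit (hdeg : Module.finrank F L = 2) {v : HeightOneSpectrum (𝓞 F)}
    (hv : IsSplit L v) {P : HeightOneSpectrum (𝓞 L)} (hP : P.asIdeal ∣ extIdeal L v.asIdeal) :
    Ideal.absNorm P.asIdeal = Ideal.absNorm v.asIdeal := by
  rcases isPrime_or_eq_mul hdeg v with h | ⟨P', Q', h, hP', hQ'⟩
  · exact absurd hv (IsInert.not_isSplit h)
  · rw [h] at hP
    rcases P.prime.dvd_or_dvd hP with h1 | h1
    · rw [associated_iff_eq.1 ((P.prime.dvd_prime_iff_associated P'.prime).1 h1), hP']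
    · rw [associated_iff_eq.1 ((P.prime.dvd_prime_iff_associated Q'.prime).1 h1), hQ']

/-- For distinct roots the cofactor `∑ x^i y^(r-1-i)` of `x - y` in `x^r - y^r = 0` vanishes. Modulo
`P` it equals `r y^(r-1)`, and `y` is a unit. -/
lemma natCast_mem_of_root_sub_mem {r : ℕ} (hr : r ≠ 0) {P : Ideal (𝓞 L)} {x y : 𝓞 L}
    (hx : x ^ r = 1) (hy : y ^ r = 1) (hxy : x ≠ y) (h : x - y ∈ P) : (r : 𝓞 L) ∈ P := by
  have hsum : ∑ i ∈ Finset.range r, x ^ i * y ^ (r - 1 - i) = 0 := by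
    have := (Commute.all x y).geom_sum₂_mul r
    rw [hx, hy, sub_self] at this
    exact (mul_eq_zero.1 this).resolve_right (sub_ne_zero.2 hxy)
  have hq : Ideal.Quotient.mk P x = Ideal.Quotient.mk P y := Ideal.Quotient.eq.2 h
  have h1 := congrArg (Ideal.Quotient.mk P) hsum
  rw [map_sum, map_zero, Finset.sum_congr rfl (g := fun _ => Ideal.Quotient.mk P y ^ (r - 1))]
    at h1
  · rw [Finset.sum_const, Finset.card_range, nsmul_eq_mul] at h1
    rw [← Ideal.Quotient.eq_zero_iff_mem, map_natCast]
    calc (r : 𝓞 L ⧸ P) = (r : 𝓞 L ⧸ P) * Ideal.Quotient.mk P y ^ (r - 1) *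
          Ideal.Quotient.mk P y := by
          rw [mul_assoc, ← pow_succ, Nat.sub_add_cancel (Nat.pos_of_ne_zero hr), ← map_pow, hy,
            map_one, mul_one]
      _ = 0 := by rw [h1, zero_mul]
  · intro i hi
    rw [map_mul, map_pow, map_pow, hq, ← pow_add]
    congr 1
    have := Finset.mem_range.1 hi
    omega

/-- In a totally real field, `1` is the only root of unity of odd order. -/
lemma eq_one_of_pow_eq_one [IsTotallyReal F] {r : ℕ} (hr : Odd r) {x : F} (hx : x ^ r = 1) :
    x = 1 := by
  let φ : F →+* ℂ := Classical.arbitrary (F →+* ℂ)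
  have hφ := IsTotallyReal.complexEmbedding_isReal φ
  have h1 : hφ.embedding x ^ r = 1 := by rw [← map_pow, hx, map_one]
  have h2 : hφ.embedding x = 1 := hr.strictMono_pow.injective (by simpa using h1)
  exact hφ.embedding.injective (by rw [h2, map_one])

lemma card_gal [IsGalois F L] (hdeg : Module.finrank F L = 2) : Nat.card Gal(L/F) = 2 := by
  rw [IsGalois.card_aut_eq_finrank, hdeg]

lemma exists_ne_one [IsGalois F L] (hdeg : Module.finrank F L = 2) : ∃ σ : Gal(L/F), σ ≠ 1 := by
  have : Nontrivial Gal(L/F) := Finite.one_lt_card_iff_nontrivial.1 (by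
    rw [card_gal hdeg]; norm_num)
  exact exists_ne 1

lemma eq_one_or_eq [IsGalois F L] (hdeg : Module.finrank F L = 2) {σ : Gal(L/F)} (hσ : σ ≠ 1)
    (τ : Gal(L/F)) : τ = 1 ∨ τ = σ := by
  classical
  have hc : Fintype.card Gal(L/F) = 2 := by rw [← Nat.card_eq_fintype_card, card_gal hdeg]
  have h2 : ({1, σ} : Finset Gal(L/F)) = Finset.univ :=
    Finset.eq_univ_of_card _ (by rw [Finset.card_pair hσ.symm, hc])
  simpa using (Finset.ext_iff.1 h2 τ).2 (Finset.mem_univ τ)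

lemma conj_conj [IsGalois F L] (hdeg : Module.finrank F L = 2) (σ : Gal(L/F)) (x : L) :
    σ (σ x) = x := by
  have h : σ ^ 2 = 1 := by rw [← card_gal (F := F) (L := L) hdeg, pow_card_eq_one']
  rw [← AlgEquiv.mul_apply, ← pow_two, h, AlgEquiv.one_apply]

/-- An `r`-th root of unity that is fixed by the nontrivial automorphism is trivial. -/
lemma eq_one_of_conj_eq [IsGalois F L] [IsTotallyReal F] (hdeg : Module.finrank F L = 2) {r : ℕ}
    (hr : Odd r) {σ : Gal(L/F)} (hσ : σ ≠ 1) {x : L} (hx : x ^ r = 1) (h : σ x = x) : x = 1 := by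
  have hfix : x ∈ (⊥ : IntermediateField F L) := by
    rw [IsGalois.mem_bot_iff_fixed]
    intro τ
    rcases eq_one_or_eq hdeg hσ τ with rfl | rfl
    · rfl
    · exact h
  obtain ⟨y, rfl⟩ := IntermediateField.mem_bot.1 hfix
  have hy : y ^ r = 1 := (algebraMap F L).injective (by rw [map_pow, hx, map_one])
  rw [eq_one_of_pow_eq_one hr hy, map_one]

open scoped Pointwise in
lemma smul_extIdeal (σ : Gal(L/F)) (n : Ideal (𝓞 F)) : σ • extIdeal L n = extIdeal L n := by
  unfold extIdeal
  rw [Ideal.pointwise_smul_def, Ideal.map_map]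
  congr 1
  exact RingHom.ext fun x => RingOfIntegers.ext (σ.commutes (x : F))

lemma coe_smul_integer (σ : Gal(L/F)) (x : 𝓞 L) : ((σ • x : 𝓞 L) : L) = σ (x : L) := rfl

open scoped Pointwise in
/-- The primes of `L` over `v` are permuted transitively. -/
lemma exists_smul_eq [IsGalois F L] {v : HeightOneSpectrum (𝓞 F)} {P Q : HeightOneSpectrum (𝓞 L)}
    (hP : P.asIdeal ∣ extIdeal L v.asIdeal) (hQ : Q.asIdeal ∣ extIdeal L v.asIdeal) :
    ∃ σ : Gal(L/F), σ • P.asIdeal = Q.asIdeal := by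
  have : IsGaloisGroup Gal(L/F) (𝓞 F) (𝓞 L) :=
    IsGaloisGroup.of_isFractionRing Gal(L/F) (𝓞 F) (𝓞 L) F L
  have := P.isPrime
  have := Q.isPrime
  have : P.asIdeal.LiesOver v.asIdeal := ⟨(comap_eq_of_dvd hP).symm⟩
  have : Q.asIdeal.LiesOver v.asIdeal := ⟨(comap_eq_of_dvd hQ).symm⟩
  exact Ideal.exists_smul_eq_of_isGaloisGroup v.asIdeal P.asIdeal Q.asIdeal Gal(L/F)

/-- The embedding of residue fields is an injection between finite sets of equal size, hence onto.
-/
lemma exists_sub_mem_of_absNorm_eq {v : HeightOneSpectrum (𝓞 F)} {P : HeightOneSpectrum (𝓞 L)}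
    (hP : P.asIdeal ∣ extIdeal L v.asIdeal)
    (hN : Ideal.absNorm P.asIdeal = Ideal.absNorm v.asIdeal) (x : 𝓞 L) :
    ∃ y : 𝓞 F, x - algebraMap (𝓞 F) (𝓞 L) y ∈ P.asIdeal := by
  have := v.isMaximal
  have := P.isPrime
  have hle : v.asIdeal ≤ P.asIdeal.comap (algebraMap (𝓞 F) (𝓞 L)) := (comap_eq_of_dvd hP).ge
  let φ : 𝓞 F ⧸ v.asIdeal →+* 𝓞 L ⧸ P.asIdeal :=
    Ideal.quotientMap P.asIdeal (algebraMap (𝓞 F) (𝓞 L)) hle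
  have hinj : Function.Injective φ := Ideal.quotientMap_injective' (comap_eq_of_dvd hP).le
  have : Finite (𝓞 F ⧸ v.asIdeal) := Ideal.finiteQuotientOfFreeOfNeBot v.asIdeal v.ne_bot
  have : Finite (𝓞 L ⧸ P.asIdeal) := Ideal.finiteQuotientOfFreeOfNeBot P.asIdeal P.ne_bot
  have hcard : Nat.card (𝓞 L ⧸ P.asIdeal) = Nat.card (𝓞 F ⧸ v.asIdeal) := by
    simpa [Ideal.absNorm_apply, Submodule.cardQuot_apply] using hN
  have hsurj : Function.Surjective φ :=
    ((Nat.bijective_iff_injective_and_card φ).2 ⟨hinj, hcard.symm⟩).2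
  obtain ⟨y, hy⟩ := hsurj (Ideal.Quotient.mk _ x)
  obtain ⟨y, rfl⟩ := Ideal.Quotient.mk_surjective y
  exact ⟨y, Ideal.Quotient.eq.1 hy.symm⟩

/-! ### Ramification in the cyclotomic quadratic extension. -/

section Cyclotomic

variable [IsTotallyReal F] {r : ℕ} [IsCyclotomicExtension {r} F L]

lemma exists_integral_primitiveRoot (F : Type*) [Field F] [NumberField F] [Algebra F L] (r : ℕ)
    [IsCyclotomicExtension {r} F L] (hr : r ≠ 0) : ∃ ζ : 𝓞 L, IsPrimitiveRoot ζ r := by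
  have : NeZero r := ⟨hr⟩
  have hζ := IsCyclotomicExtension.zeta_spec r F L
  have : NeZero ((r : ℕ) : F) := ⟨Nat.cast_ne_zero.2 hr⟩
  refine ⟨⟨IsCyclotomicExtension.zeta r F L, hζ.isIntegral (Nat.pos_of_ne_zero hr)⟩, ?_⟩
  exact IsPrimitiveRoot.of_map_of_injective (f := algebraMap (𝓞 L) L) hζ
    RingOfIntegers.coe_injective

open scoped Pointwise in
/-- A prime of `F` whose primes in `L` do not divide `r` is inert or split. -/
lemma isInert_or_isSplit (hr : r.Prime) (hr2 : r ≠ 2) (hdeg : Module.finrank F L = 2)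
    {v : HeightOneSpectrum (𝓞 F)}
    (hv : ∀ P : HeightOneSpectrum (𝓞 L), P.asIdeal ∣ extIdeal L v.asIdeal →
      (r : 𝓞 L) ∉ P.asIdeal) : IsInert L v ∨ IsSplit L v := by
  have : IsGalois F L := IsCyclotomicExtension.isGalois {r} F L
  refine (isPrime_or_eq_mul hdeg v).imp_right ?_
  rintro ⟨P, Q, hPQ, hP, -⟩
  by_cases hne : P = Q
  swap
  · exact ⟨P, Q, hne, hPQ⟩
  subst hne
  exfalso
  have hdvd : P.asIdeal ∣ extIdeal L v.asIdeal := hPQ ▸ Dvd.intro _ rfl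
  obtain ⟨σ, hσ⟩ := exists_ne_one (F := F) (L := L) hdeg
  -- In the ramified case `P²` comes from `F`, so it is stable under `σ`; this forces `σ` to map `P`
  -- into itself.
  have hσP : σ • P.asIdeal ≤ P.asIdeal := by
    have h1 : (σ • P.asIdeal) ^ 2 = P.asIdeal ^ 2 := by
      rw [← smul_pow', pow_two, ← hPQ, smul_extIdeal]
    exact Ideal.le_of_dvd (P.prime.dvd_of_dvd_pow (n := 2) (by
      rw [h1]; exact dvd_pow_self _ two_ne_zero))
  obtain ⟨ζ, hζ⟩ := exists_integral_primitiveRoot (L := L) F r hr.ne_zero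
  have hσζ : σ • ζ ≠ ζ := by
    intro h
    have h1 : (ζ : L) = 1 := eq_one_of_conj_eq hdeg (hr.odd_of_ne_two hr2) hσ
      (by exact_mod_cast congrArg (algebraMap (𝓞 L) L) hζ.pow_eq_one)
      (by rw [← coe_smul_integer, h])
    have h2 : ζ = 1 := RingOfIntegers.ext (by simpa using h1)
    exact hr.ne_one (by rw [hζ.eq_orderOf, h2, orderOf_one])
  -- Modulo `P`, `ζ` is congruent to an element of `F`, which `σ` fixes. Two distinct `r`-th roots
  -- of unity thus agree modulo `P`, so `P` divides `r`.
  have hmem : σ • ζ - ζ ∈ P.asIdeal := by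
    obtain ⟨y, hy⟩ := exists_sub_mem_of_absNorm_eq hdvd hP ζ
    have h1 : σ • (ζ - algebraMap (𝓞 F) (𝓞 L) y) ∈ P.asIdeal :=
      hσP (Ideal.smul_mem_pointwise_smul σ _ _ hy)
    rw [smul_sub] at h1
    have h2 : σ • (algebraMap (𝓞 F) (𝓞 L) y) = algebraMap (𝓞 F) (𝓞 L) y :=
      RingOfIntegers.ext (σ.commutes (y : F))
    rw [h2] at h1
    have := P.asIdeal.sub_mem h1 hy
    rwa [sub_sub_sub_cancel_right] at this
  refine hv P hdvd (natCast_mem_of_root_sub_mem hr.ne_zero ?_ hζ.pow_eq_one hσζ hmem)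
  rw [← smul_pow', hζ.pow_eq_one, smul_one]

end Cyclotomic

end QuadraticExtension

/-! ### The power residue symbol at a prime -/

section PrimeSymbol

variable {L : Type*} [Field L] [NumberField L]

/-! ### Congruences modulo a prime between elements of the field. -/

section Congruence

variable (P : HeightOneSpectrum (𝓞 L))

/-- Congruence modulo `P` of elements of `L`. -/
def CongrAt (x y : L) : Prop := P.valuation L (x - y) < 1

variable {P}

lemma CongrAt.symm {x y : L} (h : CongrAt P x y) : CongrAt P y x := by
  unfold CongrAt at *
  rwa [Valuation.map_sub_swap]

lemma CongrAt.trans {x y z : L} (h : CongrAt P x y) (h' : CongrAt P y z) : CongrAt P x z := by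
  unfold CongrAt at *
  have := Valuation.map_add_lt (P.valuation L) h h'
  rwa [sub_add_sub_cancel] at this

lemma congrAt_refl (x : L) : CongrAt P x x := by
  unfold CongrAt
  rw [sub_self, map_zero]
  exact zero_lt_one

lemma CongrAt.mul {x y x' y' : L} (h : CongrAt P x y) (h' : CongrAt P x' y')
    (hx : P.valuation L x' ≤ 1) (hy : P.valuation L y ≤ 1) : CongrAt P (x * x') (y * y') := by
  unfold CongrAt at *
  have h1 : x * x' - y * y' = (x - y) * x' + y * (x' - y') := by ring
  rw [h1]
  refine Valuation.map_add_lt _ ?_ ?_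
  · rw [map_mul]
    exact lt_of_le_of_lt (mul_le_of_le_one_right' hx) h
  · rw [map_mul]
    exact lt_of_le_of_lt (mul_le_of_le_one_left' hy) h'

lemma CongrAt.valuation_eq_one {x y : L} (h : CongrAt P x y) (hy : P.valuation L y = 1) :
    P.valuation L x = 1 := by
  unfold CongrAt at h
  have := Valuation.map_add_eq_of_lt_right (P.valuation L) (x := x - y) (y := y) (by rwa [hy])
  rwa [sub_add_cancel, hy] at this

lemma CongrAt.pow {x y : L} (h : CongrAt P x y) (hx : P.valuation L x ≤ 1)
    (hy : P.valuation L y ≤ 1) (n : ℕ) : CongrAt P (x ^ n) (y ^ n) := by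
  induction n with
  | zero => rw [pow_zero, pow_zero]; exact congrAt_refl 1
  | succ n ih =>
    rw [pow_succ, pow_succ]
    exact ih.mul h hx (by rw [map_pow]; exact pow_le_one₀ zero_le hy)

lemma congrAt_coe_iff {x y : 𝓞 L} : CongrAt P (x : L) (y : L) ↔ x - y ∈ P.asIdeal := by
  unfold CongrAt
  rw [← map_sub, HeightOneSpectrum.valuation_lt_one_iff_mem]

lemma exists_congrAt {x : L} (hx : P.valuation L x ≤ 1) : ∃ z : 𝓞 L, CongrAt P x z := by
  obtain ⟨z, hz⟩ := P.exists_valuation_sub_lt_of_integer hx 1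
  exact ⟨z, CongrAt.symm hz⟩

lemma valuation_eq_one_of_pow {r : ℕ} (hr : r ≠ 0) {x : L} (hx : P.valuation L x ^ r = 1) :
    P.valuation L x = 1 :=
  (pow_eq_one_iff_of_nonneg zero_le hr).1 hx

lemma valuation_root_of_unity {r : ℕ} (hr : r ≠ 0) {x : L} (hx : x ^ r = 1) :
    P.valuation L x = 1 :=
  valuation_eq_one_of_pow hr (by rw [← map_pow, hx, map_one])

lemma pow_absNorm_sub_one_sub_one_mem {z : 𝓞 L} (hz : z ∉ P.asIdeal) :
    z ^ (Ideal.absNorm P.asIdeal - 1) - 1 ∈ P.asIdeal := by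
  have := P.isMaximal
  have : Finite (𝓞 L ⧸ P.asIdeal) := Ideal.finiteQuotientOfFreeOfNeBot P.asIdeal P.ne_bot
  have := Fintype.ofFinite (𝓞 L ⧸ P.asIdeal)
  let := Ideal.Quotient.field P.asIdeal
  have h := FiniteField.pow_card_sub_one_eq_one (Ideal.Quotient.mk P.asIdeal z)
    fun h => hz (Ideal.Quotient.eq_zero_iff_mem.1 h)
  rw [← Nat.card_eq_fintype_card, ← Submodule.cardQuot_apply, ← Ideal.absNorm_apply] at h
  rw [← Ideal.Quotient.eq, map_pow, h, map_one]

/-- Fermat's little theorem, extended from integers to all elements of `L` that are units at `P` by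
replacing them with congruent integers. -/
lemma congrAt_pow_absNorm_sub_one {x : L} (hx : P.valuation L x = 1) :
    CongrAt P (x ^ (Ideal.absNorm P.asIdeal - 1)) 1 := by
  obtain ⟨z, hz⟩ := exists_congrAt hx.le
  have hz1 := hz.symm.valuation_eq_one hx
  have h1 := hz.pow hx.le hz1.le (Ideal.absNorm P.asIdeal - 1)
  refine h1.trans ?_
  have h2 := congrAt_coe_iff (P := P).2 (pow_absNorm_sub_one_sub_one_mem
    (P.valuation_eq_one_iff_notMem.1 hz1))
  simpa using h2

end Congruence

variable {r : ℕ} {P : HeightOneSpectrum (𝓞 L)}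

/-- Reduction modulo a prime not dividing `r` is injective on `r`-th roots of unity; this makes a
symbol determined by its defining congruence. -/
lemma root_of_unity_eq_of_congrAt (hr : r ≠ 0) (hP : (r : 𝓞 L) ∉ P.asIdeal) {x y : L}
    (hx : x ^ r = 1) (hy : y ^ r = 1) (h : CongrAt P x y) : x = y := by
  have hint : ∀ z : L, z ^ r = 1 → ∃ t : 𝓞 L, algebraMap (𝓞 L) L t = z := fun z hz =>
    ⟨⟨z, IsIntegral.of_pow (Nat.pos_of_ne_zero hr) (by rw [hz]; exact isIntegral_one)⟩, rfl⟩
  obtain ⟨x, rfl⟩ := hint x hx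
  obtain ⟨y, rfl⟩ := hint y hy
  by_contra hne
  rw [← map_pow] at hx hy
  exact hP (natCast_mem_of_root_sub_mem hr
    (RingOfIntegers.coe_injective (hx.trans (map_one (algebraMap (𝓞 L) L)).symm))
    (RingOfIntegers.coe_injective (hy.trans (map_one (algebraMap (𝓞 L) L)).symm))
    (fun h => hne (congrArg (algebraMap (𝓞 L) L) h)) (congrAt_coe_iff.1 h))

/-- `ζ^(N P - 1)` is congruent to `1` modulo `P` and is itself an `r`-th root of unity, so it equals
`1`. -/
lemma dvd_absNorm_sub_one (hr : r.Prime) {ζ : 𝓞 L} (hζ : IsPrimitiveRoot ζ r)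
    (hP : (r : 𝓞 L) ∉ P.asIdeal) : r ∣ Ideal.absNorm P.asIdeal - 1 := by
  have hζP : ζ ∉ P.asIdeal := fun h => P.isPrime.ne_top
    (Ideal.eq_top_of_isUnit_mem _ h (hζ.isUnit hr.ne_zero))
  have h := pow_absNorm_sub_one_sub_one_mem hζP
  rw [← hζ.pow_eq_one_iff_dvd]
  by_contra hne
  refine hP (natCast_mem_of_root_sub_mem hr.ne_zero ?_ (one_pow r) hne h)
  rw [← pow_mul, mul_comm, pow_mul, hζ.pow_eq_one, one_pow]

/-- `ζ` is a value of the `r`-th power residue symbol `(a / P)_r`. -/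
def IsSymbolValue (r : ℕ) (P : HeightOneSpectrum (𝓞 L)) (a ζ : L) : Prop :=
  ζ ^ r = 1 ∧ ∃ b : L, b ≠ 0 ∧
    CongrAt P ((a * b ^ r) ^ ((Ideal.absNorm P.asIdeal - 1) / r)) ζ

lemma absNorm_sub_one_div_pos (hd : r ∣ Ideal.absNorm P.asIdeal - 1) :
    (Ideal.absNorm P.asIdeal - 1) / r ≠ 0 := by
  have := one_lt_absNorm P
  obtain ⟨k, hk⟩ := hd
  have hr : r ≠ 0 := by rintro rfl; omega
  rw [hk, Nat.mul_div_cancel_left _ (Nat.pos_of_ne_zero hr)]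
  rintro rfl
  omega

/-- Two admissible `b`, `b'` have a quotient that is a unit at `P`, and its `r`-th power raised to
`(N P - 1) / r` is congruent to `1` by Fermat. Hence neither the choice of `b` nor that of the root
in `primeSymbol` matters. -/
lemma IsSymbolValue.unique (hr : r ≠ 0) (hd : r ∣ Ideal.absNorm P.asIdeal - 1)
    (hP : (r : 𝓞 L) ∉ P.asIdeal) {a ζ ζ' : L} (h : IsSymbolValue r P a ζ)
    (h' : IsSymbolValue r P a ζ') : ζ = ζ' := by
  obtain ⟨hζ, b, hb, hc⟩ := h
  obtain ⟨hζ', b', hb', hc'⟩ := h'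
  have he := absNorm_sub_one_div_pos hd
  have val : ∀ {b ζ : L}, ζ ^ r = 1 →
      CongrAt P ((a * b ^ r) ^ ((Ideal.absNorm P.asIdeal - 1) / r)) ζ →
      P.valuation L (a * b ^ r) = 1 := fun hζ hc =>
    valuation_eq_one_of_pow he (by
      rw [← map_pow]; exact hc.valuation_eq_one (valuation_root_of_unity hr hζ))
  have hv := val hζ hc
  have hv' := val hζ' hc'
  have hu : P.valuation L (b' / b) = 1 := by
    refine valuation_eq_one_of_pow hr ?_
    have h1 : a * b ^ r * (b' / b) ^ r = a * b' ^ r := by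
      rw [mul_assoc, ← mul_pow, mul_div_cancel₀ _ hb]
    have h2 := congrArg (P.valuation L) h1
    rwa [map_mul, hv, hv', one_mul, map_pow] at h2
  have hF := congrAt_pow_absNorm_sub_one hu
  have hmul := hc.mul hF (by rw [map_pow, hu, one_pow])
    (valuation_root_of_unity hr hζ).le
  have heq : (a * b ^ r) ^ ((Ideal.absNorm P.asIdeal - 1) / r) *
      (b' / b) ^ (Ideal.absNorm P.asIdeal - 1) =
      (a * b' ^ r) ^ ((Ideal.absNorm P.asIdeal - 1) / r) := by
    conv_lhs => rw [← Nat.mul_div_cancel' hd, pow_mul, Nat.mul_div_cancel' hd]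
    rw [← mul_pow, mul_assoc, ← mul_pow, mul_div_cancel₀ _ hb]
  rw [heq, mul_one] at hmul
  exact root_of_unity_eq_of_congrAt hr hP hζ hζ' (hmul.symm.trans hc')

lemma IsSymbolValue.primeSymbol_eq (hr : r ≠ 0) (hd : r ∣ Ideal.absNorm P.asIdeal - 1)
    (hP : (r : 𝓞 L) ∉ P.asIdeal) (emb : L →+* ℂ) {a ζ : L} (h : IsSymbolValue r P a ζ) :
    primeSymbol r emb P a = emb ζ := by
  have hex : ∃ ζ : L, ζ ^ r = 1 ∧ ∃ b : L, b ≠ 0 ∧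
      P.valuation L ((a * b ^ r) ^ ((Ideal.absNorm P.asIdeal - 1) / r) - ζ) < 1 := ⟨ζ, h⟩
  unfold primeSymbol
  rw [dif_pos hex]
  exact congrArg emb (IsSymbolValue.unique hr hd hP hex.choose_spec h)

lemma isSymbolValue_one : IsSymbolValue r P 1 1 :=
  ⟨one_pow r, 1, one_ne_zero, by
    rw [one_pow, mul_one, one_pow]; exact congrAt_refl 1⟩

lemma IsSymbolValue.mul (hr : r ≠ 0) {a ζ a' ζ' : L} (h : IsSymbolValue r P a ζ)
    (h' : IsSymbolValue r P a' ζ') : IsSymbolValue r P (a * a') (ζ * ζ') := by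
  obtain ⟨hζ, b, hb, hc⟩ := h
  obtain ⟨hζ', b', hb', hc'⟩ := h'
  refine ⟨by rw [mul_pow, hζ, hζ', one_mul], b * b', mul_ne_zero hb hb', ?_⟩
  have := hc.mul hc' (hc'.valuation_eq_one (valuation_root_of_unity hr hζ')).le
    (valuation_root_of_unity hr hζ).le
  rwa [← mul_pow, show a * b ^ r * (a' * b' ^ r) = a * a' * (b * b') ^ r by ring] at this

/-- The power `(N P - 1) / r` of a nonzero residue is an `r`-th root of unity in the residue field.
The reduction of `ξ` is still primitive there, so this residue is the reduction of a power of `ξ`.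
-/
lemma exists_isSymbolValue (hr : r.Prime) {ξ : 𝓞 L} (hξ : IsPrimitiveRoot ξ r)
    (hP : (r : 𝓞 L) ∉ P.asIdeal) {a b : L} (hb : b ≠ 0) (hv : P.valuation L (a * b ^ r) = 1) :
    ∃ ζ, IsSymbolValue r P a ζ := by
  have hd := dvd_absNorm_sub_one hr hξ hP
  obtain ⟨z, hz⟩ := exists_congrAt hv.le
  have hz1 := hz.symm.valuation_eq_one hv
  have hzP := P.valuation_eq_one_iff_notMem.1 hz1
  have hpow : (Ideal.Quotient.mk P.asIdeal z ^ ((Ideal.absNorm P.asIdeal - 1) / r)) ^ r = 1 := by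
    rw [← pow_mul, Nat.div_mul_cancel hd, ← map_pow, ← map_one (Ideal.Quotient.mk P.asIdeal)]
    exact Ideal.Quotient.eq.2 (pow_absNorm_sub_one_sub_one_mem hzP)
  have := P.isPrime
  have hprim : IsPrimitiveRoot (Ideal.Quotient.mk P.asIdeal ξ) r := by
    refine IsPrimitiveRoot.mk_of_lt _ hr.pos (by rw [← map_pow, hξ.pow_eq_one, map_one]) ?_
    intro l hl hlr h
    rw [← map_pow, ← map_one (Ideal.Quotient.mk P.asIdeal), Ideal.Quotient.eq] at h
    refine hP (natCast_mem_of_root_sub_mem hr.ne_zero ?_ (one_pow r)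
      (hξ.pow_ne_one_of_pos_of_lt hl.ne' hlr) h)
    rw [← pow_mul, mul_comm, pow_mul, hξ.pow_eq_one, one_pow]
  have : NeZero r := ⟨hr.ne_zero⟩
  obtain ⟨i, -, hi⟩ := hprim.eq_pow_of_pow_eq_one hpow
  refine ⟨((ξ ^ i : 𝓞 L) : L), ?_, b, hb, ?_⟩
  · rw [← map_pow, ← pow_mul, mul_comm, pow_mul, hξ.pow_eq_one, one_pow, map_one]
  · refine (hz.pow hv.le hz1.le _).trans ?_
    rw [← map_pow, congrAt_coe_iff, ← Ideal.Quotient.eq, map_pow, map_pow, hi]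

-- An element integral at `P` is a fraction `n / d` of integers with `d` outside `P`, and `σ`
-- carries membership in `P` to membership in `Q`.
open scoped Pointwise in
lemma CongrAt.map {F : Type*} [Field F] [NumberField F] [Algebra F L] (σ : Gal(L/F))
    {P Q : HeightOneSpectrum (𝓞 L)} (hσ : σ • P.asIdeal = Q.asIdeal) {x y : L}
    (h : CongrAt P x y) : CongrAt Q (σ x) (σ y) := by
  unfold CongrAt at *
  rw [← map_sub]
  generalize x - y = t at h
  obtain ⟨n, d, hnd⟩ := P.exists_primeCompl_mul_eq_of_integer t h.le
  have hd1 : P.valuation L (algebraMap (𝓞 L) L d) = 1 := P.valuation_eq_one_iff_notMem.2 d.2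
  have hn : n ∈ P.asIdeal := by
    refine (P.valuation_lt_one_iff_mem (K := L) n).1 ?_
    rw [Algebra.cast, ← hnd, map_mul, hd1, mul_one]
    exact h
  have hσn : Q.valuation L (algebraMap (𝓞 L) L (σ • n)) < 1 := by
    rw [Q.valuation_lt_one_iff_mem, ← hσ]
    exact Ideal.smul_mem_pointwise_smul σ _ _ hn
  have hσd : Q.valuation L (algebraMap (𝓞 L) L (σ • d.1)) = 1 := by
    rw [Q.valuation_eq_one_iff_notMem, ← hσ, Ideal.smul_mem_pointwise_smul_iff]
    exact d.2
  have h2 := congrArg σ hnd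
  rw [map_mul] at h2
  change σ t * algebraMap (𝓞 L) L (σ • d.1) = algebraMap (𝓞 L) L (σ • n) at h2
  rwa [← h2, map_mul, hσd, mul_one] at hσn

-- Galois equivariance of the symbol, `(σa / σP) = σ (a / P)`. Equality of norms makes the two
-- defining exponents agree.
open scoped Pointwise in
lemma IsSymbolValue.map {F : Type*} [Field F] [NumberField F] [Algebra F L] (σ : Gal(L/F))
    {P Q : HeightOneSpectrum (𝓞 L)} (hσ : σ • P.asIdeal = Q.asIdeal)
    (hN : Ideal.absNorm P.asIdeal = Ideal.absNorm Q.asIdeal) {a ζ : L}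
    (h : IsSymbolValue r P a ζ) : IsSymbolValue r Q (σ a) (σ ζ) := by
  obtain ⟨hζ, b, hb, hc⟩ := h
  refine ⟨by rw [← map_pow, hζ, map_one], σ b, (map_ne_zero σ).2 hb, ?_⟩
  have := hc.map σ hσ
  rwa [map_pow, map_mul, map_pow, hN] at this

end PrimeSymbol

/-! ### Valuations of the generators -/

section Generators

/-! ### Orders of ideals versus valuations of elements. -/

section Count

variable {L : Type*} [Field L] [NumberField L] (P : HeightOneSpectrum (𝓞 L))

lemma count_coe_eq_ord {n : Ideal (𝓞 L)} (hn : n ≠ ⊥) :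
    FractionalIdeal.count L P (n : FractionalIdeal (𝓞 L)⁰ L) = ord P n := by
  classical
  rw [FractionalIdeal.count_coe L P hn,
    Ideal.count_associates_factors_eq hn P.isPrime P.ne_bot]
  unfold ord
  congr!

lemma pow_dvd_iff_le_ord {n : Ideal (𝓞 L)} (hn : n ≠ ⊥) (k : ℕ) :
    P.asIdeal ^ k ∣ n ↔ k ≤ ord P n := by
  classical
  rw [pow_dvd_iff_le_emultiplicity,
    UniqueFactorizationMonoid.emultiplicity_eq_count_normalizedFactors P.irreducible hn,
    normalize_eq, Nat.cast_le]
  unfold ord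
  congr!

/-- Links the valuations in which the symbol is defined with the exponents of fractional ideals in
which the decompositions are given. Writing `x` as a quotient reduces it to integers. -/
lemma valuation_eq_exp_count {x : L} (hx : x ≠ 0) :
    P.valuation L x =
      WithZero.exp (-FractionalIdeal.count L P (FractionalIdeal.spanSingleton (𝓞 L)⁰ x)) := by
  have hint : ∀ y : 𝓞 L, y ≠ 0 → P.valuation L (algebraMap (𝓞 L) L y) = WithZero.exp
      (-FractionalIdeal.count L P (FractionalIdeal.spanSingleton (𝓞 L)⁰ (algebraMap (𝓞 L) L y))) := by
    intro y hy
    rw [HeightOneSpectrum.valuation_of_algebraMap, P.intValuation_if_neg hy,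
      ← FractionalIdeal.coeIdeal_span_singleton, FractionalIdeal.count_coe L P
        (by simpa [Ideal.span_singleton_eq_bot] using hy)]
  obtain ⟨a, b, hb, rfl⟩ := IsFractionRing.div_surjective (A := 𝓞 L) x
  have hb0 : b ≠ 0 := nonZeroDivisors.ne_zero hb
  have ha0 : a ≠ 0 := by
    rintro rfl
    simp at hx
  have hb1 : algebraMap (𝓞 L) L b ≠ 0 := by simpa using hb0
  have h1 : FractionalIdeal.spanSingleton (𝓞 L)⁰ (algebraMap (𝓞 L) L a) =
      FractionalIdeal.spanSingleton (𝓞 L)⁰ (algebraMap (𝓞 L) L a / algebraMap (𝓞 L) L b) *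
        FractionalIdeal.spanSingleton (𝓞 L)⁰ (algebraMap (𝓞 L) L b) := by
    rw [FractionalIdeal.spanSingleton_mul_spanSingleton, div_mul_cancel₀ _ hb1]
  have h2 := congrArg (FractionalIdeal.count L P) h1
  rw [FractionalIdeal.count_mul L P (FractionalIdeal.spanSingleton_ne_zero_iff.2 hx)
    (FractionalIdeal.spanSingleton_ne_zero_iff.2 hb1)] at h2
  rw [map_div₀, hint a ha0, hint b hb0, h2, ← WithZero.exp_sub]
  congr 1
  ring

/-- Otherwise all of `n` would lie in the next power of `P`, against the definition of the order. -/
lemma exists_mem_valuation_eq {n : Ideal (𝓞 L)} (hn : n ≠ ⊥) :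
    ∃ x ∈ n, P.valuation L (algebraMap (𝓞 L) L x) = WithZero.exp (-(ord P n : ℤ)) := by
  have hle : ∀ x ∈ n, P.intValuation x ≤ WithZero.exp (-(ord P n : ℤ)) := fun x hx =>
    (P.intValuation_le_pow_iff_mem x _).2
      (Ideal.le_of_dvd ((pow_dvd_iff_le_ord P hn _).2 le_rfl) hx)
  by_contra! hne
  have hlt : ¬ n ≤ P.asIdeal ^ (ord P n + 1) := fun h => by
    have := (pow_dvd_iff_le_ord P hn _).1 (Ideal.dvd_iff_le.2 h)
    omega
  refine hlt fun x hx => ?_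
  rw [← P.intValuation_le_pow_iff_mem]
  have h1 := lt_of_le_of_ne (hle x hx) (by
    rw [← HeightOneSpectrum.valuation_of_algebraMap (K := L)]; exact hne x hx)
  by_cases h0 : x = 0
  · rw [h0, map_zero]; exact zero_le
  rw [P.intValuation_if_neg h0] at h1 ⊢
  rw [WithZero.exp_lt_exp] at h1
  rw [WithZero.exp_le_exp]
  push_cast
  omega

/-- If `n` and `m` generate the same module over the `S`-integers, then they have the same
valuation outside `S`. -/
lemma valuation_of_span_eq {S' : Set (HeightOneSpectrum (𝓞 L))} (hP : P ∉ S') {n : Ideal (𝓞 L)}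
    (hn : n ≠ ⊥) {m : L}
    (h : Submodule.span (S'.integer L) (algebraMap (𝓞 L) L '' (n : Set (𝓞 L))) =
      Submodule.span (S'.integer L) {m}) :
    P.valuation L m = WithZero.exp (-(ord P n : ℤ)) := by
  have hSle : ∀ a : S'.integer L, P.valuation L (a : L) ≤ 1 := fun a => a.2 P hP
  apply le_antisymm
  · have hm : m ∈ Submodule.span (S'.integer L) (algebraMap (𝓞 L) L '' (n : Set (𝓞 L))) := by
      rw [h]; exact Submodule.mem_span_singleton_self m
    clear h
    induction hm using Submodule.span_induction with
    | mem x hx =>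
      obtain ⟨y, hy, rfl⟩ := hx
      rw [HeightOneSpectrum.valuation_of_algebraMap, P.intValuation_le_pow_iff_mem]
      exact Ideal.le_of_dvd ((pow_dvd_iff_le_ord P hn _).2 le_rfl) hy
    | zero => rw [map_zero]; exact zero_le
    | add x y _ _ hx hy => exact Valuation.map_add_le _ hx hy
    | smul a x _ hx =>
      rw [Algebra.smul_def, map_mul]
      exact (mul_le_of_le_one_left' (hSle a)).trans hx
  · obtain ⟨x, hx, hv⟩ := exists_mem_valuation_eq P hn
    have hm : algebraMap (𝓞 L) L x ∈ Submodule.span (S'.integer L) {m} := by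
      rw [← h]; exact Submodule.subset_span ⟨x, hx, rfl⟩
    obtain ⟨a, ha⟩ := Submodule.mem_span_singleton.1 hm
    rw [← hv, ← ha, Algebra.smul_def, map_mul]
    exact mul_le_of_le_one_left' (hSle a)

end Count

variable {F L : Type*} [Field F] [NumberField F] [Field L] [NumberField L] [Algebra F L]
  {r : ℕ} {S' : Set (HeightOneSpectrum (𝓞 L))}

namespace SymbolChoices

variable (C : SymbolChoices F L r S')

/-- Outside of `v`, the valuation of the generator attached to `v` is divisible by `r`. -/
lemma exists_valuation_mul_pow_eq_one {v : HeightOneSpectrum (𝓞 F)} (hv : v ∉ below F S')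
    {P : HeightOneSpectrum (𝓞 L)} (hP : P ∉ S') (hPv : ¬ P.asIdeal ∣ extIdeal L v.asIdeal) :
    ∃ b : L, b ≠ 0 ∧ P.valuation L (algebraMap F L (C.mF v * C.meF v) * b ^ r) = 1 := by
  have hm0 : algebraMap F L (C.mF v) ≠ 0 := (map_ne_zero _).2 (C.mF_ne_zero v hv)
  set g := FractionalIdeal.extendedHom L (𝓞 L) (C.gF v) with hg
  have hext := congrArg (FractionalIdeal.extendedHom L (𝓞 L)) (C.decomp v hv)
  have hspan : FractionalIdeal.extendedHom L (𝓞 L)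
      (FractionalIdeal.spanSingleton (𝓞 F)⁰ (C.mF v)) =
      FractionalIdeal.spanSingleton (𝓞 L)⁰ (algebraMap F L (C.mF v)) := by
    rw [FractionalIdeal.extendedHom_spanSingleton]
    congr 1
    obtain ⟨a, b, hb, hab⟩ := IsFractionRing.div_surjective (A := 𝓞 F) (C.mF v)
    rw [← hab, map_div₀, map_div₀]
    simp only [IsFractionRing.map, IsLocalization.map_eq]
    rfl
  rw [map_mul, map_mul, map_pow, hspan, FractionalIdeal.extendedHom_coeIdeal_eq_map,
    FractionalIdeal.extendedHom_coeIdeal_eq_map, ← hg] at hext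
  change ((extIdeal L v.asIdeal : Ideal (𝓞 L)) : FractionalIdeal (𝓞 L)⁰ L) = _ *
    ((extIdeal L (C.eF v) : Ideal (𝓞 L)) : FractionalIdeal (𝓞 L)⁰ L) * _ at hext
  have hv0 : extIdeal L v.asIdeal ≠ ⊥ := extIdeal_ne_bot v.ne_bot
  have he0 : ∀ j ∈ Finset.univ, C.e₀ j ^ (C.lam v j : ℕ) ≠ ⊥ := fun j _ =>
    pow_ne_zero _ (C.e₀_mem j).1
  have hE0 : extIdeal L (C.eF v) ≠ ⊥ := by
    rw [C.eF_eq v hv]; exact Finset.prod_ne_zero_iff.2 he0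
  have hg0 : g ^ r ≠ 0 := by
    intro h
    rw [h, mul_zero, FractionalIdeal.coeIdeal_eq_zero] at hext
    exact hv0 hext
  have hcount := congrArg (FractionalIdeal.count L P) hext
  rw [FractionalIdeal.count_mul L P (mul_ne_zero (FractionalIdeal.spanSingleton_ne_zero_iff.2 hm0)
      (FractionalIdeal.coeIdeal_ne_zero.2 hE0)) hg0,
    FractionalIdeal.count_mul L P (FractionalIdeal.spanSingleton_ne_zero_iff.2 hm0)
      (FractionalIdeal.coeIdeal_ne_zero.2 hE0), FractionalIdeal.count_pow, count_coe_eq_ord P hv0,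
    count_coe_eq_ord P hE0, C.eF_eq v hv, ord_prod P _ _ he0] at hcount
  have hord0 : ord P (extIdeal L v.asIdeal) = 0 := by
    by_contra h
    exact hPv ((ord_pos_iff P hv0).1 (Nat.pos_of_ne_zero h))
  have hme : P.valuation L (algebraMap F L (C.meF v)) =
      WithZero.exp (-((∑ j, ord P (C.e₀ j ^ (C.lam v j : ℕ)) : ℕ) : ℤ)) := by
    rw [C.meF_eq v hv, map_prod, Nat.cast_sum, ← Finset.sum_neg_distrib]
    have : ∀ j, P.valuation L (C.m₀ j ^ (C.lam v j : ℕ)) =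
        WithZero.exp (-((ord P (C.e₀ j ^ (C.lam v j : ℕ)) : ℕ) : ℤ)) := by
      intro j
      rw [map_pow, valuation_of_span_eq P hP (C.e₀_mem j).1 (C.m₀_span j),
        ord_pow P (C.e₀_mem j).1, ← WithZero.exp_nsmul]
      congr 1
      push_cast
      simp
    simp only [this]
    generalize (Finset.univ : Finset (Fin C.d)) = s
    classical
    induction s using Finset.induction_on with
    | empty => simp
    | insert a s ha ih => rw [Finset.prod_insert ha, Finset.sum_insert ha, ih, WithZero.exp_add]
  -- `b` is taken with the order of `g` at `P`. The decomposition gives `0 = ord(m) + ord(e) + r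
  -- ord(g)`, and `m_e` has the order of `e` because `P` is outside `S'`.
  obtain ⟨b, hb⟩ := P.valuation_surjective (K := L)
    (WithZero.exp (-FractionalIdeal.count L P g))
  refine ⟨b, fun h => ?_, ?_⟩
  · rw [h, map_zero] at hb
    exact WithZero.exp_ne_zero hb.symm
  · rw [map_mul, map_mul, map_mul, map_pow, hb, hme, valuation_eq_exp_count P hm0,
      ← WithZero.exp_nsmul, ← WithZero.exp_add, ← WithZero.exp_add, ← WithZero.exp_zero]
    congr 1
    rw [hord0] at hcount
    simp only [nsmul_eq_mul]
    push_cast at hcount ⊢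
    linarith

end SymbolChoices

end Generators

/-! ### The residue symbol for ideals -/

section IdealSymbol

lemma isCoprime_iff_forall_prime {K : Type*} [Field K] [NumberField K] {m n : Ideal (𝓞 K)}
    (hn : n ≠ ⊥) : IsCoprime m n ↔
      ∀ P : HeightOneSpectrum (𝓞 K), P.asIdeal ∣ m → ¬ P.asIdeal ∣ n := by
  rw [Ideal.isCoprime_iff_sup_eq]
  constructor
  · intro h P hm hn
    exact P.isPrime.ne_top (top_le_iff.1 (h ▸ sup_le (Ideal.le_of_dvd hm) (Ideal.le_of_dvd hn)))
  · intro h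
    by_contra hne
    obtain ⟨P, hP, hle⟩ := Ideal.exists_le_maximal _ hne
    have hPn : n ≤ P := le_sup_right.trans hle
    refine h ⟨P, hP.isPrime, fun h0 => hn (le_bot_iff.1 (h0 ▸ hPn))⟩
      (Ideal.dvd_iff_le.2 (le_sup_left.trans hle)) (Ideal.dvd_iff_le.2 hPn)

variable {F L : Type*} [Field F] [NumberField F] [Field L] [NumberField L] [Algebra F L]
  {r : ℕ} {S' : Set (HeightOneSpectrum (𝓞 L))}

lemma isCoprime_extIdeal_iff (n : Ideal (𝓞 F)) {m : Ideal (𝓞 L)} (hm : m ≠ ⊥) :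
    IsCoprime (extIdeal L n) m ↔
      ∀ P : HeightOneSpectrum (𝓞 L), P.asIdeal ∣ extIdeal L n → ¬ P.asIdeal ∣ m :=
  isCoprime_iff_forall_prime hm

lemma extIdeal_dvd {m n : Ideal (𝓞 F)} (h : m ∣ n) : extIdeal L m ∣ extIdeal L n := by
  obtain ⟨c, rfl⟩ := h
  exact ⟨extIdeal L c, extIdeal_mul m c⟩

lemma comap_dvd_of_dvd {n : Ideal (𝓞 F)} {P : HeightOneSpectrum (𝓞 L)}
    (h : P.asIdeal ∣ extIdeal L n) {v : HeightOneSpectrum (𝓞 F)}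
    (hv : P.asIdeal ∣ extIdeal L v.asIdeal) : v.asIdeal ∣ n := by
  rw [← comap_eq_of_dvd hv]
  exact Ideal.dvd_iff_le.2 (Ideal.map_le_iff_le_comap.1 (Ideal.le_of_dvd h))

lemma exists_dvd_extIdeal (F : Type*) [Field F] [NumberField F] [Algebra F L]
    (P : HeightOneSpectrum (𝓞 L)) :
    ∃ v : HeightOneSpectrum (𝓞 F), P.asIdeal ∣ extIdeal L v.asIdeal := by
  obtain ⟨v, hv⟩ := exists_below F P
  exact ⟨v, hv ▸ dvd_extIdeal_comap P⟩

lemma extIdeal_mem {n : Ideal (𝓞 F)} (hn : n ∈ idealsPrimeTo (below F S')) :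
    extIdeal L n ∈ idealsPrimeTo S' := by
  refine ⟨extIdeal_ne_bot hn.1, fun P hP h => ?_⟩
  obtain ⟨v, hv⟩ := exists_dvd_extIdeal F P
  exact hn.2 v ⟨P, hP, comap_eq_of_dvd hv⟩ (comap_dvd_of_dvd h hv)

variable (r) in
lemma idealSymbol_mul_right (emb : L →+* ℂ) (a : L) {m m' : Ideal (𝓞 L)} (hm : m ≠ ⊥)
    (hm' : m' ≠ ⊥) :
    idealSymbol r emb a (m * m') = idealSymbol r emb a m * idealSymbol r emb a m' :=
  finprod_pow_ord_mul _ hm hm'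

variable (r) in
lemma idealSymbol_prime (emb : L →+* ℂ) (a : L) (P : HeightOneSpectrum (𝓞 L)) :
    idealSymbol r emb a P.asIdeal = primeSymbol r emb P a :=
  finprod_pow_ord_prime _ P

variable (r) in
lemma idealSymbol_one_right (emb : L →+* ℂ) (a : L) : idealSymbol r emb a 1 = 1 :=
  finprod_pow_ord_one _

lemma idealSymbol_mul_left (emb : L →+* ℂ) {a a' : L} {m : Ideal (𝓞 L)} (hm : m ≠ ⊥)
    (h : ∀ P : HeightOneSpectrum (𝓞 L), P.asIdeal ∣ m →
      primeSymbol r emb P (a * a') = primeSymbol r emb P a * primeSymbol r emb P a') :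
    idealSymbol r emb (a * a') m = idealSymbol r emb a m * idealSymbol r emb a' m := by
  unfold idealSymbol
  rw [← finprod_mul_distrib (hasFiniteMulSupport_pow_ord _ hm) (hasFiniteMulSupport_pow_ord _ hm)]
  refine finprod_congr fun P => ?_
  by_cases hP : ord P m = 0
  · simp [hP]
  · rw [h P ((ord_pos_iff P hm).1 (Nat.pos_of_ne_zero hP)), mul_pow]

lemma idealSymbol_pow_eq_one (emb : L →+* ℂ) {a : L} {m : Ideal (𝓞 L)} (hm : m ≠ ⊥)
    (h : ∀ P : HeightOneSpectrum (𝓞 L), P.asIdeal ∣ m → primeSymbol r emb P a ^ r = 1) :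
    idealSymbol r emb a m ^ r = 1 := by
  unfold idealSymbol
  refine finprod_induction (p := fun x : ℂ => x ^ r = 1) (one_pow r)
    (fun x y hx hy => by rw [mul_pow, hx, hy, one_mul]) fun P => ?_
  by_cases hP : ord P m = 0
  · rw [hP, pow_zero, one_pow]
  · rw [← pow_mul, mul_comm, pow_mul, h P ((ord_pos_iff P hm).1 (Nat.pos_of_ne_zero hP)), one_pow]

namespace SymbolChoices

variable (C : SymbolChoices F L r S') (emb : L →+* ℂ)

lemma gen_mul {n n' : Ideal (𝓞 F)} (hn : n ≠ ⊥) (hn' : n' ≠ ⊥) :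
    C.gen (n * n') = C.gen n * C.gen n' :=
  finprod_pow_ord_mul _ hn hn'

lemma chi_of_isCoprime {n : Ideal (𝓞 F)} {m : Ideal (𝓞 L)} (h : IsCoprime (extIdeal L n) m) :
    C.chi emb n m = idealSymbol r emb (algebraMap F L (C.gen n)) m := if_pos h

lemma chi_of_not_isCoprime {n : Ideal (𝓞 F)} {m : Ideal (𝓞 L)}
    (h : ¬ IsCoprime (extIdeal L n) m) : C.chi emb n m = 0 := if_neg h

lemma chi_one_right (n : Ideal (𝓞 F)) : C.chi emb n 1 = 1 := by
  rw [chi_of_isCoprime _ _ isCoprime_one_right, idealSymbol_one_right]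

lemma chi_mul_right (n : Ideal (𝓞 F)) {m m' : Ideal (𝓞 L)} (hm : m ≠ ⊥) (hm' : m' ≠ ⊥) :
    C.chi emb n (m * m') = C.chi emb n m * C.chi emb n m' := by
  by_cases h : IsCoprime (extIdeal L n) m
  · by_cases h' : IsCoprime (extIdeal L n) m'
    · rw [chi_of_isCoprime _ _ (h.mul_right h'), chi_of_isCoprime _ _ h, chi_of_isCoprime _ _ h',
        idealSymbol_mul_right r emb _ hm hm']
    · rw [chi_of_not_isCoprime _ _ h', mul_zero, chi_of_not_isCoprime]
      exact fun h1 => h' h1.of_mul_right_right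
  · rw [chi_of_not_isCoprime _ _ h, zero_mul, chi_of_not_isCoprime]
    exact fun h1 => h h1.of_mul_right_left

lemma isCompletelyMultiplicative_chi (n : Ideal (𝓞 F)) :
    IsCompletelyMultiplicative S' fun m => C.chi emb n m where
  map_one := chi_one_right C emb n
  map_mul _ hm _ hm' := chi_mul_right C emb n hm.1 hm'.1

lemma chi_one_left (hr : r.Prime) {ξ : 𝓞 L} (hξ : IsPrimitiveRoot ξ r)
    (hS_r : ∀ P : HeightOneSpectrum (𝓞 L), (r : 𝓞 L) ∈ P.asIdeal → P ∈ S') {m : Ideal (𝓞 L)}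
    (hm : m ∈ idealsPrimeTo S') : C.chi emb 1 m = 1 := by
  have hgen : C.gen 1 = 1 := finprod_pow_ord_one _
  rw [chi_of_isCoprime _ _ (by rw [extIdeal_one]; exact isCoprime_one_left), hgen, map_one]
  unfold idealSymbol
  refine finprod_induction (p := fun x : ℂ => x = 1) rfl
    (fun x y hx hy => by rw [hx, hy, one_mul]) fun P => ?_
  by_cases hP : ord P m = 0
  · rw [hP, pow_zero]
  · have hPr := fun h => notMem_of_dvd hm ((ord_pos_iff P hm.1).1 (Nat.pos_of_ne_zero hP)) (hS_r P h)
    rw [isSymbolValue_one.primeSymbol_eq hr.ne_zero (dvd_absNorm_sub_one hr hξ hPr) hPr emb,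
      map_one, one_pow]

/-- The generator is a product of the elements attached to the primes of `n`. Each of these becomes
a unit at `P` after multiplication by an `r`-th power, as `P` lies over none of those primes, and
symbol values multiply. -/
lemma exists_isSymbolValue_gen (hr : r.Prime) {ξ : 𝓞 L} (hξ : IsPrimitiveRoot ξ r)
    (hS_r : ∀ P : HeightOneSpectrum (𝓞 L), (r : 𝓞 L) ∈ P.asIdeal → P ∈ S') {n : Ideal (𝓞 F)}
    (hn : n ∈ idealsPrimeTo (below F S')) {P : HeightOneSpectrum (𝓞 L)} (hP : P ∉ S')
    (hPn : ¬ P.asIdeal ∣ extIdeal L n) : ∃ ζ, IsSymbolValue r P (algebraMap F L (C.gen n)) ζ := by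
  have hPr : (r : 𝓞 L) ∉ P.asIdeal := fun h => hP (hS_r P h)
  unfold gen
  refine finprod_induction (p := fun x : F => ∃ ζ, IsSymbolValue r P (algebraMap F L x) ζ)
    ⟨1, by rw [map_one]; exact isSymbolValue_one⟩ ?_ fun v => ?_
  · rintro x y ⟨ζ, h⟩ ⟨ζ', h'⟩
    exact ⟨ζ * ζ', by rw [map_mul]; exact h.mul hr.ne_zero h'⟩
  by_cases hv : ord v n = 0
  · exact ⟨1, by rw [hv, pow_zero, map_one]; exact isSymbolValue_one⟩
  have hvn := (ord_pos_iff v hn.1).1 (Nat.pos_of_ne_zero hv)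
  obtain ⟨b, hb, hv1⟩ := C.exists_valuation_mul_pow_eq_one (notMem_of_dvd hn hvn) hP
    fun h => hPn (h.trans (extIdeal_dvd hvn))
  obtain ⟨ζ, hζ⟩ := exists_isSymbolValue hr hξ hPr hb hv1
  generalize ord v n = k
  induction k with
  | zero => exact ⟨1, by rw [pow_zero, map_one]; exact isSymbolValue_one⟩
  | succ k ih =>
    obtain ⟨ζ', h'⟩ := ih
    exact ⟨ζ' * ζ, by rw [pow_succ, map_mul]; exact h'.mul hr.ne_zero hζ⟩

/-! ### The symbol as a completely multiplicative function of the ideal of `F`. -/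

section Multiplicativity

variable (hr : r.Prime) {ξ : 𝓞 L} (hξ : IsPrimitiveRoot ξ r)
  (hS_r : ∀ P : HeightOneSpectrum (𝓞 L), (r : 𝓞 L) ∈ P.asIdeal → P ∈ S')

include hr hξ hS_r

/-- `primeSymbol` takes the default value `0` when no symbol value exists, so multiplicativity rests
on `exists_isSymbolValue_gen` at each prime of `m`. If either ideal fails to be coprime to `m`, both
sides vanish. -/
lemma chi_mul_left {n n' : Ideal (𝓞 F)} (hn : n ∈ idealsPrimeTo (below F S'))
    (hn' : n' ∈ idealsPrimeTo (below F S')) {m : Ideal (𝓞 L)} (hm : m ∈ idealsPrimeTo S') :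
    C.chi emb (n * n') m = C.chi emb n m * C.chi emb n' m := by
  by_cases h : IsCoprime (extIdeal L n) m
  · by_cases h' : IsCoprime (extIdeal L n') m
    · have hmul : IsCoprime (extIdeal L (n * n')) m := by
        rw [extIdeal_mul]; exact h.mul_left h'
      rw [chi_of_isCoprime _ _ hmul, chi_of_isCoprime _ _ h, chi_of_isCoprime _ _ h',
        gen_mul C hn.1 hn'.1, map_mul]
      refine idealSymbol_mul_left emb hm.1 fun P hP => ?_
      have hPS := notMem_of_dvd hm hP
      have hPr : (r : 𝓞 L) ∉ P.asIdeal := fun h => hPS (hS_r P h)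
      have hd := dvd_absNorm_sub_one hr hξ hPr
      obtain ⟨ζ, hζ⟩ := exists_isSymbolValue_gen C hr hξ hS_r hn hPS
        fun h1 => (isCoprime_extIdeal_iff n hm.1).1 h P h1 hP
      obtain ⟨ζ', hζ'⟩ := exists_isSymbolValue_gen C hr hξ hS_r hn' hPS
        fun h1 => (isCoprime_extIdeal_iff n' hm.1).1 h' P h1 hP
      rw [(hζ.mul hr.ne_zero hζ').primeSymbol_eq hr.ne_zero hd hPr,
        hζ.primeSymbol_eq hr.ne_zero hd hPr, hζ'.primeSymbol_eq hr.ne_zero hd hPr, map_mul]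
    · rw [chi_of_not_isCoprime _ _ h', mul_zero, chi_of_not_isCoprime]
      rw [extIdeal_mul]
      exact fun h1 => h' h1.of_mul_left_right
  · rw [chi_of_not_isCoprime _ _ h, zero_mul, chi_of_not_isCoprime]
    rw [extIdeal_mul]
    exact fun h1 => h h1.of_mul_left_left

lemma isCompletelyMultiplicative_chi_left {m : Ideal (𝓞 L)} (hm : m ∈ idealsPrimeTo S') :
    IsCompletelyMultiplicative (below F S') fun n => C.chi emb n m where
  map_one := chi_one_left C emb hr hξ hS_r hm
  map_mul _ hn _ hn' := chi_mul_left C emb hr hξ hS_r hn hn' hm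

lemma chi_pow_eq_one {n : Ideal (𝓞 F)} (hn : n ∈ idealsPrimeTo (below F S'))
    {m : Ideal (𝓞 L)} (hm : m ∈ idealsPrimeTo S') (h : IsCoprime (extIdeal L n) m) :
    C.chi emb n m ^ r = 1 := by
  rw [chi_of_isCoprime _ _ h]
  refine idealSymbol_pow_eq_one emb hm.1 fun P hP => ?_
  have hPS := notMem_of_dvd hm hP
  have hPr : (r : 𝓞 L) ∉ P.asIdeal := fun h => hPS (hS_r P h)
  obtain ⟨ζ, hζ⟩ := exists_isSymbolValue_gen C hr hξ hS_r hn hPS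
    fun h1 => (isCoprime_extIdeal_iff n hm.1).1 h P h1 hP
  rw [hζ.primeSymbol_eq hr.ne_zero (dvd_absNorm_sub_one hr hξ hPr) hPr, ← map_pow, hζ.1, map_one]

lemma norm_chi_le_one {n : Ideal (𝓞 F)} (hn : n ∈ idealsPrimeTo (below F S'))
    {m : Ideal (𝓞 L)} (hm : m ∈ idealsPrimeTo S') : ‖C.chi emb n m‖ ≤ 1 := by
  by_cases h : IsCoprime (extIdeal L n) m
  · have h1 := congrArg norm (chi_pow_eq_one C emb hr hξ hS_r hn hm h)
    rw [norm_pow, norm_one] at h1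
    exact ((pow_eq_one_iff_of_nonneg (norm_nonneg _) hr.ne_zero).1 h1).le
  · rw [chi_of_not_isCoprime _ _ h, norm_zero]
    exact zero_le_one

end Multiplicativity

-- The generator of `n` lies in `F`, so it is fixed by the nontrivial `σ`. If `v` is inert, `σ`
-- fixes the prime over `v` and therefore the symbol. If `v` is split, the symbol at the second
-- prime is `σ` of the symbol at the first, and their product is fixed. By `eq_one_of_conj_eq` a
-- fixed `r`-th root of unity is `1`.
open scoped Pointwise in
lemma chi_extIdeal_prime [IsTotallyReal F] [IsCyclotomicExtension {r} F L] (hr : r.Prime)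
    (hr2 : r ≠ 2) (hdeg : Module.finrank F L = 2)
    (hS_r : ∀ P : HeightOneSpectrum (𝓞 L), (r : 𝓞 L) ∈ P.asIdeal → P ∈ S') {n : Ideal (𝓞 F)}
    (hn : n ∈ idealsPrimeTo (below F S')) {v : HeightOneSpectrum (𝓞 F)} (hv : v ∉ below F S')
    (hvn : ¬ v.asIdeal ∣ n) : C.chi emb n (extIdeal L v.asIdeal) = 1 := by
  have : IsGalois F L := IsCyclotomicExtension.isGalois {r} F L
  obtain ⟨ξ, hξ⟩ := exists_integral_primitiveRoot (L := L) F r hr.ne_zero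
  have hodd := hr.odd_of_ne_two hr2
  have hcop : IsCoprime (extIdeal L n) (extIdeal L v.asIdeal) :=
    (isCoprime_extIdeal_iff n (extIdeal_ne_bot v.ne_bot)).2
      fun P hP hPv => hvn (comap_dvd_of_dvd hP hPv)
  have hnotMem : ∀ {P : HeightOneSpectrum (𝓞 L)}, P.asIdeal ∣ extIdeal L v.asIdeal → P ∉ S' :=
    fun h => notMem_of_dvd_extIdeal hv h
  have hPr : ∀ {P : HeightOneSpectrum (𝓞 L)}, P.asIdeal ∣ extIdeal L v.asIdeal →
      (r : 𝓞 L) ∉ P.asIdeal := fun h h' => hnotMem h (hS_r _ h')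
  have hex : ∀ {P : HeightOneSpectrum (𝓞 L)}, P.asIdeal ∣ extIdeal L v.asIdeal →
      ∃ ζ, IsSymbolValue r P (algebraMap F L (C.gen n)) ζ := fun h =>
    exists_isSymbolValue_gen C hr hξ hS_r hn (hnotMem h) fun h' => hvn (comap_dvd_of_dvd h' h)
  rw [chi_of_isCoprime _ _ hcop]
  rcases isInert_or_isSplit (F := F) (L := L) hr hr2 hdeg (v := v) (fun P hP => hPr hP) with
    hin | hsp
  · obtain ⟨P, hP⟩ : ∃ P : HeightOneSpectrum (𝓞 L), P.asIdeal = extIdeal L v.asIdeal :=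
      ⟨⟨_, hin, extIdeal_ne_bot v.ne_bot⟩, rfl⟩
    have hdvd : P.asIdeal ∣ extIdeal L v.asIdeal := hP ▸ dvd_rfl
    obtain ⟨ζ, hζ⟩ := hex hdvd
    obtain ⟨σ, hσ⟩ := exists_ne_one (F := F) (L := L) hdeg
    have hd := dvd_absNorm_sub_one hr hξ (hPr hdvd)
    have h2 := hζ.map σ (Q := P) (by rw [hP, smul_extIdeal]) rfl
    rw [AlgEquiv.commutes] at h2
    rw [← hP, idealSymbol_prime, hζ.primeSymbol_eq hr.ne_zero hd (hPr hdvd),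
      eq_one_of_conj_eq hdeg hodd hσ hζ.1 (h2.unique hr.ne_zero hd (hPr hdvd) hζ), map_one]
  · have hN := fun P hP => absNorm_of_dvd_of_isSplit hdeg hsp (P := P) hP
    obtain ⟨P, Q, hne, hPQ⟩ := hsp
    have hP : P.asIdeal ∣ extIdeal L v.asIdeal := hPQ ▸ Dvd.intro _ rfl
    have hQ : Q.asIdeal ∣ extIdeal L v.asIdeal := hPQ ▸ Dvd.intro_left _ rfl
    obtain ⟨σ, hσ⟩ := exists_smul_eq hP hQ
    have hσ1 : σ ≠ 1 := by
      rintro rfl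
      exact hne (HeightOneSpectrum.ext (by rw [← hσ, one_smul]))
    obtain ⟨ζ, hζ⟩ := hex hP
    have h2 := hζ.map σ hσ ((hN P hP).trans (hN Q hQ).symm)
    rw [AlgEquiv.commutes] at h2
    rw [hPQ, idealSymbol_mul_right r emb _ P.ne_bot Q.ne_bot, idealSymbol_prime, idealSymbol_prime,
      hζ.primeSymbol_eq hr.ne_zero (dvd_absNorm_sub_one hr hξ (hPr hP)) (hPr hP),
      h2.primeSymbol_eq hr.ne_zero (dvd_absNorm_sub_one hr hξ (hPr hQ)) (hPr hQ), ← map_mul,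
      eq_one_of_conj_eq hdeg hodd hσ1 (x := ζ * σ ζ) (by rw [mul_pow, hζ.1, h2.1, one_mul])
        (by rw [map_mul, conj_conj hdeg, mul_comm]), map_one]

/-- The symbol is trivial on ideals of `F`. -/
lemma chi_extIdeal [IsTotallyReal F] [IsCyclotomicExtension {r} F L] (hr : r.Prime)
    (hr2 : r ≠ 2) (hdeg : Module.finrank F L = 2)
    (hS_r : ∀ P : HeightOneSpectrum (𝓞 L), (r : 𝓞 L) ∈ P.asIdeal → P ∈ S') {n h : Ideal (𝓞 F)}
    (hn : n ∈ idealsPrimeTo (below F S')) (hh : h ∈ idealsPrimeTo (below F S'))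
    (hnh : ∀ v : HeightOneSpectrum (𝓞 F), v.asIdeal ∣ h → ¬ v.asIdeal ∣ n) :
    C.chi emb n (extIdeal L h) = 1 := by
  have hmul : IsCompletelyMultiplicative (below F S')
      fun h => C.chi emb n (extIdeal L h) :=
    { map_one := by rw [extIdeal_one, chi_one_right]
      map_mul := fun a ha b hb => by
        rw [extIdeal_mul, chi_mul_right C emb n (extIdeal_ne_bot ha.1) (extIdeal_ne_bot hb.1)] }
  obtain ⟨k, hk⟩ := (expEquiv (below F S')).surjective ⟨h, hh⟩
  obtain rfl : idealOfExp _ k = h := congrArg Subtype.val hk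
  rw [hmul.map_idealOfExp]
  refine Finset.prod_eq_one fun v hv => ?_
  have hvh : v.1.asIdeal ∣ idealOfExp (below F S') k := by
    rw [← ord_pos_iff _ hh.1, ord_idealOfExp]
    exact Nat.pos_of_ne_zero (Finsupp.mem_support_iff.1 hv)
  rw [chi_extIdeal_prime C emb hr hr2 hdeg hS_r hn v.2 (hnh _ hvh), one_pow]

end SymbolChoices

end IdealSymbol

/-! ### Hecke characters on ideals -/

section HeckeOnIdeals

variable {K : Type*} [Field K] [NumberField K] {T : Set (HeightOneSpectrum (𝓞 K))}

namespace HeckeChar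

variable (χ : HeckeChar K)

lemma onIdeal_mul {m n : Ideal (𝓞 K)} (hm : m ≠ ⊥) (hn : n ≠ ⊥) :
    χ.onIdeal (m * n) = χ.onIdeal m * χ.onIdeal n :=
  finprod_pow_ord_mul _ hm hn

lemma isCompletelyMultiplicative_onIdeal : IsCompletelyMultiplicative T χ.onIdeal where
  map_one := finprod_pow_ord_one _
  map_mul _ hm _ hn := onIdeal_mul χ hm.1 hn.1

lemma norm_onIdeal (n : Ideal (𝓞 K)) : ‖χ.onIdeal n‖ = 1 := by
  unfold onIdeal
  refine finprod_induction (p := fun x : ℂ => ‖x‖ = 1) norm_one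
    (fun x y hx hy => by rw [norm_mul, hx, hy, one_mul]) fun v => ?_
  rw [norm_pow, atPrime, Circle.norm_coe, one_pow]

end HeckeChar

end HeckeOnIdeals

/-! ### Deleting Euler factors by means of an indicator function. -/

section Coprimality

variable {K : Type*} [Field K] [NumberField K] {T : Set (HeightOneSpectrum (𝓞 K))}

open Classical in
/-- The indicator function of the ideals prime to the primes in `W`. -/
def primeToIndicator (W : Set (HeightOneSpectrum (𝓞 K))) (n : Ideal (𝓞 K)) : ℂ :=
  if ∀ v ∈ W, ¬ v.asIdeal ∣ n then 1 else 0

lemma isCompletelyMultiplicative_primeToIndicator (W : Set (HeightOneSpectrum (𝓞 K))) :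
    IsCompletelyMultiplicative T (primeToIndicator W) where
  map_one := if_pos fun v _ h => v.prime.not_isUnit (isUnit_of_dvd_one h)
  map_mul m _ n _ := by
    unfold primeToIndicator
    by_cases hm : ∀ v ∈ W, ¬ v.asIdeal ∣ m
    · by_cases hn : ∀ v ∈ W, ¬ v.asIdeal ∣ n
      · rw [if_pos hm, if_pos hn, if_pos, one_mul]
        exact fun v hv h => (v.prime.dvd_or_dvd h).elim (hm v hv) (hn v hv)
      · rw [if_neg hn, mul_zero, if_neg]
        exact fun h => hn fun v hv h' => h v hv (h'.mul_left m)
    · rw [if_neg hm, zero_mul, if_neg]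
      exact fun h => hm fun v hv h' => h v hv (h'.mul_right n)

lemma norm_primeToIndicator_le (W : Set (HeightOneSpectrum (𝓞 K))) (n : Ideal (𝓞 K)) :
    ‖primeToIndicator W n‖ ≤ 1 := by
  unfold primeToIndicator
  split_ifs <;> simp

/-- Removing finitely many Euler factors, with the coprimality condition as an indicator. -/
lemma tsum_mul_primeToIndicator {g : Ideal (𝓞 K) → ℂ} (hg : IsCompletelyMultiplicative T g)
    (hs : Summable fun n : idealsPrimeTo T => g n) (W : Finset (HeightOneSpectrum (𝓞 K)))
    (hW : ∀ v ∈ W, v ∉ T) :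
    ∑' n : idealsPrimeTo T, g n * primeToIndicator W (n : Ideal (𝓞 K)) =
      (∏ v ∈ W, (1 - g v.asIdeal)) * ∑' n : idealsPrimeTo T, g n := by
  rw [← tsum_union_primes hg hs W hW]
  have hinj : Function.Injective fun n : idealsPrimeTo (T ∪ W) =>
      (⟨n.1, idealsPrimeTo_mono Set.subset_union_left n.2⟩ : idealsPrimeTo T) :=
    fun x y h => Subtype.ext (congrArg (fun z => z.1) h)
  rw [← hinj.tsum_eq]
  · refine tsum_congr fun n => ?_
    rw [primeToIndicator, if_pos, mul_one]
    exact fun v hv => n.2.2 v (Or.inr hv)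
  · intro n hn
    have h : ∀ v ∈ (W : Set (HeightOneSpectrum (𝓞 K))), ¬ v.asIdeal ∣ n.1 := by
      by_contra h
      exact hn (by simp only [primeToIndicator, if_neg h, mul_zero])
    exact ⟨⟨n.1, n.2.1, fun v hv => hv.elim (n.2.2 v) (h v)⟩, rfl⟩

end Coprimality

/-! ### Ideals of `L` as products of an ideal of `F` and an imaginary ideal -/

section Imaginary

variable {F L : Type*} [Field F] [NumberField F] [Field L] [NumberField L] [Algebra F L]
  {S' : Set (HeightOneSpectrum (𝓞 L))}

lemma imaginaryIdeals_subset : imaginaryIdeals F S' ⊆ idealsPrimeTo S' := fun _ hm => hm.1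

/-- Some prime lies over `v`, by integrality. This makes norms drop strictly when an ideal of `F` is
split off. -/
lemma extIdeal_prime_ne_top (v : HeightOneSpectrum (𝓞 F)) : extIdeal L v.asIdeal ≠ ⊤ := by
  intro h
  have := v.isPrime
  obtain ⟨Q, -, hQv⟩ := Ideal.exists_ideal_over_prime_of_isIntegral (S := 𝓞 L) v.asIdeal ⊥
    (by rw [← RingHom.ker_eq_comap_bot,
      (RingHom.injective_iff_ker_eq_bot _).1 (RingOfIntegers.algebraMap.injective F L)]
        exact bot_le)
  have hle : extIdeal L v.asIdeal ≤ Q := Ideal.map_le_iff_le_comap.2 hQv.2.ge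
  rw [h, top_le_iff] at hle
  exact hQv.1.ne_top hle

/-- An ideal that is not imaginary has a divisor from `F` other than the unit ideal; splitting it
off lowers the norm, and induction applies. -/
lemma exists_eq_extIdeal_mul (m : Ideal (𝓞 L)) (hm : m ∈ idealsPrimeTo S') :
    ∃ h ∈ idealsPrimeTo (below F S'), ∃ m' ∈ imaginaryIdeals F S', extIdeal L h * m' = m := by
  induction hN : Ideal.absNorm m using Nat.strong_induction_on generalizing m with
  | _ N ih =>
    by_cases him : m ∈ imaginaryIdeals F S'
    · exact ⟨1, one_mem_idealsPrimeTo, m, him, by rw [extIdeal_one, one_mul]⟩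
    · have : ∃ h ∈ idealsPrimeTo (below F S'), extIdeal L h ∣ m ∧ h ≠ ⊤ := by
        by_contra! hne
        exact him ⟨hm, hne⟩
      obtain ⟨h, hh, ⟨c, rfl⟩, htop⟩ := this
      obtain ⟨hE, hc⟩ := mul_mem_idealsPrimeTo_iff.1 hm
      have hlt : Ideal.absNorm c < N := by
        rw [← hN, map_mul]
        refine lt_mul_of_one_lt_left (absNorm_pos hc.1) ?_
        have h0 := absNorm_pos hE.1
        refine lt_of_le_of_ne h0 fun h1 => htop ?_
        have h2 : extIdeal L h = ⊤ := Ideal.absNorm_eq_one_iff.1 h1.symm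
        by_contra hne
        obtain ⟨v, hv⟩ := exists_prime_dvd hh.1 hne
        exact extIdeal_prime_ne_top (L := L) v
          (top_le_iff.1 (h2 ▸ Ideal.le_of_dvd (extIdeal_dvd hv)))
      obtain ⟨h', hh', m', hm', rfl⟩ := ih _ hlt c hc rfl
      exact ⟨h * h', mul_mem_idealsPrimeTo hh hh', m', hm', by rw [extIdeal_mul, mul_assoc]⟩

/-- Common primes of `h` and `h'` are cancelled by induction on the norm. A prime `v` of `h` that
does not divide `h'` would generate an ideal coprime to `h' 𝓞_L`, hence would divide the imaginary
ideal `m'`, which is impossible. -/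
lemma extIdeal_mul_injective {h h' : Ideal (𝓞 F)} (hh : h ∈ idealsPrimeTo (below F S'))
    (hh' : h' ∈ idealsPrimeTo (below F S')) {m m' : Ideal (𝓞 L)} (hm : m ∈ imaginaryIdeals F S')
    (hm' : m' ∈ imaginaryIdeals F S') (heq : extIdeal L h * m = extIdeal L h' * m') :
    h = h' ∧ m = m' := by
  induction hN : Ideal.absNorm h using Nat.strong_induction_on generalizing h h' with
  | _ N ih =>
    by_cases h1 : h = ⊤
    · rw [← Ideal.one_eq_top] at h1
      subst h1
      rw [extIdeal_one, one_mul] at heq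
      have h2 := hm.2 h' hh' (heq ▸ Dvd.intro _ rfl)
      rw [← Ideal.one_eq_top] at h2
      subst h2
      exact ⟨rfl, by rw [heq, extIdeal_one, one_mul]⟩
    obtain ⟨v, hv⟩ := exists_prime_dvd hh.1 h1
    have hvT := notMem_of_dvd hh hv
    by_cases hv' : v.asIdeal ∣ h'
    · obtain ⟨a, rfl⟩ := hv
      obtain ⟨b, rfl⟩ := hv'
      have ha := (mul_mem_idealsPrimeTo_iff.1 hh).2
      have hb := (mul_mem_idealsPrimeTo_iff.1 hh').2
      rw [extIdeal_mul, extIdeal_mul, mul_assoc, mul_assoc] at heq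
      have heq' := mul_left_cancel₀ (extIdeal_ne_bot v.ne_bot) heq
      have hlt : Ideal.absNorm a < N := by
        rw [← hN, map_mul]
        exact lt_mul_of_one_lt_left (absNorm_pos ha.1) (one_lt_absNorm v)
      obtain ⟨rfl, hmm⟩ := ih _ hlt ha hb heq' rfl
      exact ⟨rfl, hmm⟩
    · exfalso
      have hcop : IsCoprime (extIdeal L v.asIdeal) (extIdeal L h') :=
        (isCoprime_extIdeal_iff _ (extIdeal_ne_bot hh'.1)).2
          fun P hP hPh => hv' (comap_dvd_of_dvd hPh hP)
      have hdvd : extIdeal L v.asIdeal ∣ extIdeal L h' * m' :=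
        (extIdeal_dvd hv).trans (heq ▸ Dvd.intro _ rfl)
      exact v.isPrime.ne_top (hm'.2 _ (prime_mem_idealsPrimeTo hvT) (hcop.dvd_of_dvd_mul_left hdvd))

variable (F S') in
/-- Each ideal of `L` prime to `S'` is uniquely the product of an ideal of `F` and an imaginary
ideal. -/
def imaginaryDecomposition :
    idealsPrimeTo (below F S') × imaginaryIdeals F S' ≃ idealsPrimeTo S' :=
  Equiv.ofBijective
    (fun x => ⟨extIdeal L x.1.1 * x.2.1, mul_mem_idealsPrimeTo (extIdeal_mem x.1.2) x.2.2.1⟩)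
    ⟨fun x y h => by
      obtain ⟨h1, h2⟩ := extIdeal_mul_injective x.1.2 y.1.2 x.2.2 y.2.2
        (congrArg (fun z => z.1) h)
      exact Prod.ext (Subtype.ext h1) (Subtype.ext h2),
    fun m => by
      obtain ⟨h, hh, m', hm', heq⟩ := exists_eq_extIdeal_mul (F := F) m.1 m.2
      exact ⟨(⟨h, hh⟩, ⟨m', hm'⟩), Subtype.ext heq⟩⟩

lemma summable_imaginary {g : Ideal (𝓞 L) → ℂ} (hs : Summable fun n : idealsPrimeTo S' => g n) :
    Summable fun m : imaginaryIdeals F S' => g m :=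
  hs.comp_injective (i := fun m : imaginaryIdeals F S' =>
    (⟨m.1, imaginaryIdeals_subset m.2⟩ : idealsPrimeTo S'))
    fun _ _ h => Subtype.ext (congrArg (fun z => z.1) h)

lemma one_mem_imaginaryIdeals : (1 : Ideal (𝓞 L)) ∈ imaginaryIdeals F S' := by
  obtain ⟨h, hh, m', hm', heq⟩ := exists_eq_extIdeal_mul (F := F) (S' := S') 1 one_mem_idealsPrimeTo
  have : m' = 1 := by
    have := isUnit_of_dvd_one (Dvd.intro_left _ heq)
    rwa [Ideal.isUnit_iff, ← Ideal.one_eq_top] at this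
  exact this ▸ hm'

/-- Complete multiplicativity turns the unique decomposition of ideals into a product of two
absolutely convergent sums. It is applied to the twisted series only after a coprimality indicator
is inserted. -/
lemma tsum_eq_tsum_extIdeal_mul_tsum_imaginary {g : Ideal (𝓞 L) → ℂ}
    (hg : IsCompletelyMultiplicative S' g) (hs : Summable fun n : idealsPrimeTo S' => g n) :
    ∑' n : idealsPrimeTo S', g n =
      (∑' h : idealsPrimeTo (below F S'), g (extIdeal L (h : Ideal (𝓞 F)))) *
        ∑' m : imaginaryIdeals F S', g m := by
  have hone := one_mem_imaginaryIdeals (F := F) (S' := S')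
  have hsF : Summable fun h : idealsPrimeTo (below F S') => g (extIdeal L (h : Ideal (𝓞 F))) :=
    hs.comp_injective (i := fun h : idealsPrimeTo (below F S') =>
      (⟨extIdeal L h.1, extIdeal_mem h.2⟩ : idealsPrimeTo S')) fun x y h =>
        Subtype.ext (extIdeal_mul_injective x.2 y.2 hone hone
          (congrArg (· * 1) (congrArg (fun z => z.1) h))).1
  rw [tsum_mul_tsum_of_summable_norm hsF.norm (summable_imaginary hs).norm,
    ← (imaginaryDecomposition F S').tsum_eq]
  exact tsum_congr fun x => hg.map_mul _ (extIdeal_mem x.1.2) _ x.2.2.1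

end Imaginary

/-! ### The series `L_S(s, χ_n ψ)` as a series over imaginary ideals -/

section LSeriesDecomposition

variable {F L : Type*} [Field F] [NumberField F] [Field L] [NumberField L] [Algebra F L]
  {r : ℕ} {S' : Set (HeightOneSpectrum (𝓞 L))}

/-- The primes of `L` over `v`. -/
lemma finite_primesOver (v : HeightOneSpectrum (𝓞 F)) :
    {P : HeightOneSpectrum (𝓞 L) | P.asIdeal ∣ extIdeal L v.asIdeal}.Finite :=
  Ideal.finite_factors (extIdeal_ne_bot v.ne_bot)

variable (L) in
/-- The finite set of primes of `L` over `v`. -/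
def primesOver (v : HeightOneSpectrum (𝓞 F)) : Finset (HeightOneSpectrum (𝓞 L)) :=
  (finite_primesOver (L := L) v).toFinset

lemma mem_primesOver {v : HeightOneSpectrum (𝓞 F)} {P : HeightOneSpectrum (𝓞 L)} :
    P ∈ primesOver L v ↔ P.asIdeal ∣ extIdeal L v.asIdeal :=
  Set.Finite.mem_toFinset _

/-- The term at `M` of the series `L_S(s, χ_{n₁} ψ)`. -/
def twistedTerm (C : SymbolChoices F L r S') (emb : L →+* ℂ) (ψ : HeckeChar L) (s : ℂ)
    (n : Ideal (𝓞 F)) (M : Ideal (𝓞 L)) : ℂ :=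
  dirichletTerm (fun m => C.chi emb (powFreePart r n) m * ψ.onIdeal m) s M

/-- The term at `h` of the series `L_S(2s, ψ)` over `F`. -/
def restrictedTerm (ψ : HeckeChar L) (s : ℂ) (h : Ideal (𝓞 F)) : ℂ :=
  dirichletTerm (fun n => ψ.onIdeal (extIdeal L n)) (2 * s) h

open Classical in
/-- The indicator function of the ideals of `L` prime to `v`. -/
def coprimeIndicator (v : HeightOneSpectrum (𝓞 F)) (m : Ideal (𝓞 L)) : ℂ :=
  if IsCoprime (extIdeal L v.asIdeal) m then 1 else 0

variable (C : SymbolChoices F L r S') (emb : L →+* ℂ) (ψ : HeckeChar L) (s : ℂ)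

lemma isCompletelyMultiplicative_twistedTerm (n : Ideal (𝓞 F)) :
    IsCompletelyMultiplicative S' (twistedTerm C emb ψ s n) :=
  ((C.isCompletelyMultiplicative_chi emb _).mul
    ψ.isCompletelyMultiplicative_onIdeal).dirichletTerm s

lemma isCompletelyMultiplicative_restrictedTerm {T : Set (HeightOneSpectrum (𝓞 F))} :
    IsCompletelyMultiplicative T (restrictedTerm ψ s) :=
  IsCompletelyMultiplicative.dirichletTerm
    { map_one := by
        rw [extIdeal_one]
        exact (ψ.isCompletelyMultiplicative_onIdeal (T := ∅)).map_one
      map_mul := fun m hm n hn => by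
        rw [extIdeal_mul, ψ.onIdeal_mul (extIdeal_ne_bot hm.1) (extIdeal_ne_bot hn.1)] } _

lemma summable_restrictedTerm {T : Set (HeightOneSpectrum (𝓞 F))} (hs : 1 < s.re) :
    Summable fun n : idealsPrimeTo T => restrictedTerm ψ s (n : Ideal (𝓞 F)) :=
  summable_dirichletTerm (fun _ hn => hn.1) (fun _ _ => (ψ.norm_onIdeal _).le)
    (by simp; linarith)

/-- The norm of an ideal of `F` is squared in the quadratic extension; this is the source of the
argument `2s`. -/
lemma absNorm_extIdeal_cpow (hdeg : Module.finrank F L = 2) (h : Ideal (𝓞 F)) :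
    (Ideal.absNorm (extIdeal L h) : ℂ) ^ (-s) = (Ideal.absNorm h : ℂ) ^ (-(2 * s)) := by
  rw [absNorm_extIdeal hdeg, Nat.cast_pow, ← Complex.natCast_cpow_natCast_mul]
  congr 1
  push_cast
  ring

lemma prod_coprimeIndicator (U : Finset {v : HeightOneSpectrum (𝓞 F) // v ∉ below F S'})
    {m : Ideal (𝓞 L)} (hm : m ≠ ⊥) [DecidableEq (HeightOneSpectrum (𝓞 L))] :
    ∏ v ∈ U, coprimeIndicator v.1 m =
      primeToIndicator (U.biUnion fun v => primesOver L v.1 : Finset _) m := by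
  classical
  unfold coprimeIndicator primeToIndicator
  rw [Finset.prod_ite_zero, Finset.prod_const_one]
  congr 1
  simp only [isCoprime_extIdeal_iff _ hm, Finset.coe_biUnion, Set.mem_iUnion, Finset.mem_coe,
    mem_primesOver, eq_iff_iff]
  exact ⟨fun h P ⟨v, hv, hP⟩ => h v hv P hP, fun h v hv P hP => h P ⟨v, hv, hP⟩⟩

/-- A prime over `v` divides `h 𝓞_L` only if `v` divides `h`, and conversely `v ∣ h` forces every
prime over `v` to divide `h 𝓞_L`. -/
lemma primeToIndicator_extIdeal (U : Finset {v : HeightOneSpectrum (𝓞 F) // v ∉ below F S'})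
    [DecidableEq (HeightOneSpectrum (𝓞 L))] (h : Ideal (𝓞 F)) :
    primeToIndicator (U.biUnion fun v => primesOver L v.1 : Finset _) (extIdeal L h) =
      primeToIndicator (U.map (Function.Embedding.subtype _) : Finset _) h := by
  classical
  unfold primeToIndicator
  congr 1
  simp only [Finset.coe_biUnion, Set.mem_iUnion, Finset.mem_coe, mem_primesOver, eq_iff_iff,
    Finset.mem_map, Function.Embedding.subtype_apply]
  constructor
  · rintro H _ ⟨v, hv, rfl⟩ hvh
    obtain ⟨P, hP⟩ := exists_prime_dvd (n := extIdeal L v.1.asIdeal)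
      (extIdeal_ne_bot v.1.ne_bot) (extIdeal_prime_ne_top v.1)
    exact H P ⟨v, hv, hP⟩ (hP.trans (extIdeal_dvd hvh))
  · rintro H P ⟨v, hv, hP⟩ hPh
    exact H v.1 ⟨v, hv, rfl⟩ (comap_dvd_of_dvd hPh hP)

section Main

variable [IsTotallyReal F] [IsCyclotomicExtension {r} F L] (hr : r.Prime) (hr2 : r ≠ 2)
  (hdeg : Module.finrank F L = 2)
  (hS_r : ∀ P : HeightOneSpectrum (𝓞 L), (r : 𝓞 L) ∈ P.asIdeal → P ∈ S')

include hr hdeg hS_r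

lemma norm_chi_powFreePart_le_one {n : Ideal (𝓞 F)} (hn : n ∈ idealsPrimeTo (below F S'))
    {M : Ideal (𝓞 L)} (hM : M ∈ idealsPrimeTo S') :
    ‖C.chi emb (powFreePart r n) M‖ ≤ 1 := by
  obtain ⟨ξ, hξ⟩ := exists_integral_primitiveRoot (L := L) F r hr.ne_zero
  exact C.norm_chi_le_one emb hr hξ hS_r (powFreePart_mem hn) hM

lemma norm_twistedTerm_le {n : Ideal (𝓞 F)} (hn : n ∈ idealsPrimeTo (below F S'))
    {M : Ideal (𝓞 L)} (hM : M ∈ idealsPrimeTo S') :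
    ‖twistedTerm C emb ψ s n M‖ ≤ (Ideal.absNorm M : ℝ) ^ (-s.re) := by
  refine norm_dirichletTerm_le hM.1 ?_ s
  rw [norm_mul, ψ.norm_onIdeal, mul_one]
  exact norm_chi_powFreePart_le_one C emb hr hdeg hS_r hn hM

lemma summable_twistedTerm (hs : 1 < s.re) {n : Ideal (𝓞 F)}
    (hn : n ∈ idealsPrimeTo (below F S')) :
    Summable fun M : idealsPrimeTo S' => twistedTerm C emb ψ s n M :=
  Summable.of_norm_bounded (summable_absNorm_rpow_of_subset (fun _ h => h.1) hs)
    fun M => norm_twistedTerm_le C emb ψ s hr hdeg hS_r hn M.2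

include hr2

lemma twistedTerm_extIdeal {n h : Ideal (𝓞 F)} (hn : n ∈ idealsPrimeTo (below F S'))
    (hh : h ∈ idealsPrimeTo (below F S'))
    (hnh : ∀ v : HeightOneSpectrum (𝓞 F), v.asIdeal ∣ h → ¬ v.asIdeal ∣ powFreePart r n) :
    twistedTerm C emb ψ s n (extIdeal L h) = restrictedTerm ψ s h := by
  unfold twistedTerm restrictedTerm dirichletTerm
  dsimp only
  rw [C.chi_extIdeal emb hr hr2 hdeg hS_r (powFreePart_mem hn) hh hnh, one_mul,
    absNorm_extIdeal_cpow s hdeg]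

/-- Removing the Euler factors over a set of primes of `F` that contains the primes dividing
`n₁` from the series `L_S(s, χ_{n₁} ψ)`. -/
lemma prod_mul_tsum_twistedTerm (hs : 1 < s.re) {n : Ideal (𝓞 F)}
    (hn : n ∈ idealsPrimeTo (below F S'))
    (U : Finset {v : HeightOneSpectrum (𝓞 F) // v ∉ below F S'})
    (hU : ∀ v : {v : HeightOneSpectrum (𝓞 F) // v ∉ below F S'},
      v.1.asIdeal ∣ powFreePart r n → v ∈ U) :
    (∏ v ∈ U, ∏ P ∈ primesOver L v.1, (1 - twistedTerm C emb ψ s n P.asIdeal)) *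
        ∑' M : idealsPrimeTo S', twistedTerm C emb ψ s n M =
      (∏ v ∈ U, (1 - restrictedTerm ψ s v.1.asIdeal)) *
        (∑' h : idealsPrimeTo (below F S'), restrictedTerm ψ s (h : Ideal (𝓞 F))) *
        ∑' m : imaginaryIdeals F S', twistedTerm C emb ψ s n m *
          ∏ v ∈ U, coprimeIndicator v.1 (m : Ideal (𝓞 L)) := by
  classical
  set g := twistedTerm C emb ψ s n with hg
  have hgm := isCompletelyMultiplicative_twistedTerm C emb ψ s n
  have hgs := summable_twistedTerm C emb ψ s hr hdeg hS_r hs hn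
  have hdisj : (U : Set {v : HeightOneSpectrum (𝓞 F) // v ∉ below F S'}).PairwiseDisjoint
      fun v => primesOver L v.1 := by
    intro v _ w _ hvw
    refine Finset.disjoint_left.2 fun P hP hP' => hvw (Subtype.ext (HeightOneSpectrum.ext ?_))
    rw [← comap_eq_of_dvd (mem_primesOver.1 hP), comap_eq_of_dvd (mem_primesOver.1 hP')]
  have hUS : ∀ P ∈ U.biUnion fun v => primesOver L v.1, P ∉ S' := by
    intro P hP
    obtain ⟨v, -, hv⟩ := Finset.mem_biUnion.1 hP
    exact notMem_of_dvd_extIdeal v.2 (mem_primesOver.1 hv)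
  set I : Ideal (𝓞 L) → ℂ :=
    primeToIndicator (U.biUnion fun v => primesOver L v.1 : Finset _) with hI
  have hIm : IsCompletelyMultiplicative S' I := isCompletelyMultiplicative_primeToIndicator _
  have hgIs : Summable fun M : idealsPrimeTo S' => g M * I M := by
    refine Summable.of_norm_bounded hgs.norm fun M => ?_
    rw [norm_mul]
    exact mul_le_of_le_one_right (norm_nonneg _) (norm_primeToIndicator_le _ _)
  rw [← Finset.prod_biUnion hdisj, ← tsum_mul_primeToIndicator hgm hgs _ hUS,
    tsum_eq_tsum_extIdeal_mul_tsum_imaginary (F := F) (hgm.mul hIm) hgIs]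
  congr 1
  · have hW : ∀ v ∈ U.map (Function.Embedding.subtype _), v ∉ below F S' := by
      intro v hv
      obtain ⟨w, -, rfl⟩ := Finset.mem_map.1 hv
      exact w.2
    have h1 := tsum_mul_primeToIndicator (isCompletelyMultiplicative_restrictedTerm ψ s)
      (summable_restrictedTerm ψ s hs) (U.map (Function.Embedding.subtype _)) hW
    rw [Finset.prod_map] at h1
    simp only [Function.Embedding.subtype_apply] at h1
    rw [← h1]
    refine tsum_congr fun h => ?_
    rw [hI, primeToIndicator_extIdeal]
    -- Ideals `h` meeting `U` are killed by the indicator on both sides. The others are coprime to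
    -- `n₁`, since `U` contains its primes, and there the symbol is trivial.
    by_cases hcop : ∀ v ∈ U, ¬ v.1.asIdeal ∣ h.1
    · rw [twistedTerm_extIdeal C emb ψ s hr hr2 hdeg hS_r hn h.2]
      intro v hvh hvn
      exact hcop _ (hU ⟨v, notMem_of_dvd h.2 hvh⟩ hvn) hvh
    · have h0 : primeToIndicator (U.map (Function.Embedding.subtype _) : Finset _) h.1 = 0 := by
        refine if_neg fun H => hcop fun v hv => H v.1 ?_
        exact Finset.mem_coe.2 (Finset.mem_map_of_mem _ hv)
      rw [h0, mul_zero, mul_zero]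
  · refine tsum_congr fun m => ?_
    rw [prod_coprimeIndicator U m.2.1.1]

/-- Multiplying `L_S(s, χ_{n₁} ψ)` by local factors, at the primes of a finite set `W`, that are
affine in the Euler factors. -/
lemma prod_affine_mul_tsum_twistedTerm (hs : 1 < s.re) {n : Ideal (𝓞 F)}
    (hn : n ∈ idealsPrimeTo (below F S'))
    (W : Finset {v : HeightOneSpectrum (𝓞 F) // v ∉ below F S'})
    (α β : {v : HeightOneSpectrum (𝓞 F) // v ∉ below F S'} → ℂ)
    (hW : ∀ v : {v : HeightOneSpectrum (𝓞 F) // v ∉ below F S'},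
      v.1.asIdeal ∣ powFreePart r n → v ∈ W ∧ β v = 0) :
    (∑' M : idealsPrimeTo S', twistedTerm C emb ψ s n M) *
      ∏ v ∈ W, ((∏ P ∈ primesOver L v.1, (1 - twistedTerm C emb ψ s n P.asIdeal)) * α v + β v) =
    (∑' h : idealsPrimeTo (below F S'), restrictedTerm ψ s (h : Ideal (𝓞 F))) *
      ∑' m : imaginaryIdeals F S', twistedTerm C emb ψ s n m *
        ∏ v ∈ W, (coprimeIndicator v.1 (m : Ideal (𝓞 L)) *
          ((1 - restrictedTerm ψ s v.1.asIdeal) * α v) + β v) := by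
  classical
  have hsum : ∀ U ∈ W.powerset, Summable fun m : imaginaryIdeals F S' =>
      twistedTerm C emb ψ s n m * ((∏ v ∈ U, coprimeIndicator v.1 (m : Ideal (𝓞 L)) *
          ((1 - restrictedTerm ψ s v.1.asIdeal) * α v)) * ∏ v ∈ W \ U, β v) := by
    intro U _
    have h1 : Summable fun m : imaginaryIdeals F S' =>
        twistedTerm C emb ψ s n m * ∏ v ∈ U, coprimeIndicator v.1 (m : Ideal (𝓞 L)) := by
      refine Summable.of_norm_bounded
        (summable_imaginary (summable_twistedTerm C emb ψ s hr hdeg hS_r hs hn)).norm fun m => ?_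
      rw [norm_mul]
      refine mul_le_of_le_one_right (norm_nonneg _) ?_
      rw [prod_coprimeIndicator U m.2.1.1]
      exact norm_primeToIndicator_le _ _
    refine (h1.mul_right ((∏ v ∈ U, ((1 - restrictedTerm ψ s v.1.asIdeal) * α v)) *
      ∏ v ∈ W \ U, β v)).congr fun m => ?_
    simp only [Finset.prod_mul_distrib]
    ring
  -- Both products are expanded over the subsets `U` of `W` at which the term with the Euler factors
  -- is chosen.
  simp only [Finset.prod_add]
  simp only [Finset.mul_sum]
  rw [Summable.tsum_finsetSum hsum, Finset.mul_sum]
  refine Finset.sum_congr rfl fun U hU => ?_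
  -- If `U` contains all primes of `n₁`, the previous lemma applies to it; otherwise `β` vanishes at
  -- a missing prime and both terms are zero.
  by_cases hcase : ∀ v : {v : HeightOneSpectrum (𝓞 F) // v ∉ below F S'},
      v.1.asIdeal ∣ powFreePart r n → v ∈ U
  · have h1 := prod_mul_tsum_twistedTerm C emb ψ s hr hr2 hdeg hS_r hs hn U hcase
    simp only [Finset.prod_mul_distrib]
    calc _ = ((∏ v ∈ U, ∏ P ∈ primesOver L v.1, (1 - twistedTerm C emb ψ s n P.asIdeal)) *
          ∑' M : idealsPrimeTo S', twistedTerm C emb ψ s n M) *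
          ((∏ v ∈ U, α v) * ∏ v ∈ W \ U, β v) := by ring
      _ = _ := by
        rw [h1, mul_comm (∏ v ∈ U, (1 - restrictedTerm ψ s v.1.asIdeal)), mul_assoc, mul_assoc]
        congr 1
        rw [mul_left_comm, ← tsum_mul_right]
        refine tsum_congr fun m => ?_
        ring
  · push Not at hcase
    obtain ⟨v, hvn, hvU⟩ := hcase
    have hzero : ∏ v ∈ W \ U, β v = 0 :=
      Finset.prod_eq_zero (Finset.mem_sdiff.2 ⟨(hW v hvn).1, hvU⟩) (hW v hvn).2
    simp only [hzero, mul_zero, tsum_zero]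

end Main

end LSeriesDecomposition

/-! ### The local factors of the Dirichlet polynomial. -/

section LocalFactors

variable {F L : Type*} [Field F] [NumberField F] [Field L] [NumberField L] [Algebra F L]
  {r : ℕ} {S' : Set (HeightOneSpectrum (𝓞 L))}

open Classical in
/-- The part of the local factor of `P_n(s, ψ)` at `v` that is not multiplied by the Euler factors
at `v`, for `n` of order `k` at `v`. -/
def residualFactor (r : ℕ) (ψ : HeckeChar L) (s : ℂ) (v : HeightOneSpectrum (𝓞 F)) (k : ℕ) : ℂ :=
  if r ∣ k then ψ.onIdeal (extIdeal L v.asIdeal) ^ k * q v ^ ((k : ℂ) * (1 - 2 * s)) *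
    (if IsInert L v then 1 + (q v)⁻¹ else 1 - (q v)⁻¹) else 0

/-- The local factor at `v` of the coefficient at the imaginary ideal `m` of
`L_S(s, χ_{n₁} ψ) P_n(s, ψ) / L_S(2s, ψ)`, for `n` of order `k` at `v`. -/
def localFactor (r : ℕ) (ψ : HeckeChar L) (s : ℂ) (m : Ideal (𝓞 L))
    (v : HeightOneSpectrum (𝓞 F)) (k : ℕ) : ℂ :=
  coprimeIndicator v m * ((1 - restrictedTerm ψ s v.asIdeal) * geomPoly ψ v k s) +
    residualFactor r ψ s v k

variable (C : SymbolChoices F L r S') (emb : L →+* ℂ) (ψ : HeckeChar L) (s : ℂ)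

lemma restrictedTerm_prime (v : HeightOneSpectrum (𝓞 F)) :
    restrictedTerm ψ s v.asIdeal = ψ.onIdeal (extIdeal L v.asIdeal) * q v ^ (-2 * s) := by
  unfold restrictedTerm dirichletTerm q
  rw [neg_mul]

/-- The symbol vanishes at primes over `n₁`. Hence the Euler factors there are `1`, and the first
product in `P_n` also has the affine form. -/
lemma twistedTerm_eq_zero {n : Ideal (𝓞 F)} {v : HeightOneSpectrum (𝓞 F)}
    (hv : v.asIdeal ∣ powFreePart r n) {P : HeightOneSpectrum (𝓞 L)}
    (hP : P ∈ primesOver L v) : twistedTerm C emb ψ s n P.asIdeal = 0 := by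
  unfold twistedTerm dirichletTerm
  dsimp only
  rw [C.chi_of_not_isCoprime, zero_mul, zero_mul]
  rw [isCoprime_extIdeal_iff _ P.ne_bot]
  exact fun h => h P ((mem_primesOver.1 hP).trans (extIdeal_dvd hv)) dvd_rfl

lemma dvd_powFreePart_iff {T : Set (HeightOneSpectrum (𝓞 F))}
    (k : {v : HeightOneSpectrum (𝓞 F) // v ∉ T} →₀ ℕ)
    (v : {v : HeightOneSpectrum (𝓞 F) // v ∉ T}) :
    v.1.asIdeal ∣ powFreePart r (idealOfExp T k) ↔ ¬ r ∣ k v := by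
  rw [← ord_pos_iff _ (powFreePart_ne_bot _ _), ord_powFreePart _ (idealOfExp_mem k).1,
    ord_idealOfExp, Nat.pos_iff_ne_zero, Nat.dvd_iff_mod_eq_zero]

variable [IsTotallyReal F] [IsCyclotomicExtension {r} F L] (hr : r.Prime) (hr2 : r ≠ 2)
  (hdeg : Module.finrank F L = 2)
  (hS_r : ∀ P : HeightOneSpectrum (𝓞 L), (r : 𝓞 L) ∈ P.asIdeal → P ∈ S')

include hr hr2 hdeg hS_r

lemma isInert_or_isSplit_of_notMem {v : HeightOneSpectrum (𝓞 F)} (hv : v ∉ below F S') :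
    IsInert L v ∨ IsSplit L v :=
  isInert_or_isSplit hr hr2 hdeg fun P hP h => notMem_of_dvd_extIdeal hv hP (hS_r P h)

/-- The local factors of the Dirichlet polynomial `P_n(s, ψ)`. -/
lemma polyP_idealOfExp (k : {v : HeightOneSpectrum (𝓞 F) // v ∉ below F S'} →₀ ℕ) :
    polyP C emb ψ (idealOfExp (below F S') k) s = ∏ v ∈ k.support,
      ((∏ P ∈ primesOver L v.1,
        (1 - twistedTerm C emb ψ s (idealOfExp (below F S') k) P.asIdeal)) *
          geomPoly ψ v.1 (k v) s + residualFactor r ψ s v.1 (k v)) := by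
  classical
  have hn0 := (idealOfExp_mem k).1
  unfold polyP
  rw [finprod_mem_eq_prod_support k, finprod_mem_eq_prod_support k, finprod_mem_eq_prod_support k,
    ← Finset.prod_mul_distrib, ← Finset.prod_mul_distrib]
  · refine Finset.prod_congr rfl fun v hv => ?_
    have hk0 : 0 < k v := Nat.pos_of_ne_zero (Finsupp.mem_support_iff.1 hv)
    simp only [Set.mem_ofPred_eq, ord_powFreePart r hn0, ord_idealOfExp]
    by_cases hrk : r ∣ k v
    · rw [if_neg (by rw [Nat.dvd_iff_mod_eq_zero.1 hrk]; exact lt_irrefl 0), one_mul]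
      unfold residualFactor
      rw [if_pos hrk]
      rcases isInert_or_isSplit_of_notMem hr hr2 hdeg hS_r v.2 with hin | hsp
      · rw [if_pos ⟨hk0, hrk, hin⟩, if_neg fun h => hin.not_isSplit h.2.2, mul_one, if_pos hin]
        obtain ⟨P, hP⟩ : ∃ P : HeightOneSpectrum (𝓞 L), P.asIdeal = extIdeal L v.1.asIdeal :=
          ⟨⟨_, hin, extIdeal_ne_bot v.1.ne_bot⟩, rfl⟩
        have hover : primesOver L v.1 = {P} := by
          ext Q
          rw [mem_primesOver, Finset.mem_singleton]
          exact ⟨fun h => HeightOneSpectrum.ext ((hin.eq_of_dvd h).trans hP.symm),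
            fun h => by rw [h, hP]⟩
        -- Since `r ∣ k_v`, the prime `v` does not divide `n₁`. So the symbol is trivial at `v 𝓞_L`,
        -- and the single Euler factor is the one written in `P_n`.
        rw [hover, Finset.prod_singleton, hP, twistedTerm_extIdeal C emb ψ s hr hr2 hdeg hS_r
          (idealOfExp_mem k) (prime_mem_idealsPrimeTo v.2), restrictedTerm_prime]
        intro w hw hwn
        have : w = v.1 := HeightOneSpectrum.ext
          (associated_iff_eq.1 ((w.prime.dvd_prime_iff_associated v.1.prime).1 hw))
        subst this
        exact (dvd_powFreePart_iff k v).1 hwn hrk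
      · have hnin : ¬ IsInert L v.1 := fun h => IsInert.not_isSplit h hsp
        rw [if_neg fun h => hnin h.2.2, one_mul, if_pos ⟨hk0, hrk, hsp⟩, if_neg hnin]
        congr 2
        -- At a split place both primes have norm `q_v`, so the factors agree one by one.
        refine (finprod_mem_eq_finite_toFinset_prod _ (finite_primesOver v.1)).trans ?_
        refine Finset.prod_congr rfl fun P hP => ?_
        unfold twistedTerm dirichletTerm q
        rw [absNorm_of_dvd_of_isSplit hdeg hsp (mem_primesOver.1 hP)]
    · rw [if_pos (Nat.pos_of_ne_zero fun h => hrk (Nat.dvd_of_mod_eq_zero h)),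
        if_neg fun h => hrk h.2.1, if_neg fun h => hrk h.2.1, mul_one, mul_one]
      unfold residualFactor
      rw [if_neg hrk, add_zero, Finset.prod_eq_one, one_mul]
      intro P hP
      rw [twistedTerm_eq_zero C emb ψ s ((dvd_powFreePart_iff k v).2 hrk) hP, sub_zero]
  · exact fun v hv => hv.1.ne'
  · exact fun v hv => hv.1.ne'
  · intro v hv h
    rw [Set.mem_ofPred_eq, ord_powFreePart r hn0, h, Nat.zero_mod] at hv
    exact lt_irrefl _ hv

/-- `L_S(s, χ_n ψ)` is `L_S(2s, ψ)` times a series over the imaginary ideals. -/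
lemma LChiPsi_idealOfExp (hs : 1 < s.re)
    (k : {v : HeightOneSpectrum (𝓞 F) // v ∉ below F S'} →₀ ℕ) :
    LChiPsi C emb ψ (idealOfExp (below F S') k) s =
      (∑' h : idealsPrimeTo (below F S'), restrictedTerm ψ s (h : Ideal (𝓞 F))) *
      ∑' m : imaginaryIdeals F S', twistedTerm C emb ψ s (idealOfExp (below F S') k) m *
        ∏ v ∈ k.support, localFactor r ψ s (m : Ideal (𝓞 L)) v.1 (k v) := by
  unfold LChiPsi
  rw [polyP_idealOfExp C emb ψ s hr hr2 hdeg hS_r]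
  exact prod_affine_mul_tsum_twistedTerm C emb ψ s hr hr2 hdeg hS_r hs (idealOfExp_mem k)
    k.support (fun v => geomPoly ψ v.1 (k v) s) (fun v => residualFactor r ψ s v.1 (k v))
    fun v hv => by
      have h := (dvd_powFreePart_iff k v).1 hv
      exact ⟨Finsupp.mem_support_iff.2 fun h0 => h (h0 ▸ dvd_zero r), if_neg h⟩

end LocalFactors

/-! ### Euler products indexed by finitely supported exponents -/

section EulerProducts

variable {ι : Type*}

lemma summable_of_finsuppProd {b : ι → ℕ → ℂ} (hb : ∀ v, b v 0 = 1)
    (hs : Summable fun k : ι →₀ ℕ => k.prod b) (v : ι) : Summable (b v) := by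
  refine (hs.comp_injective (Finsupp.single_injective v)).congr fun j => ?_
  rw [Function.comp_apply, Finsupp.prod_single_index (hb v)]

-- Exponents supported in `S ∪ {v}` split as an exponent at `v` plus exponents supported in `S`, so
-- induction on `S` multiplies the absolutely convergent local sums.
open Classical in
lemma tsum_finsuppProd_support_subset {b : ι → ℕ → ℂ} (hb : ∀ v, b v 0 = 1)
    (hs : Summable fun k : ι →₀ ℕ => k.prod b) (S : Finset ι) :
    ∑' k : ι →₀ ℕ, (if k.support ⊆ S then k.prod b else 0) = ∏ v ∈ S, ∑' j, b v j := by
  induction S using Finset.induction_on with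
  | empty =>
    rw [tsum_eq_single 0]
    · simp
    · intro k hk
      rw [if_neg]
      rw [Finset.subset_empty, Finsupp.support_eq_empty]
      exact hk
  | insert v S hv ih =>
    have hsS : Summable fun k : ι →₀ ℕ => if k.support ⊆ S then k.prod b else 0 :=
      Summable.of_norm_bounded hs.norm fun k => by
        split_ifs
        · exact le_rfl
        · rw [norm_zero]; exact norm_nonneg _
    rw [Finset.prod_insert hv, ← ih,
      tsum_mul_tsum_of_summable_norm (summable_of_finsuppProd hb hs v).norm hsS.norm]
    have hzero : ∀ x : Function.support fun x : ℕ × (ι →₀ ℕ) =>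
        b v x.1 * (if x.2.support ⊆ S then x.2.prod b else 0), x.1.2.support ⊆ S := by
      intro x
      by_contra h
      exact x.2 (by simp only [if_neg h, mul_zero])
    have hval : ∀ {k : ι →₀ ℕ}, k.support ⊆ S → k v = 0 := fun h =>
      Finsupp.notMem_support_iff.1 fun h' => hv (h h')
    have hprod : ∀ {k : ι →₀ ℕ} (j : ℕ), k.support ⊆ S →
        (Finsupp.single v j + k).prod b = b v j * k.prod b := by
      intro k j h
      rw [← Finsupp.mul_prod_erase' _ v b hb]
      congr 1
      · rw [Finsupp.add_apply, Finsupp.single_eq_same, hval h, add_zero]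
      · rw [Finsupp.erase_add, Finsupp.erase_single, zero_add,
          Finsupp.erase_of_notMem_support (Finsupp.notMem_support_iff.2 (hval h))]
    -- Adding an exponent at `v` is injective only on pairs whose second entry vanishes at `v`.
    -- Outside the support of the summand this may fail, which is why only the support is matched.
    refine tsum_eq_tsum_of_ne_zero_bij (fun x => Finsupp.single v x.1.1 + x.1.2) ?_ ?_ ?_
    · intro x y h
      dsimp only at h
      have h1 := DFunLike.congr_fun h v
      rw [Finsupp.add_apply, Finsupp.add_apply, Finsupp.single_eq_same, Finsupp.single_eq_same,
        hval (hzero x), hval (hzero y), add_zero, add_zero] at h1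
      rw [h1] at h
      exact Subtype.ext (Prod.ext h1 (add_left_cancel h))
    · intro k hk
      have hkS : k.support ⊆ insert v S := by
        by_contra h
        exact hk (if_neg h)
      have heS : (k.erase v).support ⊆ S := by
        rw [Finsupp.support_erase]
        exact Finset.subset_insert_iff.1 hkS
      have heq : Finsupp.single v (k v) + k.erase v = k := Finsupp.single_add_erase v k
      refine ⟨⟨(k v, k.erase v), ?_⟩, heq⟩
      have h1 : k.prod b ≠ 0 := by
        intro h
        exact hk (by simp only [h, ite_self])
      rw [Function.mem_support]
      dsimp only
      rwa [if_pos heS, ← hprod _ heS, heq]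
    · intro x
      rw [if_pos, if_pos (hzero x), hprod _ (hzero x)]
      refine Finsupp.support_add.trans (Finset.union_subset ?_ ?_)
      · exact Finsupp.support_single_subset.trans (by simp)
      · exact (hzero x).trans (Finset.subset_insert v S)

open Filter in
/-- An absolutely convergent Euler product. -/
lemma tendsto_prod_tsum {b : ι → ℕ → ℂ} (hb : ∀ v, b v 0 = 1)
    (hs : Summable fun k : ι →₀ ℕ => k.prod b) :
    Tendsto (fun S : Finset ι => ∏ v ∈ S, ∑' j, b v j) atTop
      (nhds (∑' k : ι →₀ ℕ, k.prod b)) := by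
  classical
  simp only [← tsum_finsuppProd_support_subset hb hs]
  -- Dominated convergence: for each `k`, the support condition holds for every sufficiently large
  -- `S`.
  refine tendsto_tsum_of_dominated_convergence hs.norm (fun k => ?_) ?_
  · refine tendsto_const_nhds.congr' ?_
    filter_upwards [eventually_ge_atTop k.support] with S hS
    rw [if_pos hS]
  · refine Eventually.of_forall fun S k => ?_
    split_ifs
    · exact le_rfl
    · rw [norm_zero]; exact norm_nonneg _

/-- The identity holds for the finite partial products, and limits are unique. Only convergence of
the three series is needed, not non-vanishing of the local factors. -/
lemma tsum_finsuppProd_eq_mul {f a b : ι → ℕ → ℂ} (hf : ∀ v, f v 0 = 1) (ha : ∀ v, a v 0 = 1)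
    (hb : ∀ v, b v 0 = 1) (hfs : Summable fun k : ι →₀ ℕ => k.prod f)
    (has : Summable fun k : ι →₀ ℕ => k.prod a) (hbs : Summable fun k : ι →₀ ℕ => k.prod b)
    (h : ∀ v, ∑' j, f v j = (∑' j, a v j) * ∑' j, b v j) :
    ∑' k : ι →₀ ℕ, k.prod f = (∑' k : ι →₀ ℕ, k.prod a) * ∑' k : ι →₀ ℕ, k.prod b := by
  refine tendsto_nhds_unique (tendsto_prod_tsum hf hfs) ?_
  simp only [h, Finset.prod_mul_distrib]
  exact (tendsto_prod_tsum ha has).mul (tendsto_prod_tsum hb hbs)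

end EulerProducts

/-! ### The local identity -/

section LocalIdentity

/-- If `f (n + 1) - T f n` is the sum of the `u (n + 1)` and the shift of `T t n`, the generating
series of `f` is that of `T t + u` divided by `1 - T`. -/
lemma tsum_eq_geom_mul_tsum {f t u : ℕ → ℂ} {T : ℂ} (hT : ‖T‖ < 1) (hf : Summable f)
    (ht : Summable t) (hu : Summable u) (h0 : f 0 = u 0)
    (h : ∀ n, f (n + 1) = T * f n + u (n + 1) + T * t n) :
    ∑' j, f j = (∑' j, T ^ j) * ∑' j, (T * t j + u j) := by
  have hT1 : 1 - T ≠ 0 := by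
    intro h
    rw [← sub_eq_zero.1 h, norm_one] at hT
    exact lt_irrefl _ hT
  have hu1 : Summable fun n => u (n + 1) := (summable_nat_add_iff 1).2 hu
  have h1 : ∑' j, f j = f 0 + (T * ∑' j, f j + ∑' j, u (j + 1) + T * ∑' j, t j) := by
    conv_lhs => rw [hf.tsum_eq_zero_add]
    simp only [h]
    rw [((hf.mul_left T).add hu1).tsum_add (ht.mul_left T), (hf.mul_left T).tsum_add hu1,
      tsum_mul_left, tsum_mul_left]
  rw [tsum_geometric_of_norm_lt_one hT, (ht.mul_left T).tsum_add hu, tsum_mul_left,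
    hu.tsum_eq_zero_add]
  field_simp
  linear_combination h1 + h0

variable {r : ℕ} {Y R c e κ x : ℂ}

/-- The recursion for the local factors, with `c` the value of an `r`-th power residue symbol,
which vanishes if `e = 0`. -/
lemma local_recursion (hr : 1 < r) (hce : c ^ r = e) (hec : e * c = c) (n : ℕ) :
    c ^ ((n + 1) % r) * R ^ (n + 1) * (e * ((1 - Y * x) * ∑ i ∈ Finset.range (n + 1), Y ^ i) +
        if r ∣ n + 1 then Y ^ (n + 1) * κ else 0) =
      c * R * (if n = 0 then 1 else c ^ (n % r) * R ^ n *
        (e * ((1 - Y * x) * ∑ i ∈ Finset.range n, Y ^ i) + if r ∣ n then Y ^ n * κ else 0)) +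
      Y ^ (n + 1) * R ^ (n + 1) * c ^ ((n + 1) % r) * (if r ∣ n + 1 then κ - e * x else -x) +
      c * R * (Y ^ n * R ^ n * c ^ (n % r) *
        (if n = 0 then 0 else if r ∣ n then 1 - κ else 1)) := by
  -- At `n = 0` the general formula would give `κ` for the local term and `1 - κ` for the linear
  -- coefficient. They are replaced by `1` and `0`, with the same sum, so the recursion is
  -- unaffected.
  rcases Nat.eq_zero_or_pos n with rfl | hn
  · have h1 : ¬ r ∣ 1 := fun h => by have := Nat.le_of_dvd one_pos h; omega
    simp only [zero_add, if_neg h1, Nat.mod_eq_of_lt hr, pow_one, if_true]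
    simp
    linear_combination (R * (1 - Y * x)) * hec
  · rw [if_neg hn.ne', if_neg hn.ne', Finset.sum_range_succ]
    by_cases h1 : r ∣ n + 1
    · have h2 : ¬ r ∣ n := fun h => by
        have := Nat.le_of_dvd one_pos ((Nat.dvd_add_right h).1 h1); omega
      have h3 : (n + 1) % r = 0 := Nat.dvd_iff_mod_eq_zero.1 h1
      -- This is where the exponent of `c` wraps around: `c` times `c^(r-1)` is `c^r = e`, not
      -- `c^0`. In the other case the exponent just increases by one.
      have h4 : n % r + 1 = r := by
        have := Nat.mod_lt n (by omega : 0 < r)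
        have h5 : (n % r + 1) % r = 0 := by rwa [Nat.mod_add_mod]
        by_contra h6
        rw [Nat.mod_eq_of_lt (by omega)] at h5
        omega
      have h5 : c * c ^ (n % r) = e := by rw [← pow_succ', h4, hce]
      have h6 : e * e = e := by
        nth_rewrite 2 [← h5]
        rw [← mul_assoc, hec, h5]
      rw [if_pos h1, if_pos h1, if_neg h2, if_neg h2, h3]
      generalize ∑ i ∈ Finset.range n, Y ^ i = A at *
      generalize c ^ (n % r) = D at *
      linear_combination (-(R ^ (n + 1)) * (e * (1 - Y * x) * A + Y ^ n)) * h5 -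
        R ^ (n + 1) * (1 - Y * x) * A * h6
    · have h3 : (n + 1) % r = n % r + 1 := by
        have := Nat.mod_lt n (by omega : 0 < r)
        rw [← Nat.mod_add_mod, Nat.mod_eq_of_lt]
        by_contra h6
        apply h1
        rw [Nat.dvd_iff_mod_eq_zero, ← Nat.mod_add_mod, show n % r + 1 = r by omega, Nat.mod_self]
      rw [if_neg h1, if_neg h1, h3, pow_succ c]
      by_cases h2 : r ∣ n
      · rw [if_pos h2, if_pos h2]
        linear_combination (R ^ (n + 1) * c ^ (n % r) * (1 - Y * x) * Y ^ n) * hec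
      · rw [if_neg h2, if_neg h2]
        linear_combination (R ^ (n + 1) * c ^ (n % r) * (1 - Y * x) * Y ^ n) * hec

end LocalIdentity

/-! ### The Euler factors of the two series -/

section Factors

variable {F L : Type*} [Field F] [NumberField F] [Field L] [NumberField L] [Algebra F L]
  {r : ℕ} {S' : Set (HeightOneSpectrum (𝓞 L))}

/-- The relative norm of a prime over `w` is a positive power of `w`. This turns the conditions on
`N_{L/F} m` in `B` and `C` into coprimality. -/
lemma prime_dvd_relNorm_iff {v : HeightOneSpectrum (𝓞 F)} {m : Ideal (𝓞 L)} (hm : m ≠ ⊥) :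
    v.asIdeal ∣ Ideal.relNorm (𝓞 F) m ↔ ¬ IsCoprime (extIdeal L v.asIdeal) m := by
  rw [isCoprime_extIdeal_iff _ hm]
  push Not
  constructor
  · intro h
    rw [← Ideal.prod_normalizedFactors_eq_self hm, map_multiset_prod] at h
    obtain ⟨P, hP, hvP⟩ := v.prime.exists_mem_multiset_map_dvd h
    rw [UniqueFactorizationMonoid.mem_normalizedFactors_iff' hm] at hP
    have hP0 : P ≠ ⊥ := hP.1.ne_zero
    obtain ⟨Q, rfl⟩ : ∃ Q : HeightOneSpectrum (𝓞 L), Q.asIdeal = P :=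
      ⟨⟨P, Ideal.isPrime_of_prime hP.1.prime, hP0⟩, rfl⟩
    refine ⟨Q, ?_, hP.2.2⟩
    obtain ⟨w, hw⟩ := exists_below F Q
    have hQw : Q.asIdeal ∣ extIdeal L w.asIdeal := hw ▸ dvd_extIdeal_comap Q
    obtain ⟨a, -, ha⟩ := relNorm_prime hQw
    rw [ha] at hvP
    rwa [associated_iff_eq.1 ((v.prime.dvd_prime_iff_associated w.prime).1
      (v.prime.dvd_of_dvd_pow hvP))]
  · rintro ⟨P, hPv, hPm⟩
    obtain ⟨a, ha, h⟩ := relNorm_prime hPv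
    exact (dvd_pow_self _ ha.ne').trans (h ▸ map_dvd (Ideal.relNorm (𝓞 F)) hPm)

/-- The only prime over an inert `v` is `v 𝓞_L`, an ideal of `F`, which cannot divide an imaginary
ideal. Hence `D` needs no condition on the norm of `m`. -/
lemma IsInert.isCoprime_of_imaginary {v : HeightOneSpectrum (𝓞 F)} (hv : IsInert L v)
    (hvS : v ∉ below F S') {m : Ideal (𝓞 L)} (hm : m ∈ imaginaryIdeals F S') :
    IsCoprime (extIdeal L v.asIdeal) m := by
  rw [isCoprime_extIdeal_iff _ hm.1.1]
  intro P hP hPm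
  rw [hv.eq_of_dvd hP] at hPm
  exact v.isPrime.ne_top (hm.2 _ (prime_mem_idealsPrimeTo hvS) hPm)

lemma powFreePart_idealOfExp {T : Set (HeightOneSpectrum (𝓞 F))}
    (k : {v : HeightOneSpectrum (𝓞 F) // v ∉ T} →₀ ℕ) :
    powFreePart r (idealOfExp T k) =
      idealOfExp T (k.mapRange (· % r) (Nat.zero_mod r)) := by
  refine eq_of_ord_eq (powFreePart_ne_bot _ _) (idealOfExp_mem _).1 fun v => ?_
  rw [ord_powFreePart r (idealOfExp_mem k).1]
  by_cases hv : v ∈ T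
  · rw [ord_eq_zero_of_mem (idealOfExp_mem _) hv, ord_eq_zero_of_mem (idealOfExp_mem _) hv,
      Nat.zero_mod]
  · rw [ord_idealOfExp k ⟨v, hv⟩, ord_idealOfExp _ ⟨v, hv⟩, Finsupp.mapRange_apply]

lemma IsCompletelyMultiplicative.map_powFreePart {T : Set (HeightOneSpectrum (𝓞 F))}
    {g : Ideal (𝓞 F) → ℂ} (hg : IsCompletelyMultiplicative T g)
    (k : {v : HeightOneSpectrum (𝓞 F) // v ∉ T} →₀ ℕ) :
    g (powFreePart r (idealOfExp T k)) = ∏ v ∈ k.support, g v.1.asIdeal ^ (k v % r) := by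
  rw [powFreePart_idealOfExp, hg.map_idealOfExp]
  refine Finset.prod_subset Finsupp.support_mapRange fun v _ hv => ?_
  rw [Finsupp.notMem_support_iff.1 hv, pow_zero]

open Classical in
/-- `1 + q_v⁻¹` at the inert places, and `1 - q_v⁻¹` at the split ones. -/
def residualConstant (L : Type*) [Field L] [NumberField L] [Algebra F L]
    (v : HeightOneSpectrum (𝓞 F)) : ℂ :=
  if IsInert L v then 1 + (q v)⁻¹ else 1 - (q v)⁻¹

/-- `ψ(π_v) q_v ^ (1 - 2s)`. -/
def shiftedValue (ψ : HeckeChar L) (s : ℂ) (v : HeightOneSpectrum (𝓞 F)) : ℂ :=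
  ψ.onIdeal (extIdeal L v.asIdeal) * q v ^ (1 - 2 * s)

variable (C : SymbolChoices F L r S') (emb : L →+* ℂ) (ψ : HeckeChar L) (ρ : HeckeChar F)
  (s w : ℂ) (m : Ideal (𝓞 L)) (v : HeightOneSpectrum (𝓞 F))

open Classical in
/-- The Euler factor of the coefficient at `m` of the series `Z`. -/
def leftFactor (k : ℕ) : ℂ :=
  if k = 0 then 1 else C.chi emb v.asIdeal m ^ (k % r) *
    dirichletTerm ρ.onIdeal w v.asIdeal ^ k * localFactor r ψ s m v k

/-- The completely multiplicative part of the Euler factor of the inner sum of `Z̃`. -/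
def innerMonomial (k : ℕ) : ℂ :=
  shiftedValue ψ s v ^ k * dirichletTerm ρ.onIdeal w v.asIdeal ^ k *
    C.chi emb v.asIdeal m ^ (k % r)

open Classical in
/-- The linear coefficient of the Euler factor of the inner sum of `Z̃`. -/
def innerLinear (L : Type*) [Field L] [NumberField L] [Algebra F L] (r : ℕ)
    (v : HeightOneSpectrum (𝓞 F)) (k : ℕ) : ℂ :=
  if k = 0 then 0 else if r ∣ k then 1 - residualConstant L v else 1

open Classical in
/-- The constant coefficient of the Euler factor of the inner sum of `Z̃`. -/
def innerConstant (r : ℕ) (m : Ideal (𝓞 L)) (v : HeightOneSpectrum (𝓞 F)) (k : ℕ) : ℂ :=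
  if k = 0 then 1 else if r ∣ k then residualConstant L v - coprimeIndicator v m * (q v)⁻¹
    else -(q v)⁻¹

/-- The Euler factor of the inner sum of `Z̃`. -/
def innerFactor (k : ℕ) : ℂ :=
  innerMonomial C emb ψ ρ s w m v k *
    (dirichletTerm (chiStarRho C emb ρ m) w v.asIdeal * innerLinear L r v k +
      innerConstant r m v k)

lemma leftFactor_zero : leftFactor C emb ψ ρ s w m v 0 = 1 := if_pos rfl

lemma innerFactor_zero : innerFactor C emb ψ ρ s w m v 0 = 1 := by
  simp [innerFactor, innerMonomial, innerLinear, innerConstant]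

lemma q_ne_zero : q v ≠ 0 := Nat.cast_ne_zero.2 (absNorm_pos v.ne_bot).ne'

lemma dirichletTerm_chiStarRho : dirichletTerm (chiStarRho C emb ρ m) w v.asIdeal =
    C.chi emb v.asIdeal m * dirichletTerm ρ.onIdeal w v.asIdeal := by
  unfold dirichletTerm chiStarRho
  ring

/-- Separates `q_v^(1-2s)` from `q_v⁻¹`, so that the local factors become polynomials in the `Y` and
`x` of `local_recursion`. -/
lemma restrictedTerm_prime_eq :
    restrictedTerm ψ s v.asIdeal = shiftedValue ψ s v * (q v)⁻¹ := by
  rw [restrictedTerm_prime, shiftedValue, mul_assoc, ← Complex.cpow_neg_one,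
    ← Complex.cpow_add _ _ (q_ne_zero v)]
  congr 2
  ring

lemma shiftedValue_pow (k : ℕ) : shiftedValue ψ s v ^ k =
    ψ.onIdeal (extIdeal L v.asIdeal) ^ k * q v ^ ((k : ℂ) * (1 - 2 * s)) := by
  rw [shiftedValue, mul_pow, Complex.cpow_nat_mul]

lemma geomPoly_eq (k : ℕ) :
    geomPoly ψ v k s = ∑ i ∈ Finset.range k, shiftedValue ψ s v ^ i :=
  Finset.sum_congr rfl fun i _ => (shiftedValue_pow ψ s v i).symm

open Classical in
lemma localFactor_eq (k : ℕ) : localFactor r ψ s m v k =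
    coprimeIndicator v m * ((1 - shiftedValue ψ s v * (q v)⁻¹) *
      ∑ i ∈ Finset.range k, shiftedValue ψ s v ^ i) +
      if r ∣ k then shiftedValue ψ s v ^ k * residualConstant L v else 0 := by
  unfold localFactor residualFactor residualConstant
  rw [restrictedTerm_prime_eq, geomPoly_eq, shiftedValue_pow]

variable {m v} (hr : r.Prime) (hdeg : Module.finrank F L = 2) [IsCyclotomicExtension {r} F L]
  (hS_r : ∀ P : HeightOneSpectrum (𝓞 L), (r : 𝓞 L) ∈ P.asIdeal → P ∈ S')
  (hv : v ∉ below F S')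

lemma coprimeIndicator_mul_chi :
    coprimeIndicator v m * C.chi emb v.asIdeal m = C.chi emb v.asIdeal m := by
  unfold coprimeIndicator
  split_ifs with h
  · rw [one_mul]
  · rw [C.chi_of_not_isCoprime emb h, mul_zero]

-- A nonzero symbol is an `r`-th root of unity, so its `r`-th power only records whether `v` is
-- coprime to `m`; this is the relation `c^r = e` of the local identity.
include hr hS_r hv in
lemma chi_prime_pow (hm : m ∈ idealsPrimeTo S') :
    C.chi emb v.asIdeal m ^ r = coprimeIndicator v m := by
  obtain ⟨ξ, hξ⟩ := exists_integral_primitiveRoot (L := L) F r hr.ne_zero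
  unfold coprimeIndicator
  split_ifs with h
  · exact C.chi_pow_eq_one emb hr hξ hS_r (prime_mem_idealsPrimeTo hv) hm h
  · rw [C.chi_of_not_isCoprime emb h, zero_pow hr.ne_zero]

include hr hS_r hv in
lemma leftFactor_succ (hm : m ∈ idealsPrimeTo S') (n : ℕ) :
    leftFactor C emb ψ ρ s w m v (n + 1) =
      dirichletTerm (chiStarRho C emb ρ m) w v.asIdeal * leftFactor C emb ψ ρ s w m v n +
        innerMonomial C emb ψ ρ s w m v (n + 1) * innerConstant r m v (n + 1) +
        dirichletTerm (chiStarRho C emb ρ m) w v.asIdeal *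
          (innerMonomial C emb ψ ρ s w m v n * innerLinear L r v n) := by
  unfold leftFactor innerConstant innerLinear innerMonomial
  simp only [if_neg (Nat.succ_ne_zero n), localFactor_eq, dirichletTerm_chiStarRho]
  exact local_recursion hr.one_lt (chi_prime_pow C emb hr hS_r hv hm)
    (coprimeIndicator_mul_chi C emb) n

include hr hS_r in
lemma isCompletelyMultiplicative_chi_left' (hm : m ∈ idealsPrimeTo S') :
    IsCompletelyMultiplicative (below F S') fun n => C.chi emb n m := by
  obtain ⟨ξ, hξ⟩ := exists_integral_primitiveRoot (L := L) F r hr.ne_zero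
  exact C.isCompletelyMultiplicative_chi_left emb hr hξ hS_r hm

include hr hS_r in
lemma isCompletelyMultiplicative_chiStarRho (hm : m ∈ idealsPrimeTo S') :
    IsCompletelyMultiplicative (below F S') (dirichletTerm (chiStarRho C emb ρ m) w) :=
  ((isCompletelyMultiplicative_chi_left' C emb hr hS_r hm).mul
    ρ.isCompletelyMultiplicative_onIdeal).dirichletTerm w

end Factors

/-! ### The terms of both series as products of Euler factors. -/

section Matching

variable {F L : Type*} [Field F] [NumberField F] [Field L] [NumberField L] [Algebra F L]
  {r : ℕ} {S' : Set (HeightOneSpectrum (𝓞 L))}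
  (C : SymbolChoices F L r S') (emb : L →+* ℂ) (ψ : HeckeChar L) (ρ : HeckeChar F) (s w : ℂ)
  [IsTotallyReal F] [IsCyclotomicExtension {r} F L] (hr : r.Prime) (hr2 : r ≠ 2)
  (hdeg : Module.finrank F L = 2)
  (hS_r : ∀ P : HeightOneSpectrum (𝓞 L), (r : 𝓞 L) ∈ P.asIdeal → P ∈ S')

include hr hr2 hdeg hS_r

/-- Only `n₁` enters the symbol, so multiplicativity in `n` contributes `χ_v(m)` to the power `k_v
mod r`, which joins the local factors at `v`. -/
lemma termZ_idealOfExp (hs : 1 < s.re)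
    (k : {v : HeightOneSpectrum (𝓞 F) // v ∉ below F S'} →₀ ℕ) :
    termZ C emb ψ ρ s w (idealOfExp (below F S') k) =
      (∑' h : idealsPrimeTo (below F S'), restrictedTerm ψ s (h : Ideal (𝓞 F))) *
        ∑' m : imaginaryIdeals F S', dirichletTerm ψ.onIdeal s (m : Ideal (𝓞 L)) *
          k.prod fun v j => leftFactor C emb ψ ρ s w m v.1 j := by
  unfold termZ
  rw [LChiPsi_idealOfExp C emb ψ s hr hr2 hdeg hS_r hs, mul_assoc, mul_assoc]
  refine congrArg _ (tsum_mul_right.symm.trans ?_)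
  refine tsum_congr fun m => ?_
  have h1 : ρ.onIdeal (idealOfExp (below F S') k) *
      (Ideal.absNorm (idealOfExp (below F S') k) : ℂ) ^ (-w) =
        ∏ v ∈ k.support, dirichletTerm ρ.onIdeal w v.1.asIdeal ^ k v :=
    (ρ.isCompletelyMultiplicative_onIdeal.dirichletTerm w).map_idealOfExp k
  have h2 : twistedTerm C emb ψ s (idealOfExp (below F S') k) m =
      dirichletTerm ψ.onIdeal s (m : Ideal (𝓞 L)) *
        ∏ v ∈ k.support, C.chi emb v.1.asIdeal m ^ (k v % r) := by
    rw [← (isCompletelyMultiplicative_chi_left' C emb hr hS_r m.2.1).map_powFreePart k]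
    unfold twistedTerm dirichletTerm
    ring
  have h3 : (k.prod fun v j => leftFactor C emb ψ ρ s w m v.1 j) =
      (∏ v ∈ k.support, C.chi emb v.1.asIdeal m ^ (k v % r)) *
        (∏ v ∈ k.support, dirichletTerm ρ.onIdeal w v.1.asIdeal ^ k v) *
        ∏ v ∈ k.support, localFactor r ψ s (m : Ideal (𝓞 L)) v.1 (k v) := by
    rw [← Finset.prod_mul_distrib, ← Finset.prod_mul_distrib]
    exact Finset.prod_congr rfl fun v hv => if_neg (Finsupp.mem_support_iff.1 hv)
  rw [h1, h2, h3]
  ring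

/-- With `T` the value of `χ*_m ρ` at `v` times `q_v^(-w)`, the linear form is `T - q_v⁻¹` when `r ∤
k_v`, giving `A`. For `r ∣ k_v > 0` it is `1 - T q_v⁻¹` at inert places, giving `D`; `T q_v⁻¹ + 1 -
2 q_v⁻¹` at split places coprime to `m`, giving `C`; and `1 - q_v⁻¹` at split places meeting `m`,
where `T = 0`, giving `B`. -/
lemma innerTerm_idealOfExp {m : Ideal (𝓞 L)} (hm : m ∈ imaginaryIdeals F S')
    (k : {v : HeightOneSpectrum (𝓞 F) // v ∉ below F S'} →₀ ℕ) :
    innerTerm C emb ψ ρ s w m (idealOfExp (below F S') k) =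
      k.prod fun v j => innerFactor C emb ψ ρ s w m v.1 j := by
  classical
  have hn0 := (idealOfExp_mem k).1
  have h1 : ψ.onIdeal (extIdeal L (idealOfExp (below F S') k)) *
      (Ideal.absNorm (idealOfExp (below F S') k) : ℂ) ^ (-(2 * s - 1)) =
        ∏ v ∈ k.support, shiftedValue ψ s v.1 ^ k v := by
    have h : IsCompletelyMultiplicative (below F S')
        fun n => ψ.onIdeal (extIdeal L n) * (Ideal.absNorm n : ℂ) ^ (-(2 * s - 1)) :=
      IsCompletelyMultiplicative.mul
        { map_one := by
            rw [extIdeal_one]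
            exact (ψ.isCompletelyMultiplicative_onIdeal (T := ∅)).map_one
          map_mul := fun m hm n hn => by
            rw [extIdeal_mul, ψ.onIdeal_mul (extIdeal_ne_bot hm.1) (extIdeal_ne_bot hn.1)] }
        (isCompletelyMultiplicative_absNorm_cpow _)
    rw [h.map_idealOfExp k]
    refine Finset.prod_congr rfl fun v _ => ?_
    rw [shiftedValue, q, neg_sub]
  have h2 : ρ.onIdeal (idealOfExp (below F S') k) *
      (Ideal.absNorm (idealOfExp (below F S') k) : ℂ) ^ (-w) =
        ∏ v ∈ k.support, dirichletTerm ρ.onIdeal w v.1.asIdeal ^ k v :=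
    (ρ.isCompletelyMultiplicative_onIdeal.dirichletTerm w).map_idealOfExp k
  unfold innerTerm
  rw [finprod_mem_eq_prod_support k, finprod_mem_eq_prod_support k,
    finprod_mem_eq_prod_support k, finprod_mem_eq_prod_support k]
  · rw [show ∀ a b c d e A B C D : ℂ, a * b * c * d * e * A * B * C * D =
      (a * d) * (b * e) * c * (A * B * C * D) by intros; ring, h1, h2,
      (isCompletelyMultiplicative_chi_left' C emb hr hS_r hm.1).map_powFreePart k]
    unfold Finsupp.prod
    simp only [← Finset.prod_mul_distrib]
    refine Finset.prod_congr rfl fun v hv => ?_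
    have hk0 : k v ≠ 0 := Finsupp.mem_support_iff.1 hv
    have hkpos := Nat.pos_of_ne_zero hk0
    unfold innerFactor innerMonomial
    congr 1
    have hT : chiStarRho C emb ρ m v.1.asIdeal * q v.1 ^ (-w) =
        dirichletTerm (chiStarRho C emb ρ m) w v.1.asIdeal := rfl
    have hT' : chiStarRho C emb ρ m v.1.asIdeal * q v.1 ^ (-w - 1) =
        dirichletTerm (chiStarRho C emb ρ m) w v.1.asIdeal * (q v.1)⁻¹ := by
      rw [sub_eq_add_neg, Complex.cpow_add _ _ (q_ne_zero v.1), Complex.cpow_neg_one, ← mul_assoc,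
        hT]
    have hN0 : Ideal.relNorm (𝓞 F) m ≠ ⊥ := fun h => hm.1.1 (Ideal.relNorm_eq_bot_iff.1 h)
    simp only [Set.mem_ofPred_eq, ord_radPart_pos_iff r hn0, ord_fullPowPart_pos_iff r hn0,
      ord_idealOfExp, hT, hT', ord_pos_iff v.1 hN0, prime_dvd_relNorm_iff hm.1.1, hkpos, true_and,
      ← Nat.le_zero, ← not_lt, not_not]
    unfold innerLinear innerConstant
    rw [if_neg hk0, if_neg hk0]
    by_cases hrk : r ∣ k v
    · simp only [hrk, not_true_eq_false, if_false, if_true, and_true, one_mul]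
      unfold residualConstant
      rcases isInert_or_isSplit_of_notMem hr hr2 hdeg hS_r v.2 with hin | hsp
      · have hcop := hin.isCoprime_of_imaginary v.2 hm
        have hnsp := hin.not_isSplit
        unfold coprimeIndicator
        simp only [hin, hcop, hnsp, not_true_eq_false, if_false, if_true, false_and]
        ring
      · have hnin : ¬ IsInert L v.1 := fun h => IsInert.not_isSplit h hsp
        unfold coprimeIndicator
        by_cases hcop : IsCoprime (extIdeal L v.1.asIdeal) m
        · simp only [hnin, hcop, hsp, not_true_eq_false, if_false, if_true, true_and]
          ring
        · have hT0 : dirichletTerm (chiStarRho C emb ρ m) w v.1.asIdeal = 0 := by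
            rw [dirichletTerm_chiStarRho, C.chi_of_not_isCoprime emb hcop, zero_mul]
          simp only [hnin, hcop, hsp, hT0, not_false_eq_true, if_false, if_true, and_false]
          ring
    · simp only [hrk, not_false_eq_true, if_true, and_false, if_false]
      ring
  · rintro v ⟨-, h⟩
    exact ((ord_fullPowPart_pos_iff r hn0 v).1 h).1.ne'
  · rintro v ⟨-, -, h⟩
    exact ((ord_fullPowPart_pos_iff r hn0 v).1 h).1.ne'
  · rintro v ⟨-, h⟩
    exact ((ord_fullPowPart_pos_iff r hn0 v).1 h).1.ne'
  · intro v hv h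
    exact (ord_radPart_pos_iff r hn0 v).1 hv (h ▸ dvd_zero r)

end Matching

/-! ### Bounds for the Euler factors -/

section Bounds

variable {F L : Type*} [Field F] [NumberField F] [Field L] [NumberField L] [Algebra F L]
  {r : ℕ} {S' : Set (HeightOneSpectrum (𝓞 L))}

lemma summable_idealOfExp_iff {T : Set (HeightOneSpectrum (𝓞 F))} {f : Ideal (𝓞 F) → ℂ} :
    (Summable fun k : {v : HeightOneSpectrum (𝓞 F) // v ∉ T} →₀ ℕ => f (idealOfExp T k)) ↔
      Summable fun n : idealsPrimeTo T => f n := by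
  rw [← (expEquiv T).summable_iff]
  rfl

lemma tsum_idealOfExp {T : Set (HeightOneSpectrum (𝓞 F))} (f : Ideal (𝓞 F) → ℂ) :
    ∑' k : {v : HeightOneSpectrum (𝓞 F) // v ∉ T} →₀ ℕ, f (idealOfExp T k) =
      ∑' n : idealsPrimeTo T, f n :=
  (expEquiv T).tsum_eq fun n : idealsPrimeTo T => f n

lemma summable_dirichletTerm_idealOfExp {T : Set (HeightOneSpectrum (𝓞 F))} (ρ : HeckeChar F)
    {z : ℂ} (hz : 1 < z.re) :
    Summable fun k : {v : HeightOneSpectrum (𝓞 F) // v ∉ T} →₀ ℕ =>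
      dirichletTerm ρ.onIdeal z (idealOfExp T k) := by
  rw [summable_idealOfExp_iff]
  exact summable_dirichletTerm (A := idealsPrimeTo T) (fun _ hn => hn.1)
    (fun _ _ => (ρ.norm_onIdeal _).le) hz

lemma norm_dirichletTerm_idealOfExp {T : Set (HeightOneSpectrum (𝓞 F))} (ρ : HeckeChar F)
    (z : ℂ) (k : {v : HeightOneSpectrum (𝓞 F) // v ∉ T} →₀ ℕ) :
    ‖dirichletTerm ρ.onIdeal z (idealOfExp T k)‖ =
      ∏ v ∈ k.support, ‖dirichletTerm ρ.onIdeal z v.1.asIdeal‖ ^ k v := by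
  rw [(ρ.isCompletelyMultiplicative_onIdeal.dirichletTerm z).map_idealOfExp k, norm_prod]
  exact Finset.prod_congr rfl fun v _ => norm_pow _ _

lemma norm_dirichletTerm_onIdeal {n : Ideal (𝓞 F)} (hn : n ≠ ⊥) (ρ : HeckeChar F) (z : ℂ) :
    ‖dirichletTerm ρ.onIdeal z n‖ = (Ideal.absNorm n : ℝ) ^ (-z.re) := by
  unfold dirichletTerm
  rw [norm_mul, ρ.norm_onIdeal, one_mul, norm_absNorm_cpow hn, Complex.neg_re]

lemma two_le_absNorm (v : HeightOneSpectrum (𝓞 F)) : (2 : ℝ) ≤ Ideal.absNorm v.asIdeal := by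
  exact_mod_cast one_lt_absNorm v

lemma rpow_neg_le_half (v : HeightOneSpectrum (𝓞 F)) {x : ℝ} (hx : 1 < x) :
    (Ideal.absNorm v.asIdeal : ℝ) ^ (-x) ≤ 1 / 2 := by
  have h2 := two_le_absNorm v
  calc (Ideal.absNorm v.asIdeal : ℝ) ^ (-x) ≤ (Ideal.absNorm v.asIdeal : ℝ) ^ (-1 : ℝ) :=
        Real.rpow_le_rpow_of_exponent_le (by linarith) (by linarith)
    _ ≤ 1 / 2 := by
        rw [Real.rpow_neg_one, one_div]
        exact inv_anti₀ two_pos h2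

lemma norm_shiftedValue (ψ : HeckeChar L) (s : ℂ) (v : HeightOneSpectrum (𝓞 F)) :
    ‖shiftedValue ψ s v‖ = (Ideal.absNorm v.asIdeal : ℝ) ^ (-(2 * s.re - 1)) := by
  unfold shiftedValue q
  rw [norm_mul, ψ.norm_onIdeal, one_mul, norm_absNorm_cpow v.ne_bot]
  congr 1
  simp

lemma norm_inv_q_le (v : HeightOneSpectrum (𝓞 F)) : ‖(q v)⁻¹‖ ≤ 1 / 2 := by
  unfold q
  rw [norm_inv, Complex.norm_natCast, one_div]
  exact inv_anti₀ two_pos (two_le_absNorm v)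

lemma norm_coprimeIndicator_le (v : HeightOneSpectrum (𝓞 F)) (m : Ideal (𝓞 L)) :
    ‖coprimeIndicator v m‖ ≤ 1 := by
  unfold coprimeIndicator
  split_ifs <;> simp

lemma norm_residualConstant_le (v : HeightOneSpectrum (𝓞 F)) :
    ‖residualConstant L v‖ ≤ 3 / 2 := by
  have h := norm_inv_q_le v
  unfold residualConstant
  split_ifs
  · refine (norm_add_le _ _).trans ?_
    rw [norm_one]
    linarith
  · refine (norm_sub_le _ _).trans ?_
    rw [norm_one]
    linarith

lemma norm_one_sub_residualConstant_le (v : HeightOneSpectrum (𝓞 F)) :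
    ‖1 - residualConstant L v‖ ≤ 1 := by
  have h := norm_inv_q_le v
  unfold residualConstant
  split_ifs
  · rw [sub_add_cancel_left, norm_neg]
    linarith
  · rw [sub_sub_cancel]
    linarith

lemma norm_residualConstant_sub_le (v : HeightOneSpectrum (𝓞 F)) (m : Ideal (𝓞 L)) :
    ‖residualConstant L v - coprimeIndicator v m * (q v)⁻¹‖ ≤ 3 / 2 := by
  obtain ⟨x, hx0, hx, hxq⟩ : ∃ x : ℝ, 0 ≤ x ∧ x ≤ 1 / 2 ∧ (q v)⁻¹ = (x : ℂ) := by
    refine ⟨((Ideal.absNorm v.asIdeal : ℕ) : ℝ)⁻¹, by positivity, ?_, by simp [q]⟩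
    rw [one_div]
    exact inv_anti₀ two_pos (two_le_absNorm v)
  unfold residualConstant coprimeIndicator
  rw [hxq]
  split_ifs
  · rw [one_mul, add_sub_cancel_right, norm_one]; norm_num
  · rw [zero_mul, sub_zero, ← Complex.ofReal_one, ← Complex.ofReal_add, Complex.norm_real,
      Real.norm_eq_abs, abs_le]
    constructor <;> linarith
  · rw [one_mul, ← Complex.ofReal_one, ← Complex.ofReal_sub, ← Complex.ofReal_sub,
      Complex.norm_real, Real.norm_eq_abs, abs_le]
    constructor <;> linarith
  · rw [zero_mul, sub_zero, ← Complex.ofReal_one, ← Complex.ofReal_sub, Complex.norm_real,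
      Real.norm_eq_abs, abs_le]
    constructor <;> linarith

lemma norm_geom_sum_le {Y : ℂ} (hY : ‖Y‖ ≤ 1 / 2) (k : ℕ) :
    ‖∑ i ∈ Finset.range k, Y ^ i‖ ≤ 1 + 2 * ‖Y‖ := by
  have h0 := norm_nonneg Y
  calc ‖∑ i ∈ Finset.range k, Y ^ i‖ ≤ ∑ i ∈ Finset.range k, ‖Y‖ ^ i := by
        refine (norm_sum_le _ _).trans (Finset.sum_le_sum fun i _ => (norm_pow _ _).le)
    _ ≤ (1 - ‖Y‖)⁻¹ := by
        rw [← tsum_geometric_of_lt_one h0 (by linarith)]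
        exact (summable_geometric_of_lt_one h0 (by linarith)).sum_le_tsum _
          fun i _ => by positivity
    _ ≤ 1 + 2 * ‖Y‖ := by
        -- For `0 ≤ y ≤ 1/2` one has `(1 + 2y)(1 - y) = 1 + y(1 - 2y) ≥ 1`.
        rw [inv_le_iff_one_le_mul₀ (by linarith)]
        nlinarith

/-- The bound is independent of `k` and `m`, and its excess over `1` is summable over the primes. -/
lemma norm_localFactor_le (ψ : HeckeChar L) {s : ℂ} (hs : 1 < s.re) (m : Ideal (𝓞 L))
    (v : HeightOneSpectrum (𝓞 F)) {k : ℕ} (hk : k ≠ 0) :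
    ‖localFactor r ψ s m v k‖ ≤ 1 + 6 * ‖shiftedValue ψ s v‖ := by
  classical
  have hY : ‖shiftedValue ψ s v‖ ≤ 1 / 2 := by
    rw [norm_shiftedValue]
    exact rpow_neg_le_half v (by linarith)
  rw [localFactor_eq]
  set Y := shiftedValue ψ s v
  have h0 := norm_nonneg Y
  have h1 : ‖1 - Y * (q v)⁻¹‖ ≤ 1 + ‖Y‖ := by
    refine (norm_sub_le _ _).trans ?_
    rw [norm_one, norm_mul]
    have := mul_le_of_le_one_right h0 ((norm_inv_q_le v).trans (by norm_num))
    linarith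
  have h2 := norm_geom_sum_le hY k
  have h3 : ‖if r ∣ k then Y ^ k * residualConstant L v else 0‖ ≤ 3 / 2 * ‖Y‖ := by
    split_ifs
    · rw [norm_mul, norm_pow, mul_comm]
      refine mul_le_mul (norm_residualConstant_le v) ?_ (by positivity) (by norm_num)
      exact pow_le_of_le_one h0 (by linarith) hk
    · rw [norm_zero]; positivity
  refine (norm_add_le _ _).trans ?_
  rw [norm_mul, norm_mul]
  have h4 : ‖coprimeIndicator v m‖ * (‖1 - Y * (q v)⁻¹‖ * ‖∑ i ∈ Finset.range k, Y ^ i‖) ≤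
      1 * ((1 + ‖Y‖) * (1 + 2 * ‖Y‖)) :=
    mul_le_mul (norm_coprimeIndicator_le v m)
      (mul_le_mul h1 h2 (norm_nonneg _) (by positivity)) (by positivity) zero_le_one
  -- With `y = ‖Y‖ ≤ 1/2`: `(1 + y)(1 + 2y) + 3y/2 ≤ 1 + 6y`.
  nlinarith

variable (C : SymbolChoices F L r S') (emb : L →+* ℂ) (ψ : HeckeChar L) (ρ : HeckeChar F)
  {s w : ℂ} (hs : 1 < s.re) (hw : 1 < w.re)
  (hr : r.Prime) [IsCyclotomicExtension {r} F L]
  (hS_r : ∀ P : HeightOneSpectrum (𝓞 L), (r : 𝓞 L) ∈ P.asIdeal → P ∈ S')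

include hr hS_r in
lemma norm_chi_prime_le {v : HeightOneSpectrum (𝓞 F)} (hv : v ∉ below F S') {m : Ideal (𝓞 L)}
    (hm : m ∈ idealsPrimeTo S') : ‖C.chi emb v.asIdeal m‖ ≤ 1 := by
  obtain ⟨ξ, hξ⟩ := exists_integral_primitiveRoot (L := L) F r hr.ne_zero
  exact C.norm_chi_le_one emb hr hξ hS_r (prime_mem_idealsPrimeTo hv) hm

include hr hS_r in
lemma norm_chiStarRho_le {m : Ideal (𝓞 L)} (hm : m ∈ idealsPrimeTo S') {n : Ideal (𝓞 F)}
    (hn : n ∈ idealsPrimeTo (below F S')) : ‖chiStarRho C emb ρ m n‖ ≤ 1 := by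
  obtain ⟨ξ, hξ⟩ := exists_integral_primitiveRoot (L := L) F r hr.ne_zero
  unfold chiStarRho
  rw [norm_mul, ρ.norm_onIdeal, mul_one]
  exact C.norm_chi_le_one emb hr hξ hS_r hn hm

include hr hS_r hs in
lemma norm_leftFactor_le {v : HeightOneSpectrum (𝓞 F)} (hv : v ∉ below F S') {m : Ideal (𝓞 L)}
    (hm : m ∈ idealsPrimeTo S') {k : ℕ} (hk : k ≠ 0) :
    ‖leftFactor C emb ψ ρ s w m v k‖ ≤
      ‖dirichletTerm ρ.onIdeal w v.asIdeal‖ ^ k * (1 + 6 * ‖shiftedValue ψ s v‖) := by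
  unfold leftFactor
  rw [if_neg hk, norm_mul, norm_mul, norm_pow, norm_pow]
  refine mul_le_mul ?_ (norm_localFactor_le ψ hs m v hk) (norm_nonneg _) (by positivity)
  exact mul_le_of_le_one_left (by positivity)
    (pow_le_one₀ (norm_nonneg _) (norm_chi_prime_le C emb hr hS_r hv hm))

lemma summable_shiftedValue (hs : 1 < s.re) {T : Set (HeightOneSpectrum (𝓞 F))} :
    Summable fun v : {v : HeightOneSpectrum (𝓞 F) // v ∉ T} => ‖shiftedValue ψ s v.1‖ := by
  simp only [norm_shiftedValue]
  exact summable_prime_rpow (by linarith)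

lemma prod_one_add_le_exp {ι : Type*} {y : ι → ℝ} (hy : ∀ i, 0 ≤ y i) (hs : Summable y)
    (A : Finset ι) : ∏ i ∈ A, (1 + y i) ≤ Real.exp (∑' i, y i) := by
  calc ∏ i ∈ A, (1 + y i) ≤ ∏ i ∈ A, Real.exp (y i) := by
        refine Finset.prod_le_prod (fun i _ => by linarith [hy i]) fun i _ => ?_
        rw [add_comm]
        exact Real.add_one_le_exp _
    _ ≤ Real.exp (∑' i, y i) := by
        rw [← Real.exp_sum]
        exact Real.exp_le_exp.2 (hs.sum_le_tsum A fun i _ => hy i)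

-- The factors `1 + 6‖Y‖` have a product bounded by one exponential, whatever the support of `k`.
-- What remains is the norm of a term of a convergent series over ideals of `F`, uniformly in `m`.
include hr hS_r hs in
lemma norm_prod_leftFactor_le {m : Ideal (𝓞 L)} (hm : m ∈ idealsPrimeTo S')
    (k : {v : HeightOneSpectrum (𝓞 F) // v ∉ below F S'} →₀ ℕ) :
    ‖k.prod fun v j => leftFactor C emb ψ ρ s w m v.1 j‖ ≤
      Real.exp (∑' v : {v : HeightOneSpectrum (𝓞 F) // v ∉ below F S'},
        6 * ‖shiftedValue ψ s v.1‖) *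
      ‖dirichletTerm ρ.onIdeal w (idealOfExp (below F S') k)‖ := by
  rw [Finsupp.prod, norm_prod, norm_dirichletTerm_idealOfExp]
  calc _ ≤ ∏ v ∈ k.support, (‖dirichletTerm ρ.onIdeal w v.1.asIdeal‖ ^ k v *
          (1 + 6 * ‖shiftedValue ψ s v.1‖)) :=
        Finset.prod_le_prod (fun _ _ => norm_nonneg _) fun v hv =>
          norm_leftFactor_le C emb ψ ρ hs hr hS_r v.2 hm (Finsupp.mem_support_iff.1 hv)
    _ ≤ _ := by
        rw [Finset.prod_mul_distrib, mul_comm]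
        refine mul_le_mul_of_nonneg_right ?_ (Finset.prod_nonneg fun _ _ => by positivity)
        exact prod_one_add_le_exp (fun v => by positivity)
          ((summable_shiftedValue ψ hs).mul_left 6) _

include hr hS_r hs hw in
lemma summable_prod_leftFactor {m : Ideal (𝓞 L)} (hm : m ∈ idealsPrimeTo S') :
    Summable fun k : {v : HeightOneSpectrum (𝓞 F) // v ∉ below F S'} →₀ ℕ =>
      k.prod fun v j => leftFactor C emb ψ ρ s w m v.1 j :=
  Summable.of_norm_bounded ((summable_dirichletTerm_idealOfExp ρ hw).norm.mul_left _)
    (norm_prod_leftFactor_le C emb ψ ρ hs hr hS_r hm)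

include hr hS_r hs hw in
/-- Absolute convergence of the double series. -/
lemma summable_double :
    Summable fun x : ({v : HeightOneSpectrum (𝓞 F) // v ∉ below F S'} →₀ ℕ) ×
        imaginaryIdeals F S' => dirichletTerm ψ.onIdeal s (x.2 : Ideal (𝓞 L)) *
          x.1.prod fun v j => leftFactor C emb ψ ρ s w x.2 v.1 j := by
  have h1 := (summable_dirichletTerm_idealOfExp (T := below F S') ρ hw).norm.mul_left
    (Real.exp (∑' v : {v : HeightOneSpectrum (𝓞 F) // v ∉ below F S'},
        6 * ‖shiftedValue ψ s v.1‖))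
  have h2 : Summable fun m : imaginaryIdeals F S' =>
      ‖dirichletTerm ψ.onIdeal s (m : Ideal (𝓞 L))‖ :=
    (summable_dirichletTerm (A := imaginaryIdeals F S')
      (fun _ hm => hm.1.1) (fun _ _ => (ψ.norm_onIdeal _).le) hs).norm
  refine Summable.of_norm_bounded (h1.mul_of_nonneg h2 (fun _ => by positivity)
    fun _ => norm_nonneg _) fun x => ?_
  rw [norm_mul, mul_comm]
  exact mul_le_mul_of_nonneg_right (norm_prod_leftFactor_le C emb ψ ρ hs hr hS_r x.2.2.1 x.1)
    (norm_nonneg _)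

/-- The extra factor `q_v` makes room for the constant `2` that bounds the linear forms; `2s - 2 +
w` still has real part greater than `1`. -/
lemma norm_shiftedValue_mul {v : HeightOneSpectrum (𝓞 F)} :
    ‖shiftedValue ψ s v‖ * ‖dirichletTerm ρ.onIdeal w v.asIdeal‖ * Ideal.absNorm v.asIdeal =
      ‖dirichletTerm ρ.onIdeal (2 * s - 2 + w) v.asIdeal‖ := by
  have h0 : (0 : ℝ) < Ideal.absNorm v.asIdeal := by linarith [two_le_absNorm v]
  rw [norm_shiftedValue, norm_dirichletTerm_onIdeal v.ne_bot, norm_dirichletTerm_onIdeal v.ne_bot]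
  nth_rewrite 3 [← Real.rpow_one (Ideal.absNorm v.asIdeal : ℝ)]
  rw [← Real.rpow_add h0, ← Real.rpow_add h0]
  congr 1
  simp
  ring

include hr hS_r in
lemma norm_innerMonomial_le {v : HeightOneSpectrum (𝓞 F)} (hv : v ∉ below F S')
    {m : Ideal (𝓞 L)} (hm : m ∈ idealsPrimeTo S') (k : ℕ) :
    ‖innerMonomial C emb ψ ρ s w m v k‖ ≤
      (‖shiftedValue ψ s v‖ * ‖dirichletTerm ρ.onIdeal w v.asIdeal‖) ^ k := by
  unfold innerMonomial
  rw [norm_mul, norm_mul, norm_pow, norm_pow, norm_pow, mul_pow]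
  exact mul_le_of_le_one_right (by positivity)
    (pow_le_one₀ (norm_nonneg _) (norm_chi_prime_le C emb hr hS_r hv hm))

lemma norm_innerLinear_le (v : HeightOneSpectrum (𝓞 F)) (k : ℕ) :
    ‖innerLinear L r v k‖ ≤ 1 := by
  unfold innerLinear
  split_ifs
  · simp
  · exact norm_one_sub_residualConstant_le v
  · simp

lemma norm_innerConstant_le (m : Ideal (𝓞 L)) (v : HeightOneSpectrum (𝓞 F)) (k : ℕ) :
    ‖innerConstant r m v k‖ ≤ 3 / 2 := by
  unfold innerConstant
  split_ifs
  · rw [norm_one]; norm_num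
  · exact norm_residualConstant_sub_le v m
  · rw [norm_neg]
    exact (norm_inv_q_le v).trans (by norm_num)

include hr hS_r hw in
lemma norm_dirichletTerm_chiStarRho_le {v : HeightOneSpectrum (𝓞 F)} (hv : v ∉ below F S')
    {m : Ideal (𝓞 L)} (hm : m ∈ idealsPrimeTo S') :
    ‖dirichletTerm (chiStarRho C emb ρ m) w v.asIdeal‖ ≤ 1 / 2 :=
  (norm_dirichletTerm_le v.ne_bot (norm_chiStarRho_le C emb ρ hr hS_r hm
    (prime_mem_idealsPrimeTo hv)) w).trans (rpow_neg_le_half v hw)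

include hr hS_r hw in
lemma norm_innerFactor_le {v : HeightOneSpectrum (𝓞 F)} (hv : v ∉ below F S')
    {m : Ideal (𝓞 L)} (hm : m ∈ idealsPrimeTo S') {k : ℕ} (hk : k ≠ 0) :
    ‖innerFactor C emb ψ ρ s w m v k‖ ≤
      ‖dirichletTerm ρ.onIdeal (2 * s - 2 + w) v.asIdeal‖ ^ k := by
  unfold innerFactor
  rw [norm_mul, ← norm_shiftedValue_mul (s := s) (w := w) ψ, mul_pow]
  refine mul_le_mul (norm_innerMonomial_le C emb ψ ρ hr hS_r hv hm k) ?_ (norm_nonneg _)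
    (by positivity)
  have h2 := two_le_absNorm v
  -- The linear form has norm at most `2`, and `2 ≤ q_v ≤ q_v^k`.
  calc _ ≤ 1 / 2 * 1 + 3 / 2 := by
        refine (norm_add_le _ _).trans (add_le_add ?_ (norm_innerConstant_le m v k))
        rw [norm_mul]
        exact mul_le_mul (norm_dirichletTerm_chiStarRho_le C emb ρ hw hr hS_r hv hm)
          (norm_innerLinear_le v k) (norm_nonneg _) (by norm_num)
    _ ≤ (Ideal.absNorm v.asIdeal : ℝ) := by linarith
    _ ≤ (Ideal.absNorm v.asIdeal : ℝ) ^ k := le_self_pow₀ (by linarith) hk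

include hr hS_r hs hw in
lemma summable_prod_innerFactor {m : Ideal (𝓞 L)} (hm : m ∈ idealsPrimeTo S') :
    Summable fun k : {v : HeightOneSpectrum (𝓞 F) // v ∉ below F S'} →₀ ℕ =>
      k.prod fun v j => innerFactor C emb ψ ρ s w m v.1 j := by
  refine Summable.of_norm_bounded (summable_dirichletTerm_idealOfExp ρ
    (z := 2 * s - 2 + w) (by simp; linarith)).norm fun k => ?_
  rw [Finsupp.prod, norm_prod, norm_dirichletTerm_idealOfExp]
  exact Finset.prod_le_prod (fun _ _ => norm_nonneg _) fun v hv =>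
    norm_innerFactor_le C emb ψ ρ hw hr hS_r v.2 hm (Finsupp.mem_support_iff.1 hv)

-- Applies `tsum_eq_geom_mul_tsum` to the recursion of `leftFactor_succ`; both auxiliary series are
-- dominated by a geometric series of ratio `‖Y‖ ‖R‖ < 1`.
include hr hS_r hs hw in
lemma tsum_leftFactor {v : HeightOneSpectrum (𝓞 F)} (hv : v ∉ below F S')
    {m : Ideal (𝓞 L)} (hm : m ∈ idealsPrimeTo S')
    (hsum : Summable fun j => leftFactor C emb ψ ρ s w m v j) :
    ∑' j, leftFactor C emb ψ ρ s w m v j =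
      (∑' j : ℕ, dirichletTerm (chiStarRho C emb ρ m) w v.asIdeal ^ j) *
        ∑' j, innerFactor C emb ψ ρ s w m v j := by
  set x := ‖shiftedValue ψ s v‖ * ‖dirichletTerm ρ.onIdeal w v.asIdeal‖ with hx
  have hx0 : 0 ≤ x := by positivity
  have hx1 : x < 1 := by
    have h1 : ‖shiftedValue ψ s v‖ ≤ 1 / 2 := by
      rw [norm_shiftedValue]
      exact rpow_neg_le_half v (by linarith)
    have h2 : ‖dirichletTerm ρ.onIdeal w v.asIdeal‖ ≤ 1 / 2 := by
      rw [norm_dirichletTerm_onIdeal v.ne_bot]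
      exact rpow_neg_le_half v hw
    have := mul_le_mul h1 h2 (norm_nonneg _) (by norm_num)
    linarith
  have hgeom := summable_geometric_of_lt_one hx0 hx1
  have ht : Summable fun j => innerMonomial C emb ψ ρ s w m v j * innerLinear L r v j := by
    refine Summable.of_norm_bounded hgeom fun j => ?_
    rw [norm_mul]
    exact (mul_le_of_le_one_right (norm_nonneg _) (norm_innerLinear_le v j)).trans
      (norm_innerMonomial_le C emb ψ ρ hr hS_r hv hm j)
  have hu : Summable fun j => innerMonomial C emb ψ ρ s w m v j * innerConstant r m v j := by
    refine Summable.of_norm_bounded (hgeom.mul_right (3 / 2)) fun j => ?_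
    rw [norm_mul]
    exact mul_le_mul (norm_innerMonomial_le C emb ψ ρ hr hS_r hv hm j)
      (norm_innerConstant_le m v j) (norm_nonneg _) (by positivity)
  rw [tsum_eq_geom_mul_tsum
    ((norm_dirichletTerm_chiStarRho_le C emb ρ hw hr hS_r hv hm).trans_lt (by norm_num))
    hsum ht hu (by simp [leftFactor_zero, innerMonomial, innerConstant])
    (leftFactor_succ C emb ψ ρ s w hr hS_r hv hm)]
  congr 1
  refine tsum_congr fun j => ?_
  unfold innerFactor
  ring

include hr hS_r hs hw in
/-- For fixed `m`, the sum over `n` is an `L`-series times the inner sum of `Z̃`. -/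
lemma tsum_prod_leftFactor {m : Ideal (𝓞 L)} (hm : m ∈ idealsPrimeTo S') :
    ∑' k : {v : HeightOneSpectrum (𝓞 F) // v ∉ below F S'} →₀ ℕ,
        (k.prod fun v j => leftFactor C emb ψ ρ s w m v.1 j) =
      LSer (below F S') (chiStarRho C emb ρ m) w *
        ∑' k : {v : HeightOneSpectrum (𝓞 F) // v ∉ below F S'} →₀ ℕ,
          k.prod fun v j => innerFactor C emb ψ ρ s w m v.1 j := by
  have hmul := isCompletelyMultiplicative_chiStarRho C emb ρ w hr hS_r hm
  have hL : ∀ k : {v : HeightOneSpectrum (𝓞 F) // v ∉ below F S'} →₀ ℕ,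
      (k.prod fun v j => dirichletTerm (chiStarRho C emb ρ m) w v.1.asIdeal ^ j) =
        dirichletTerm (chiStarRho C emb ρ m) w (idealOfExp (below F S') k) :=
    fun k => (hmul.map_idealOfExp k).symm
  have hLs : Summable fun k : {v : HeightOneSpectrum (𝓞 F) // v ∉ below F S'} →₀ ℕ =>
      k.prod fun v j => dirichletTerm (chiStarRho C emb ρ m) w v.1.asIdeal ^ j := by
    simp only [hL]
    rw [summable_idealOfExp_iff]
    exact summable_dirichletTerm (A := idealsPrimeTo (below F S')) (fun _ hn => hn.1)
      (fun _ hn => norm_chiStarRho_le C emb ρ hr hS_r hm hn) hw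
  have hfs := summable_prod_leftFactor C emb ψ ρ hs hw hr hS_r hm
  have hf0 : ∀ v : {v : HeightOneSpectrum (𝓞 F) // v ∉ below F S'},
      leftFactor C emb ψ ρ s w m v.1 0 = 1 := fun v => leftFactor_zero C emb ψ ρ s w m v.1
  rw [tsum_finsuppProd_eq_mul hf0 (fun v => pow_zero _)
    (fun v => innerFactor_zero C emb ψ ρ s w m v.1) hfs hLs
    (summable_prod_innerFactor C emb ψ ρ hs hw hr hS_r hm) fun v =>
      tsum_leftFactor C emb ψ ρ hs hw hr hS_r v.2 hm (summable_of_finsuppProd hf0 hfs v)]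
  congr 1
  rw [LSer, ← tsum_idealOfExp]
  exact tsum_congr hL

end Bounds

/-! ### Exchange of summations and the factorization. -/

section Final

variable {F L : Type*} [Field F] [NumberField F] [Field L] [NumberField L] [Algebra F L]
  {r : ℕ} {S' : Set (HeightOneSpectrum (𝓞 L))}
  (C : SymbolChoices F L r S') (emb : L →+* ℂ) (ψ : HeckeChar L) (ρ : HeckeChar F) {s w : ℂ}
  (hs : 1 < s.re) (hw : 1 < w.re)
  [IsTotallyReal F] [IsCyclotomicExtension {r} F L] (hr : r.Prime) (hr2 : r ≠ 2)
  (hdeg : Module.finrank F L = 2)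
  (hS_r : ∀ P : HeightOneSpectrum (𝓞 L), (r : 𝓞 L) ∈ P.asIdeal → P ∈ S')

/-- The argument has real part `r (Re s + Re w - 1) + 1 > 1`. -/
lemma summable_normalizingChar (hs : 1 < s.re) (hw : 1 < w.re) (hr : r.Prime) :
    Summable fun m : idealsPrimeTo S' =>
      dirichletTerm (normalizingChar ψ ρ r) (r * s + r * w + 1 - r) (m : Ideal (𝓞 L)) := by
  refine summable_dirichletTerm (fun _ hm => hm.1) (fun m _ => ?_) ?_
  · unfold normalizingChar
    rw [norm_mul, norm_pow, norm_pow, ψ.norm_onIdeal, ρ.norm_onIdeal, one_pow, one_mul]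
  · have h : (2 : ℝ) ≤ r := by exact_mod_cast hr.two_le
    simp
    nlinarith

include hs hw hr hr2 hdeg hS_r

lemma tsum_innerTerm {m : Ideal (𝓞 L)} (hm : m ∈ imaginaryIdeals F S') :
    ∑' h : idealsPrimeTo (below F S'), innerTerm C emb ψ ρ s w m (h : Ideal (𝓞 F)) =
      ∑' k : {v : HeightOneSpectrum (𝓞 F) // v ∉ below F S'} →₀ ℕ,
        k.prod fun v j => innerFactor C emb ψ ρ s w m v.1 j := by
  rw [← tsum_idealOfExp]
  exact tsum_congr (innerTerm_idealOfExp C emb ψ ρ s w hr hr2 hdeg hS_r hm)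

lemma summable_innerTerm {m : Ideal (𝓞 L)} (hm : m ∈ imaginaryIdeals F S') :
    Summable fun h : idealsPrimeTo (below F S') =>
      innerTerm C emb ψ ρ s w m (h : Ideal (𝓞 F)) := by
  rw [← summable_idealOfExp_iff]
  exact (summable_prod_innerFactor C emb ψ ρ hs hw hr hS_r hm.1).congr fun k =>
    (innerTerm_idealOfExp C emb ψ ρ s w hr hr2 hdeg hS_r hm k).symm

lemma termZtilde_eq {m : Ideal (𝓞 L)} (hm : m ∈ imaginaryIdeals F S') :
    termZtilde C emb ψ ρ s w m =
      ∑' k : {v : HeightOneSpectrum (𝓞 F) // v ∉ below F S'} →₀ ℕ, dirichletTerm ψ.onIdeal s m *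
        k.prod fun v j => leftFactor C emb ψ ρ s w m v.1 j := by
  rw [tsum_mul_left, tsum_prod_leftFactor C emb ψ ρ hs hw hr hS_r hm.1]
  unfold termZtilde dirichletTerm
  rw [tsum_innerTerm C emb ψ ρ hs hw hr hr2 hdeg hS_r hm]
  ring

/-- Up to the constant `L_S(2s, ψ)`, the terms are the sums over `m` of the absolutely convergent
double series; `summable_termZtilde` uses the sums over `n` instead. -/
lemma summable_termZ :
    Summable fun n : idealsPrimeTo (below F S') => termZ C emb ψ ρ s w (n : Ideal (𝓞 F)) := by
  rw [← summable_idealOfExp_iff]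
  exact ((summable_double C emb ψ ρ hs hw hr hS_r).prod.mul_left _).congr fun k =>
    (termZ_idealOfExp C emb ψ ρ s w hr hr2 hdeg hS_r hs k).symm

lemma summable_termZtilde :
    Summable fun m : imaginaryIdeals F S' => termZtilde C emb ψ ρ s w (m : Ideal (𝓞 L)) :=
  (summable_double C emb ψ ρ hs hw hr hS_r).prod_symm.prod.congr fun m =>
    (termZtilde_eq C emb ψ ρ hs hw hr hr2 hdeg hS_r m.2).symm

lemma tsum_termZ :
    ∑' n : idealsPrimeTo (below F S'), termZ C emb ψ ρ s w (n : Ideal (𝓞 F)) =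
      LSer (below F S') (fun n => ψ.onIdeal (extIdeal L n)) (2 * s) *
        ∑' m : imaginaryIdeals F S', termZtilde C emb ψ ρ s w (m : Ideal (𝓞 L)) := by
  rw [← tsum_idealOfExp]
  simp only [termZ_idealOfExp C emb ψ ρ s w hr hr2 hdeg hS_r hs]
  rw [tsum_mul_left]
  refine congrArg _ ?_
  -- The sum over `m` becomes the outer one, and the inner sum over exponents is then a term of the
  -- second series by `termZtilde_eq`.
  refine (Summable.tsum_comm (f := fun (m : imaginaryIdeals F S')
    (k : {v : HeightOneSpectrum (𝓞 F) // v ∉ below F S'} →₀ ℕ) =>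
      dirichletTerm ψ.onIdeal s (m : Ideal (𝓞 L)) *
        k.prod fun v j => leftFactor C emb ψ ρ s w m v.1 j)
    (summable_double C emb ψ ρ hs hw hr hS_r).prod_symm).trans ?_
  exact tsum_congr fun m => (termZtilde_eq C emb ψ ρ hs hw hr hr2 hdeg hS_r m.2).symm

end Final

end DoubleDirichlet

end

theorem proposition3p4
    (F L : Type*) [Field F] [NumberField F] [IsTotallyReal F] [Field L] [NumberField L]
    [Algebra F L]
    (r : ℕ) (hr : r.Prime) (hr_odd : r ≠ 2) [IsCyclotomicExtension {r} F L]
    (hdeg : Module.finrank F L = 2)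
    (S' : Set (HeightOneSpectrum (𝓞 L))) (hS_fin : S'.Finite)
    (hS_r : ∀ P : HeightOneSpectrum (𝓞 L), (r : 𝓞 L) ∈ P.asIdeal → P ∈ S')
    (hS_conj : IsConjStable F S')
    (hS_class : IsPrincipalIdealRing (S'.integer L))
    (ψ : HeckeChar L) (ρ : HeckeChar F)
    (hψ : ∀ P ∉ S', ψ.IsUnramifiedAt P)
    (hρ : ∀ v ∉ below F S', ρ.IsUnramifiedAt v)
    (C : SymbolChoices F L r S') (emb : L →+* ℂ)
    (s w : ℂ) (hs : 1 < s.re) (hw : 1 < w.re) :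
    -- all the series that occur in the two sides converge absolutely
    (Summable fun m : idealsPrimeTo S' =>
        dirichletTerm (normalizingChar ψ ρ r) (r * s + r * w + 1 - r) (m : Ideal (𝓞 L))) ∧
    (∀ n ∈ idealsPrimeTo (below F S'), Summable fun m : idealsPrimeTo S' =>
        dirichletTerm (fun m => C.chi emb (powFreePart r n) m * ψ.onIdeal m) s
          (m : Ideal (𝓞 L))) ∧
    (Summable fun n : idealsPrimeTo (below F S') =>
        termZ C emb ψ ρ s w (n : Ideal (𝓞 F))) ∧
    (Summable fun n : idealsPrimeTo (below F S') =>
        dirichletTerm (fun n => ψ.onIdeal (extIdeal L n)) (2 * s) (n : Ideal (𝓞 F))) ∧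
    (∀ m ∈ imaginaryIdeals F S', Summable fun n : idealsPrimeTo (below F S') =>
        dirichletTerm (chiStarRho C emb ρ m) w (n : Ideal (𝓞 F))) ∧
    (∀ m ∈ imaginaryIdeals F S', Summable fun h : idealsPrimeTo (below F S') =>
        innerTerm C emb ψ ρ s w m (h : Ideal (𝓞 F))) ∧
    (Summable fun m : imaginaryIdeals F S' =>
        termZtilde C emb ψ ρ s w (m : Ideal (𝓞 L))) ∧
    -- the factorization
    Z C emb ψ ρ s w =
      LSer (below F S') (fun n => ψ.onIdeal (extIdeal L n)) (2 * s) * Ztilde C emb ψ ρ s w := by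
  refine ⟨summable_normalizingChar ψ ρ hs hw hr, fun n hn =>
      summable_twistedTerm C emb ψ s hr hdeg hS_r hs hn,
    summable_termZ C emb ψ ρ hs hw hr hr_odd hdeg hS_r, summable_restrictedTerm ψ s hs,
    fun m hm => summable_dirichletTerm (fun _ hn => hn.1)
      (fun _ hn => norm_chiStarRho_le C emb ρ hr hS_r hm.1 hn) hw,
    fun m hm => summable_innerTerm C emb ψ ρ hs hw hr hr_odd hdeg hS_r hm,
    summable_termZtilde C emb ψ ρ hs hw hr hr_odd hdeg hS_r, ?_⟩
  unfold Z Ztilde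
  rw [tsum_termZ C emb ψ ρ hs hw hr hr_odd hdeg hS_r, mul_left_comm]
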